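/- Let $N\ge 2$, $s\in(0,1)$, $m>0$, and let $g:\mathbb R\to\mathbb R$ be continuous and odd with $\lim_{t\to 0} g(t)/t=0$, $\lim_{|t|\to\infty} g(t)/|t|^{1+4s/N}=0$, and $G(t_0)>0$ for some $t_0>0$, where $G(t)=\int_0^t g(\tau)\,d\tau$. Let $H^s_r(\mathbb R^N)$ be the space of real-valued radial functions in $H^s(\mathbb R^N)$, with the norm $\|u\|^2=\|(-\Delta)^{s/2}u\|_2^2+\|u\|_2^2$. On $\mathbb R\times H^s_r(\mathbb R^N)$ define $$\mathcal I(\lambda,u)=\tfrac12\int_{\mathbb R^N}|(-\Delta)^{s/2}u|^2\,dx-\int_{\mathbb R^N}G(u)\,dx+\tfrac{e^\lambda}{2}\big(\|u\|_2^2-m\big),$$ $$\mathcal P(\lambda,u)=\tfrac{N-2s}{2}\int_{\mathbb R^N}|(-\Delta)^{s/2}u|^2\,dx+N\int_{\mathbb R^N}\Big(\tfrac{e^\lambda}{2}u^2-G(u)\Big)\,dx,$$ and for $b,c\in\mathbb R$ put $$K_b^{PSP}=\{(\lambda,u)\mid \mathcal I(\lambda,u)=b,\ \partial_\lambda\mathcal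 I(\lambda,u)=0,\ \partial_u\mathcal I(\lambda,u)=0,\ \mathcal P(\lambda,u)=0\},\qquad \mathcal I^c=\{(\lambda,u)\mid\mathcal I(\lambda,u)\le c\}.$$ Let $b<0$, let $\mathcal O$ be a neighborhood of $K_b^{PSP}$ in $\mathbb R\times H^s_r(\mathbb R^N)$, and let $\bar\varepsilon>0$. Then there exist $\varepsilon\in(0,\bar\varepsilon)$ and a continuous map $\eta:[0,1]\times(\mathbb R\times H^s_r(\mathbb R^N))\to\mathbb R\times H^s_r(\mathbb R^N)$ such that 1. $\eta(0,\cdot,\cdot)$ is the identity; 2. $\eta(t,\lambda,u)=(\lambda,u)$ for all $t\in[0,1]$ and $(\lambda,u)\in\mathcal I^{b-\bar\varepsilon}$; 3. for every $(\lambda,u)$ the function $t\mapsto\mathcal I(\eta(t,\lambda,u))$ is non-increasing on $[0,1]$; in particular $\mathcal I(\eta(t,\lambda,u))\le\mathcal I(\lambda,u)$ for all $t\in[0,1]$; 4. if $K_b^{PSP}=\emptyset$, then $\eta(1,\mathcal I^{b+\varepsilon})\subseteq\mathcal I^{b-\varepsilon}$; 5. if $K_b^{PSP}\ne\emptyset$,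 then $\eta(1,\mathcal I^{b+\varepsilon}\setminus\mathcal O)\subseteq\mathcal I^{b-\varepsilon}$ and $\eta(1,\mathcal I^{b+\varepsilon})\subseteq\mathcal I^{b-\varepsilon}\cup\mathcal O$; 6. $\eta(t,\cdot,\cdot)$ is $\mathbb Z_2$-equivariant for every $t\in[0,1]$: writing $\eta=(\eta_1,\eta_2)$, one has $\eta_1(t,\lambda,-u)=\eta_1(t,\lambda,u)$ and $\eta_2(t,\lambda,-u)=-\eta_2(t,\lambda,u)$. -/

import Mathlib

open MeasureTheory Set Filter Topology
open scoped FourierTransform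

noncomputable section

namespace FracNLS

/-- Euclidean space `ℝ^N`. -/
abbrev RN (N : ℕ) : Type := EuclideanSpace ℝ (Fin N)

/-- The Fourier transform `L²(ℝ^N; ℝ) → L²(ℝ^N; ℂ)`, `û(ξ) = ∫ e^{-2πi⟨x,ξ⟩} u(x) dx`
(extended from Schwartz functions by Plancherel). The unitary transform with kernel
`(2π)^{-N/2} e^{-i⟨x,ξ⟩}` is obtained from it by the substitution `ξ ↦ ξ / (2π)`, so that the symbol
`|ξ|^s` of the latter is `(2π|ξ|)^s` here. -/
def fourierL2 (N : ℕ) : Lp ℝ 2 (volume : Measure (RN N)) →ₗ[ℝ] Lp ℂ 2 (volume : Measure (RN N)) :=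
  ((Lp.fourierTransformₗᵢ (RN N) ℂ).toLinearEquiv.toLinearMap.restrictScalars ℝ).comp
    (Complex.ofRealCLM.compLpL 2 volume).toLinearMap

/-- The function `ξ ↦ (2π|ξ|)^s û(ξ)`. -/
def symbolFourier (N : ℕ) (s : ℝ) (u : Lp ℝ 2 (volume : Measure (RN N))) : RN N → ℂ :=
  fun ξ => ((2 * Real.pi * ‖ξ‖) ^ s : ℝ) • fourierL2 N u ξ

theorem symbolFourier_add (N : ℕ) (s : ℝ) (u v : Lp ℝ 2 (volume : Measure (RN N))) :
    symbolFourier N s (u + v) =ᵐ[volume] symbolFourier N s u + symbolFourier N s v := by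
  have h := Lp.coeFn_add (fourierL2 N u) (fourierL2 N v)
  rw [← map_add] at h
  filter_upwards [h] with ξ hξ
  simp only [symbolFourier, Pi.add_apply, hξ, smul_add]

theorem symbolFourier_smul (N : ℕ) (s c : ℝ) (u : Lp ℝ 2 (volume : Measure (RN N))) :
    symbolFourier N s (c • u) =ᵐ[volume] c • symbolFourier N s u := by
  have h := Lp.coeFn_smul c (fourierL2 N u)
  rw [← map_smul] at h
  filter_upwards [h] with ξ hξ
  simp only [symbolFourier, Pi.smul_apply, hξ]
  exact smul_comm _ _ _

/-- The real functions `u ∈ L²(ℝ^N)` that are radial, `u(x) = f(|x|)` for a.e. `x`, and satisfy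
`∫ |ξ|^{2s} |û(ξ)|² dξ < ∞`. -/
def hsrSubmodule (N : ℕ) (s : ℝ) : Submodule ℝ (Lp ℝ 2 (volume : Measure (RN N))) where
  carrier := {u | (∃ f : ℝ → ℝ, ∀ᵐ x : RN N, u x = f ‖x‖) ∧
    MemLp (symbolFourier N s u) 2 (volume : Measure (RN N))}
  add_mem' := by
    rintro u v ⟨⟨f, hf⟩, hu⟩ ⟨⟨f', hf'⟩, hv⟩
    refine ⟨⟨fun r => f r + f' r, ?_⟩, (memLp_congr_ae (symbolFourier_add N s u v)).2 (hu.add hv)⟩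
    filter_upwards [hf, hf', Lp.coeFn_add u v] with x h1 h2 h3
    rw [h3, Pi.add_apply, h1, h2]
  zero_mem' := by
    refine ⟨⟨fun _ => 0, Lp.coeFn_zero _ _ _⟩, ?_⟩
    have h := symbolFourier_smul N s 0 0
    rw [zero_smul, zero_smul] at h
    exact (memLp_congr_ae h).2 MemLp.zero
  smul_mem' := by
    rintro c u ⟨⟨f, hf⟩, hu⟩
    refine ⟨⟨fun r => c * f r, ?_⟩,
      (memLp_congr_ae (symbolFourier_smul N s c u)).2 (hu.const_smul c)⟩
    filter_upwards [hf, Lp.coeFn_smul c u] with x h1 h2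
    rw [h2, Pi.smul_apply, h1, smul_eq_mul]

/-- The space `H^s_r(ℝ^N)` of real radial functions in the Sobolev space `H^s(ℝ^N)`. It is a new
type, so that it does not inherit the `L²` norm; its norm is installed below. -/
def Hsr (N : ℕ) (s : ℝ) : Type := hsrSubmodule N s

variable {N : ℕ} {s : ℝ}

instance : AddCommGroup (Hsr N s) := inferInstanceAs (AddCommGroup (hsrSubmodule N s))

instance : Module ℝ (Hsr N s) := inferInstanceAs (Module ℝ (hsrSubmodule N s))

/-- The inclusion `H^s_r(ℝ^N) → L²(ℝ^N)`. -/
def Hsr.toL2 : Hsr N s →ₗ[ℝ] Lp ℝ 2 (volume : Measure (RN N)) := (hsrSubmodule N s).subtype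

/-- An element of `H^s_r(ℝ^N)` as a function (defined up to null sets). -/
instance : CoeFun (Hsr N s) (fun _ => RN N → ℝ) := ⟨fun u => Hsr.toL2 u⟩

theorem Hsr.memLp_symbolFourier (u : Hsr N s) :
    MemLp (symbolFourier N s (Hsr.toL2 u)) 2 (volume : Measure (RN N)) := u.2.2

/-- The operator `(-Δ)^{s/2} : H^s_r(ℝ^N) → L²(ℝ^N)`, the Fourier multiplier with symbol `|ξ|^s`. -/
def fracLap : Hsr N s →ₗ[ℝ] Lp ℂ 2 (volume : Measure (RN N)) where
  toFun u := 𝓕⁻ (Hsr.memLp_symbolFourier u).toLp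
  map_add' u v := by
    rw [← FourierTransform.fourierInv_add, ← MemLp.toLp_add]
    congr 1
    refine MemLp.toLp_congr _ _ ?_
    rw [map_add]
    exact symbolFourier_add N s _ _
  map_smul' c u := by
    have h : (Hsr.memLp_symbolFourier (c • u)).toLp =
        (c : ℂ) • (Hsr.memLp_symbolFourier u).toLp := by
      rw [← MemLp.toLp_const_smul]
      refine MemLp.toLp_congr _ _ ?_
      rw [map_smul]
      exact symbolFourier_smul N s c _
    rw [h, FourierTransform.fourierInv_smul, RingHom.id_apply]
    exact Complex.coe_smul c _

/-- The graph map `u ↦ ((-Δ)^{s/2} u, u)`, which carries the norm of `H^s_r(ℝ^N)`. -/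
def Hsr.graph : Hsr N s →ₗ[ℝ]
    WithLp 2 (Lp ℂ 2 (volume : Measure (RN N)) × Lp ℝ 2 (volume : Measure (RN N))) :=
  (WithLp.linearEquiv 2 ℝ _).symm.toLinearMap.comp (fracLap.prod Hsr.toL2)

theorem Hsr.graph_injective : Function.Injective (Hsr.graph : Hsr N s →ₗ[ℝ] _) := by
  intro u v h
  have h2 : Hsr.toL2 u = Hsr.toL2 v := congrArg (fun z => (WithLp.ofLp z).2) h
  exact Subtype.ext h2

/-- The norm `‖u‖² = ‖(-Δ)^{s/2} u‖₂² + ‖u‖₂²`. -/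
instance : NormedAddCommGroup (Hsr N s) :=
  NormedAddCommGroup.induced (Hsr N s) _ Hsr.graph Hsr.graph_injective

instance : NormedSpace ℝ (Hsr N s) := NormedSpace.induced ℝ (Hsr N s) _ Hsr.graph

/-- `∫ |(-Δ)^{s/2} u|²`. -/
def kinetic (u : Hsr N s) : ℝ := ∫ x : RN N, ‖fracLap u x‖ ^ 2

/-- `‖u‖₂² = ∫ u²`. -/
def mass (u : Hsr N s) : ℝ := ∫ x : RN N, u x ^ 2

/-- Plancherel: `∫ |(-Δ)^{s/2} u|² = ∫ (2π|ξ|)^{2s} |û(ξ)|² dξ`. -/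
theorem kinetic_eq_fourier (u : Hsr N s) :
    kinetic u = ∫ ξ : RN N, (2 * Real.pi * ‖ξ‖) ^ (2 * s) * ‖fourierL2 N (Hsr.toL2 u) ξ‖ ^ 2 := by
  have key : ∀ f : Lp ℂ 2 (volume : Measure (RN N)), ∫ x, ‖f x‖ ^ 2 = ‖f‖ ^ 2 := by
    intro f
    have h := inner_self_eq_norm_sq (𝕜 := ℂ) f
    rw [L2.inner_def] at h
    rw [← h, ← integral_re (L2.integrable_inner f f)]
    exact integral_congr_ae (.of_forall fun x => (inner_self_eq_norm_sq (𝕜 := ℂ) (f x)).symm)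
  have h1 : ‖fracLap u‖ = ‖(Hsr.memLp_symbolFourier u).toLp‖ :=
    (Lp.fourierTransformₗᵢ (RN N) ℂ).symm.norm_map _
  rw [kinetic, key, h1, ← key]
  refine integral_congr_ae ?_
  filter_upwards [(Hsr.memLp_symbolFourier u).coeFn_toLp] with ξ hξ
  have h0 : 0 ≤ 2 * Real.pi * ‖ξ‖ := by positivity
  rw [hξ, symbolFourier, norm_smul, mul_pow, Real.norm_eq_abs, sq_abs, mul_comm 2 s,
    Real.rpow_mul h0, Real.rpow_two]

theorem Hsr.norm_sq_eq (u : Hsr N s) : ‖u‖ ^ 2 = kinetic u + mass u := by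
  have h : ‖u‖ ^ 2 = ‖fracLap u‖ ^ 2 + ‖Hsr.toL2 u‖ ^ 2 :=
    WithLp.prod_norm_sq_eq_of_L2 (Hsr.graph u)
  have key : ∀ {F : Type} [NormedAddCommGroup F] [InnerProductSpace ℝ F]
      (f : Lp F 2 (volume : Measure (RN N))), ‖f‖ ^ 2 = ∫ x, ‖f x‖ ^ 2 := by
    intro F _ _ f
    have h := real_inner_self_eq_norm_sq f
    rw [L2.inner_def] at h
    rw [← h]
    exact integral_congr_ae (.of_forall fun x => real_inner_self_eq_norm_sq (f x))
  rw [h, key, key]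
  simp only [kinetic, mass, Real.norm_eq_abs, sq_abs]

/-- The primitive `G(t) = ∫₀ᵗ g(τ) dτ`. -/
def primitive (g : ℝ → ℝ) (t : ℝ) : ℝ := ∫ τ in (0 : ℝ)..t, g τ

/-- The functional
`𝓘(μ, u) = ½ ∫ |(-Δ)^{s/2} u|² - ∫ G(u) + (e^μ / 2) (‖u‖₂² - m)` on `ℝ × H^s_r(ℝ^N)`. -/
def lagrangian (g : ℝ → ℝ) (m : ℝ) (z : ℝ × Hsr N s) : ℝ :=
  kinetic z.2 / 2 - (∫ x : RN N, primitive g (z.2 x)) + Real.exp z.1 / 2 * (mass z.2 - m)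

/-- The Pohozaev functional
`𝓟(μ, u) = ((N - 2s) / 2) ∫ |(-Δ)^{s/2} u|² + N ∫ ((e^μ / 2) u² - G(u))` on `ℝ × H^s_r(ℝ^N)`. -/
def pohozaev (g : ℝ → ℝ) (z : ℝ × Hsr N s) : ℝ :=
  (N - 2 * s) / 2 * kinetic z.2 +
    N * ∫ x : RN N, (Real.exp z.1 / 2 * z.2 x ^ 2 - primitive g (z.2 x))

/-- The set `K_b^{PSP}` of critical points of `𝓘` at level `b` that satisfy the Pohozaev
identity. -/
def critPSP (N : ℕ) (s : ℝ) (g : ℝ → ℝ) (m b : ℝ) : Set (ℝ × Hsr N s) :=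
  {z | lagrangian g m z = b ∧
    HasDerivAt (fun μ : ℝ => lagrangian g m (μ, z.2)) 0 z.1 ∧
    HasFDerivAt (fun v : Hsr N s => lagrangian g m (z.1, v)) (0 : Hsr N s →L[ℝ] ℝ) z.2 ∧
    pohozaev g z = 0}

/-- The sublevel set `𝓘^c = {𝓘 ≤ c}`. -/
def sublevel (N : ℕ) (s : ℝ) (g : ℝ → ℝ) (m c : ℝ) : Set (ℝ × Hsr N s) :=
  {z | lagrangian g m z ≤ c}

/-- The action `(μ, u) ↦ (μ, -u)` of the nontrivial element of `ℤ₂` on `ℝ × H^s_r(ℝ^N)`. -/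
def reflect (z : ℝ × Hsr N s) : ℝ × Hsr N s := (z.1, -z.2)

end FracNLS

end

/-! ### Scaling groups, descent directions and step lengths. -/

noncomputable section

namespace FracNLS

/-! The set K of Pohozaev critical points adds to ordinary criticality the condition P = 0, which is
criticality along the dilations u ↦ u(e^{-a}·). These act on E = ℝ × H^s_r by a group D that is only
strongly continuous, so a ↦ D_a z need not be differentiable. Still J(a, z) = I(D_a z) is C¹,
because kinetic energy, mass and potential energy are each multiplied by an explicit exponential of
a. The components of dJ at (0, z) are P, ∂_λ I and ∂_u I, so the theorem is a deformation lemma for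
I in which dJ(0, ·) replaces the differential of I.

That lemma, `exists_deformation`, uses no differential equation. Its building blocks are the moves z
↦ D_θ(z + e). Near level b and away from K the norm of dJ(0, ·) is bounded below;
`exists_descent_field` then gives continuous descent directions (θ, e), `exists_step_length` gives
continuous step lengths, and the steps are iterated. The length of a step is controlled by the
energy it loses. Hence an orbit that stays above b - ε has finite length and converges; the step
length vanishes at the limit, which therefore lies near K. So every orbit from below b + ε either
drops below b - ε or comes near K, and in the second case the part of it above b - ε is short and
stays in O (`exists_reach_mem`). A continuous choice of the stopping time finishes the construction.

The compactness it needs is `exists_convergent_subseq`, and here b < 0 enters: P - N I = (N/2) e^λ m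
- s‖(-Δ)^{s/2}u‖² keeps e^λ away from 0, so ∂_λ I → 0 brings the mass close to m. The
Gagliardo–Nirenberg inequality with the subcritical growth of g bounds e^λ and u. Radial bounded
sequences have subsequences that are Cauchy in measure (`exists_subseq_cauchy_in_measure`), the
derivative of ∫ G(u) is uniformly continuous on bounded sets for convergence in measure
(`potentialDeriv_oscillation`), and the quadratic part is coercive
(`norm_sub_le_of_lagrangianDeriv`); so the subsequence is Cauchy in norm. Gagliardo–Nirenberg and
radial compactness both come from splitting a function into low and high frequencies. -/

/-- A strongly continuous one-parameter group of bounded operators, with exponential growth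
bound. -/
structure ScalingGroup (E : Type*) [NormedAddCommGroup E] [NormedSpace ℝ E] where
  /-- The operators of the group. -/
  op : ℝ → E →L[ℝ] E
  op_zero : ∀ z, op 0 z = z
  op_add : ∀ a b z, op (a + b) z = op a (op b z)
  continuous_op : Continuous fun p : ℝ × E => op p.1 p.2
  /-- The growth rate. -/
  rate : ℝ
  rate_nonneg : 0 ≤ rate
  norm_op_le : ∀ a z, ‖op a z‖ ≤ Real.exp (rate * |a|) * ‖z‖

namespace ScalingGroup

variable {E : Type*} [NormedAddCommGroup E] [NormedSpace ℝ E] (D : ScalingGroup E)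

theorem op_neg_op (a : ℝ) (z : E) : D.op (-a) (D.op a z) = z := by
  rw [← D.op_add, neg_add_cancel, D.op_zero]

theorem op_op_neg (a : ℝ) (z : E) : D.op a (D.op (-a) z) = z := by
  rw [← D.op_add, add_neg_cancel, D.op_zero]

/-- The elementary move: translate by `w.2`, then scale by `w.1`. -/
def move (w : ℝ × E) (z : E) : E := D.op w.1 (z + w.2)

theorem continuous_move : Continuous fun p : (ℝ × E) × E => D.move p.1 p.2 :=
  D.continuous_op.comp (by fun_prop : Continuous fun p : (ℝ × E) × E => (p.1.1, p.2 + p.1.2))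

theorem move_zero (z : E) : D.move 0 z = z := by simp [move, D.op_zero]

/-- `z'` is obtained from `z` by moves of total length at most `L`. -/
def Reach (L : ℝ) (z z' : E) : Prop :=
  ∃ (a : ℝ) (e : E), |a| ≤ L ∧ ‖e‖ ≤ L * Real.exp (D.rate * L) ∧ z' = D.op a (z + e)

theorem reach_move (w : ℝ × E) (z : E) {L : ℝ} (h : ‖w‖ ≤ L) : D.Reach L z (D.move w z) := by
  have hL : 0 ≤ L := (norm_nonneg _).trans h
  refine ⟨w.1, w.2, (norm_fst_le w).trans h, (norm_snd_le w).trans (h.trans ?_), rfl⟩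
  exact le_mul_of_one_le_right hL (Real.one_le_exp (mul_nonneg D.rate_nonneg hL))

/-- Two moves collapse into one once the second translation is pulled back through the first
scaling, which costs a factor exp(rate · L₁). The bound L exp(rate · L) on translations is shaped so
that it absorbs this factor and lengths simply add. -/
theorem Reach.trans {D : ScalingGroup E} {L₁ L₂ : ℝ} {z z' z'' : E} (h₁ : D.Reach L₁ z z')
    (h₂ : D.Reach L₂ z' z'') : D.Reach (L₁ + L₂) z z'' := by
  obtain ⟨a₁, e₁, ha₁, he₁, rfl⟩ := h₁
  obtain ⟨a₂, e₂, ha₂, he₂, rfl⟩ := h₂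
  have hL₁ : 0 ≤ L₁ := (abs_nonneg _).trans ha₁
  have hL₂ : 0 ≤ L₂ := (abs_nonneg _).trans ha₂
  have hC := D.rate_nonneg
  refine ⟨a₂ + a₁, e₁ + D.op (-a₁) e₂, ?_, ?_, ?_⟩
  · exact (abs_add_le _ _).trans (by linarith)
  · have h3 : ‖D.op (-a₁) e₂‖ ≤ Real.exp (D.rate * L₁) * (L₂ * Real.exp (D.rate * L₂)) := by
      refine (D.norm_op_le _ _).trans ?_
      rw [abs_neg]
      gcongr
    have h4 : L₁ * Real.exp (D.rate * L₁) ≤ L₁ * Real.exp (D.rate * (L₁ + L₂)) := by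
      gcongr; linarith
    have h5 : Real.exp (D.rate * L₁) * (L₂ * Real.exp (D.rate * L₂))
        = L₂ * Real.exp (D.rate * (L₁ + L₂)) := by
      rw [mul_add, Real.exp_add]; ring
    calc _ ≤ _ := norm_add_le _ _
      _ ≤ (L₁ + L₂) * Real.exp (D.rate * (L₁ + L₂)) := by linarith
  · rw [D.op_add]
    congr 1
    simp only [map_add, D.op_op_neg]
    abel

theorem Reach.mono {D : ScalingGroup E} {L L' : ℝ} {z z' : E} (h : D.Reach L z z') (hL : L ≤ L') :
    D.Reach L' z z' := by
  obtain ⟨a, e, ha, he, rfl⟩ := h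
  have hL0 : 0 ≤ L := (abs_nonneg _).trans ha
  have hC := D.rate_nonneg
  have hL0' : 0 ≤ L' := hL0.trans hL
  refine ⟨a, e, ha.trans hL, he.trans ?_, rfl⟩
  gcongr

theorem reach_refl (z : E) : D.Reach 0 z z := ⟨0, 0, by simp, by simp, by simp [D.op_zero]⟩

/-- Points that are joined to a compact set by short moves, in either direction, are close to it. -/
theorem exists_reach_mem {K O : Set E} (hK : IsCompact K) (hO : O ∈ 𝓝ˢ K) :
    ∃ r > 0, ∃ L > 0, ∀ z ∈ Metric.thickening r K, ∀ z',
      (D.Reach L z z' ∨ D.Reach L z' z) → z' ∈ O := by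
  obtain ⟨U, hUo, hKU, hUO⟩ := mem_nhdsSet_iff_exists.1 hO
  -- The first component is the forward motion. The second covers the backward one: z = D_a(z' + e)
  -- means z' = D_{-a} z - e, which has the form D_a z + e with the signs of a and e changed.
  let Φ : ℝ × (E × E) → E × E := fun q => (D.op q.1 (q.2.2 + q.2.1), D.op q.1 q.2.2 + q.2.1)
  have hΦ : Continuous Φ := by
    refine Continuous.prodMk ?_ (Continuous.add ?_ (by fun_prop))
    · exact D.continuous_op.comp
        (by fun_prop : Continuous fun q : ℝ × (E × E) => (q.1, q.2.2 + q.2.1))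
    · exact D.continuous_op.comp (by fun_prop : Continuous fun q : ℝ × (E × E) => (q.1, q.2.2))
  have hopen : IsOpen (Φ ⁻¹' (U ×ˢ U)) := (hUo.prod hUo).preimage hΦ
  have hcpt : IsCompact (({0} : Set ℝ) ×ˢ (({0} : Set E) ×ˢ K)) :=
    isCompact_singleton.prod (isCompact_singleton.prod hK)
  have hsub : (({0} : Set ℝ) ×ˢ (({0} : Set E) ×ˢ K)) ⊆ Φ ⁻¹' (U ×ˢ U) := by
    rintro ⟨a, e, z⟩ ⟨ha, he, hz⟩
    simp only [mem_singleton_iff] at ha he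
    subst ha he
    simpa [Φ, D.op_zero] using hKU hz
  obtain ⟨r, hr, hrU⟩ := hcpt.exists_thickening_subset_open hopen hsub
  have hlim : Tendsto (fun L : ℝ => L * Real.exp (D.rate * L)) (𝓝[>] 0) (𝓝 0) := by
    have : Continuous (fun L : ℝ => L * Real.exp (D.rate * L)) := by fun_prop
    simpa using (this.tendsto 0).mono_left nhdsWithin_le_nhds
  have hlim' : Tendsto (fun L : ℝ => L) (𝓝[>] 0) (𝓝 0) := nhdsWithin_le_nhds
  obtain ⟨L, ⟨hL1, hL2⟩, hL0⟩ := (((hlim.eventually_lt_const hr).and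
    (hlim'.eventually_lt_const hr)).and self_mem_nhdsWithin).exists
  refine ⟨r, hr, L, hL0, ?_⟩
  have key : ∀ a : ℝ, ∀ e : E, |a| ≤ L → ‖e‖ ≤ L * Real.exp (D.rate * L) →
      ∀ z ∈ Metric.thickening r K, (a, e, z) ∈ Φ ⁻¹' (U ×ˢ U) := by
    intro a e ha he z hz
    apply hrU
    obtain ⟨k, hk, hzk⟩ := Metric.mem_thickening_iff.1 hz
    refine Metric.mem_thickening_iff.2 ⟨(0, 0, k), ⟨rfl, rfl, hk⟩, ?_⟩
    simp only [Prod.dist_eq, dist_zero_right, Real.norm_eq_abs]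
    exact max_lt (ha.trans_lt hL2) (max_lt (he.trans_lt hL1) hzk)
  rintro z hz z' (⟨a, e, ha, he, rfl⟩ | ⟨a, e, ha, he, h⟩)
  · exact hUO (key a e ha he z hz).1
  · have h1 : z' = D.op (-a) z + -e := by rw [h, D.op_neg_op]; abel
    rw [h1]
    exact hUO (key (-a) (-e) (by rwa [abs_neg]) (by rwa [norm_neg]) z hz).2

/-- A sequence of moves of finite total length converges. -/
theorem exists_tendsto_of_summable [CompleteSpace E] {z : ℕ → E} {w : ℕ → ℝ × E}
    (hz : ∀ n, z (n + 1) = D.move (w n) (z n)) (hw : Summable fun n => ‖w n‖) :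
    ∃ z', Tendsto z atTop (𝓝 z') := by
  let Θ : ℕ → ℝ := fun n => ∑ i ∈ Finset.range n, (w i).1
  have hsum1 : Summable fun n => |(w n).1| :=
    hw.of_nonneg_of_le (fun n => abs_nonneg _) fun n => norm_fst_le (w n)
  obtain ⟨Θ', hΘ⟩ : ∃ Θ', Tendsto Θ atTop (𝓝 Θ') :=
    ⟨_, (hsum1.of_abs).hasSum.tendsto_sum_nat⟩
  have hΘb : ∀ n, |Θ n| ≤ ∑' i, |(w i).1| := fun n =>
    (Finset.abs_sum_le_sum_abs _ _).trans (hsum1.sum_le_tsum _ fun i _ => abs_nonneg _)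
  -- Undoing the accumulated scaling leaves a sequence that changes only by translations of summable
  -- norm. Strong continuity then returns the limit to the original sequence.
  let p : ℕ → E := fun n => D.op (-Θ n) (z n)
  have hp : ∀ n, p (n + 1) = p n + D.op (-Θ n) (w n).2 := by
    intro n
    have h1 : -Θ (n + 1) = -Θ n + -(w n).1 := by
      simp only [Θ, Finset.sum_range_succ]; ring
    change D.op (-Θ (n + 1)) (z (n + 1)) = _
    rw [hz, h1, D.op_add, move, D.op_neg_op, map_add]
  have hcau : CauchySeq p := by
    refine cauchySeq_of_summable_dist (Summable.of_nonneg_of_le (fun _ => dist_nonneg) (fun n => ?_)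
      (hw.mul_left (Real.exp (D.rate * ∑' i, |(w i).1|))))
    rw [Nat.succ_eq_add_one, hp, dist_eq_norm, sub_add_cancel_left, norm_neg]
    refine (D.norm_op_le _ _).trans ?_
    have := D.rate_nonneg
    rw [abs_neg]
    gcongr
    · exact hΘb n
    · exact norm_snd_le (w n)
  obtain ⟨p', hp'⟩ := cauchySeq_tendsto_of_complete hcau
  refine ⟨D.op Θ' p', ?_⟩
  have := (D.continuous_op.tendsto (Θ', p')).comp (hΘ.prodMk_nhds hp')
  refine this.congr fun n => ?_
  simp only [Function.comp_apply, p, D.op_op_neg]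

end ScalingGroup

/-- A continuous field of descent directions for a continuous field of functionals. -/
theorem exists_descent_field {E W : Type*} [NormedAddCommGroup E] [NormedAddCommGroup W]
    [NormedSpace ℝ W] {f : E → W →L[ℝ] ℝ} (hf : Continuous f) {δ : ℝ} (hδ : 0 < δ)
    (σ : E ≃ₜ E) (hσ : ∀ z, σ (σ z) = z) (σW : W →L[ℝ] W) (hσW : ∀ w, σW (σW w) = w)
    (hσn : ∀ w, ‖σW w‖ = ‖w‖) (hfσ : ∀ z w, f (σ z) (σW w) = f z w) :
    ∃ V : E → W, Continuous V ∧ (∀ z, ‖V z‖ ≤ 1) ∧ (∀ z, δ ≤ ‖f z‖ → f z (V z) < -(δ / 2)) ∧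
      ∀ z, V (σ z) = σW (V z) := by
  -- The admissible directions form convex sets, and a direction admissible at one point remains so
  -- nearby; a partition of unity glues these local choices.
  let t : E → Set W := fun z => {v | ‖v‖ ≤ 1 ∧ (δ ≤ ‖f z‖ → f z v < -(δ / 2))}
  have hconv : ∀ z, Convex ℝ (t z) := by
    intro z
    by_cases h : δ ≤ ‖f z‖
    · have : t z = Metric.closedBall 0 1 ∩ {v | f z v < -(δ / 2)} := by
        ext v; simp [t, h]
      rw [this]
      exact (convex_closedBall _ _).inter (convex_halfSpace_lt (f z).isLinear _)
    · have : t z = Metric.closedBall 0 1 := by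
        ext v; simp only [t, mem_ofPred_eq, mem_closedBall_zero_iff]; tauto
      rw [this]
      exact convex_closedBall _ _
  have hloc : ∀ z, ∃ c, ∀ᶠ y in 𝓝 z, c ∈ t y := by
    intro z
    by_cases h : δ ≤ ‖f z‖
    · obtain ⟨x, hx1, hx2⟩ := (f z).exists_lt_apply_of_lt_opNorm (r := δ / 2) (by linarith)
      obtain ⟨v, hv1, hv2⟩ : ∃ v, ‖v‖ ≤ 1 ∧ f z v < -(δ / 2) := by
        rw [Real.norm_eq_abs, lt_abs] at hx2
        rcases hx2 with h2 | h2
        · exact ⟨-x, by rw [norm_neg]; exact hx1.le, by rw [map_neg]; linarith⟩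
        · exact ⟨x, hx1.le, by linarith⟩
      refine ⟨v, ?_⟩
      have hc : Continuous fun y => f y v := by fun_prop
      filter_upwards [(hc.tendsto z).eventually_lt_const hv2] with y hy
      exact ⟨hv1, fun _ => hy⟩
    · refine ⟨0, ?_⟩
      filter_upwards [(hf.norm.tendsto z).eventually_lt_const (not_le.1 h)] with y hy
      exact ⟨by simp, fun h' => absurd hy (not_lt.2 h')⟩
  obtain ⟨V, hV⟩ := exists_continuous_forall_mem_convex_of_local_const hconv hloc
  -- Averaging over the involution gives equivariance. The norm bound and the strict descent
  -- inequality survive because both are convex conditions and f is invariant.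
  refine ⟨fun z => (1 / 2 : ℝ) • (V z + σW (V (σ z))), by fun_prop, fun z => ?_, fun z hz => ?_,
    fun z => ?_⟩
  · have h1 := (hV z).1
    have h2 := (hV (σ z)).1
    rw [norm_smul]
    have h3 := norm_add_le (V z) (σW (V (σ z)))
    rw [hσn] at h3
    norm_num
    linarith
  · have h1 := (hV z).2 hz
    have hle : ‖f z‖ ≤ ‖f (σ z)‖ := by
      refine ContinuousLinearMap.opNorm_le_bound _ (norm_nonneg _) fun w => ?_
      rw [← hfσ, ← hσn w]
      exact (f (σ z)).le_opNorm _
    have h2 := (hV (σ z)).2 (hz.trans hle)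
    have h3 : f z (σW (V (σ z))) = f (σ z) (V (σ z)) := by
      rw [← hfσ, hσW]
    rw [map_smul, map_add, h3, smul_eq_mul]
    linarith
  · simp only [hσ, map_smul, map_add, hσW]
    rw [add_comm]

namespace ScalingGroup

variable {E : Type*} [NormedAddCommGroup E] [NormedSpace ℝ E] (D : ScalingGroup E)

/-- Along a field of descent directions there is a continuous, symmetric admissible step length. -/
theorem exists_step_length {I : E → ℝ}
    (hJ : ContDiff ℝ 1 fun p : ℝ × E => I (D.op p.1 p.2)) {V : E → ℝ × E} (hV : Continuous V)
    (hV1 : ∀ z, ‖V z‖ ≤ 1) {A : Set E} (hA : IsOpen A) {δ : ℝ} (hδ : 0 < δ)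
    (hVA : ∀ z ∈ A, fderiv ℝ (fun p : ℝ × E => I (D.op p.1 p.2)) (0, z) (V z) < -(δ / 2))
    (σ : E ≃ₗᵢ[ℝ] E) (hσA : ∀ z, σ z ∈ A ↔ z ∈ A)
    (hIσ : ∀ (w : ℝ) z, I (D.move (w • V (σ z)) (σ z)) = I (D.move (w • V z) z)) :
    ∃ τ : E → ℝ, Continuous τ ∧ (∀ z, 0 ≤ τ z ∧ τ z ≤ 1) ∧ (∀ z, 0 < τ z ↔ z ∈ A) ∧
      (∀ z, τ (σ z) = τ z) ∧ ∀ (z) (t₁ t₂ : ℝ), 0 ≤ t₁ → t₁ ≤ t₂ → t₂ ≤ τ z →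
        I (D.move (t₂ • V z) z) ≤ I (D.move (t₁ • V z) z) - δ / 4 * (t₂ - t₁) := by
  set J : ℝ × E → ℝ := fun p => I (D.op p.1 p.2) with hJdef
  have hIJ : ∀ (t : ℝ) z, I (D.move (t • V z) z) = J ((0, z) + t • V z) := by
    intro t z; simp [hJdef, move]
  -- A time is good if energy falls at rate δ/4 up to it. The step length will be half the distance
  -- from (z, 0) to the bad set, hence automatically continuous. The bound |t| < 1 makes the bad set
  -- nonempty and the step at most 1.
  let Good : E → ℝ → Prop := fun z t => z ∈ A ∧ |t| < 1 ∧ ∀ t₁ t₂ : ℝ, 0 ≤ t₁ → t₁ ≤ t₂ → t₂ ≤ |t| →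
        I (D.move (t₂ • V z) z) ≤ I (D.move (t₁ • V z) z) - δ / 4 * (t₂ - t₁)
  let B : Set (E × ℝ) := {p | ¬ Good p.1 p.2}
  have hBne : B.Nonempty := ⟨(0, 1), by simp [B, Good]⟩
  have hdist : ∀ z t, (z, t) ∈ B → Metric.infDist (z, (0 : ℝ)) B ≤ |t| := by
    intro z t h
    refine (Metric.infDist_le_dist_of_mem h).trans ?_
    simp [Prod.dist_eq]
  have hpos : ∀ z ∈ A, 0 < Metric.infDist (z, (0 : ℝ)) B := by
    intro z hz
    refine lt_of_le_of_ne Metric.infDist_nonneg fun h0 => ?_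
    have hcl := mem_closure_iff_nhds.1 ((Metric.mem_closure_iff_infDist_zero hBne).2 h0.symm)
    -- Strict differentiability compares two arbitrary points near (0, z), so one estimate serves
    -- all neighbouring base points and all pairs of times. The slope -δ/2 minus the error δ/4
    -- leaves the rate δ/4.
    have hstrict : HasStrictFDerivAt J (fderiv ℝ J (0, z)) (0, z) :=
      (hJ.contDiffAt).hasStrictFDerivAt one_ne_zero
    have h1 := hstrict.isLittleO.def (show 0 < δ / 4 by positivity)
    have hcont : Continuous fun q : E × ℝ × ℝ =>
        (((0 : ℝ), q.1) + q.2.2 • V q.1, ((0 : ℝ), q.1) + q.2.1 • V q.1) := by fun_prop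
    have h2 : ∀ᶠ q : E × ℝ × ℝ in 𝓝 (z, 0, 0),
        ‖J (((0 : ℝ), q.1) + q.2.2 • V q.1) - J (((0 : ℝ), q.1) + q.2.1 • V q.1) -
          fderiv ℝ J (0, z) ((((0 : ℝ), q.1) + q.2.2 • V q.1) - (((0 : ℝ), q.1) + q.2.1 • V q.1))‖
          ≤ δ / 4 * ‖(((0 : ℝ), q.1) + q.2.2 • V q.1) - (((0 : ℝ), q.1) + q.2.1 • V q.1)‖ := by
      have := hcont.tendsto (z, 0, 0)
      simp only [zero_smul, add_zero] at this
      exact this.eventually h1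
    have h3 : ∀ᶠ q : E × ℝ × ℝ in 𝓝 (z, 0, 0), fderiv ℝ J (0, z) (V q.1) < -(δ / 2) := by
      have hc : Continuous fun q : E × ℝ × ℝ => fderiv ℝ J (0, z) (V q.1) := by fun_prop
      exact (hc.tendsto _).eventually_lt_const (hVA z hz)
    have h4 : ∀ᶠ q : E × ℝ × ℝ in 𝓝 (z, 0, 0), q.1 ∈ A :=
      continuous_fst.continuousAt.eventually (hA.mem_nhds hz)
    obtain ⟨r, hr, hball⟩ := Metric.eventually_nhds_iff_ball.1 (h2.and (h3.and h4))
    obtain ⟨⟨z', t⟩, hzt, hbad⟩ :=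
      hcl (Metric.ball (z, 0) (min r 1)) (Metric.ball_mem_nhds _ (by positivity))
    apply hbad
    simp only [Metric.mem_ball, Prod.dist_eq, dist_zero_right, Real.norm_eq_abs, max_lt_iff,
      lt_min_iff] at hzt
    have hin : ∀ t₁ t₂ : ℝ, |t₁| ≤ |t| → |t₂| ≤ |t| → (z', t₁, t₂) ∈ Metric.ball (z, (0 : ℝ), (0 : ℝ)) r := by
      intro t₁ t₂ h₁ h₂
      simp only [Metric.mem_ball, Prod.dist_eq, dist_zero_right, Real.norm_eq_abs, max_lt_iff]
      exact ⟨hzt.1.1, by linarith [hzt.2.1], by linarith [hzt.2.1]⟩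
    refine ⟨(hball _ (hin 0 0 (by simp) (by simp))).2.2, hzt.2.2, fun t₁ t₂ h0 h12 h2t => ?_⟩
    obtain ⟨g1, g2, -⟩ := hball (z', t₁, t₂) (hin t₁ t₂
      (by rw [abs_of_nonneg h0]; linarith) (by rw [abs_of_nonneg (h0.trans h12)]; linarith))
    rw [hIJ, hIJ]
    simp only at g1 g2
    have h5 : (((0 : ℝ), z') + t₂ • V z') - (((0 : ℝ), z') + t₁ • V z') = (t₂ - t₁) • V z' := by
      rw [sub_smul]; abel
    rw [h5, map_smul, smul_eq_mul, norm_smul, Real.norm_eq_abs, Real.norm_eq_abs,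
      abs_of_nonneg (sub_nonneg.2 h12)] at g1
    have g3 := (abs_le.1 g1).2
    have g4 : (t₂ - t₁) * ‖V z'‖ ≤ (t₂ - t₁) * 1 :=
      mul_le_mul_of_nonneg_left (hV1 z') (sub_nonneg.2 h12)
    nlinarith [sub_nonneg.2 h12]
  -- Halving keeps the step strictly below the distance to the bad set whenever that distance is
  -- positive, so the full step is still a good time.
  refine ⟨fun z => Metric.infDist (z, (0 : ℝ)) B / 2, ?_, ?_, ?_, ?_, ?_⟩
  · exact ((Metric.continuous_infDist_pt B).comp (by fun_prop)).div_const 2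
  · intro z
    have h1 : Metric.infDist (z, (0 : ℝ)) B ≤ |1| := hdist z 1 (by simp [B, Good])
    have h2 : 0 ≤ Metric.infDist (z, (0 : ℝ)) B := Metric.infDist_nonneg
    rw [abs_one] at h1
    constructor <;> linarith
  · intro z
    refine ⟨fun h => ?_, fun h => half_pos (hpos z h)⟩
    by_contra hz
    have h1 := hdist z 0 (by simp [B, Good, hz])
    rw [abs_zero] at h1
    linarith
  · intro z
    have hgood : ∀ z t, Good (σ z) t ↔ Good z t := by
      intro z t
      simp only [Good, hσA, hIσ]
    -- The distance is invariant because this isometry maps the bad set onto itself.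
    let Φ : E × ℝ → E × ℝ := Prod.map σ id
    have hΦ : Isometry Φ := σ.isometry.prodMap isometry_id
    have himg : Φ '' B = B := by
      ext ⟨y, t⟩
      constructor
      · rintro ⟨⟨y', t'⟩, hy, h⟩
        have : (σ y', t') = (y, t) := h
        rw [← this]
        exact fun h => hy ((hgood _ _).1 h)
      · intro hy
        refine ⟨(σ.symm y, t), fun h => hy ?_, ?_⟩
        · have := (hgood _ _).2 h
          simpa using this
        · change (σ (σ.symm y), t) = (y, t)
          simp
    have := Metric.infDist_image hΦ (x := (z, (0 : ℝ))) (t := B)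
    rw [himg] at this
    change Metric.infDist (σ z, (0 : ℝ)) B / 2 = _
    rw [show (σ z, (0 : ℝ)) = Φ (z, 0) from rfl, this]
  · intro z t₁ t₂ h0 h12 h2
    replace h2 : t₂ ≤ Metric.infDist (z, (0 : ℝ)) B / 2 := h2
    rcases (Metric.infDist_nonneg : 0 ≤ Metric.infDist (z, (0 : ℝ)) B).eq_or_lt with h | h
    · rw [← h, zero_div] at h2
      obtain rfl : t₁ = 0 := by linarith
      obtain rfl : t₂ = 0 := by linarith
      simp
    · have hg : Good z t₂ := by
        by_contra hb
        have := hdist z t₂ hb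
        rw [abs_of_nonneg (h0.trans h12)] at this
        linarith
      exact hg.2.2 t₁ t₂ h0 h12 (le_abs_self _)

end ScalingGroup

end FracNLS
end

/-! ### Iterated steps and the abstract deformation lemma. -/

noncomputable section

namespace FracNLS

/-- Time truncated to the unit interval. -/
def clip (x : ℝ) : ℝ := max 0 (min 1 x)

theorem continuous_clip : Continuous clip := by unfold clip; fun_prop

theorem clip_nonneg (x : ℝ) : 0 ≤ clip x := le_max_left _ _

theorem clip_le_one (x : ℝ) : clip x ≤ 1 := max_le zero_le_one (min_le_left _ _)

theorem clip_mono {x y : ℝ} (h : x ≤ y) : clip x ≤ clip y :=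
  max_le_max le_rfl (min_le_min le_rfl h)

theorem clip_of_nonpos {x : ℝ} (h : x ≤ 0) : clip x = 0 :=
  max_eq_left ((min_le_right _ _).trans h)

theorem clip_of_one_le {x : ℝ} (h : 1 ≤ x) : clip x = 1 := by
  rw [clip, min_eq_left h, max_eq_right zero_le_one]

/-- The `n`-th iterate of a step map `S`, run up to time `a`. -/
def stepFlow {E : Type*} (S : ℝ → E → E) : ℕ → ℝ → E → E
  | 0, _, z => z
  | n + 1, a, z => S (clip (a - n)) (stepFlow S n a z)

section stepFlow

variable {E : Type*} {S : ℝ → E → E}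

theorem continuous_stepFlow [TopologicalSpace E] (hS : Continuous fun p : ℝ × E => S p.1 p.2)
    (n : ℕ) : Continuous fun p : ℝ × E => stepFlow S n p.1 p.2 := by
  induction n with
  | zero => exact continuous_snd
  | succ n ih =>
    exact hS.comp (((continuous_clip.comp (by fun_prop : Continuous fun p : ℝ × E =>
      p.1 - n))).prodMk ih)

theorem stepFlow_eq_of_le (hS0 : ∀ z, S 0 z = z) {n m : ℕ} {a : ℝ} (ha : a ≤ n) (hnm : n ≤ m)
    (z : E) : stepFlow S m a z = stepFlow S n a z := by
  induction m, hnm using Nat.le_induction with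
  | base => rfl
  | succ m hnm ih =>
    have : (n : ℝ) ≤ m := Nat.cast_le.2 hnm
    rw [stepFlow, clip_of_nonpos (by linarith), hS0, ih]

theorem stepFlow_of_ge {n : ℕ} {a a' : ℝ} (ha : n ≤ a) (ha' : n ≤ a') (z : E) :
    stepFlow S n a z = stepFlow S n a' z := by
  induction n with
  | zero => rfl
  | succ n ih =>
    push_cast at ha ha'
    rw [stepFlow, stepFlow, clip_of_one_le (by linarith), clip_of_one_le (by linarith),
      ih (by linarith) (by linarith)]

theorem stepFlow_nonpos (hS0 : ∀ z, S 0 z = z) (n : ℕ) {a : ℝ} (ha : a ≤ 0) (z : E) :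
    stepFlow S n a z = z :=
  stepFlow_eq_of_le hS0 (n := 0) (by simpa using ha) (Nat.zero_le n) z

theorem stepFlow_fixed {z : E} (hz : ∀ t, S t z = z) (n : ℕ) (a : ℝ) : stepFlow S n a z = z := by
  induction n with
  | zero => rfl
  | succ n ih => rw [stepFlow, ih, hz]

theorem stepFlow_equivariant {σ : E → E} (hσ : ∀ t z, S t (σ z) = σ (S t z)) (n : ℕ) (a : ℝ)
    (z : E) : stepFlow S n a (σ z) = σ (stepFlow S n a z) := by
  induction n with
  | zero => rfl
  | succ n ih => rw [stepFlow, ih, hσ, stepFlow]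

/-- Before time n the last step has not begun; after time n the earlier steps are complete and only
the parameter of the last one moves. Comparing two times therefore reduces to the induction
hypothesis or to a single step. -/
theorem antitone_stepFlow {I : E → ℝ} (hS0 : ∀ z, S 0 z = z)
    (hI : ∀ z t₁ t₂, 0 ≤ t₁ → t₁ ≤ t₂ → t₂ ≤ 1 → I (S t₂ z) ≤ I (S t₁ z)) (n : ℕ) (z : E) :
    Antitone fun a => I (stepFlow S n a z) := by
  induction n with
  | zero => exact fun _ _ _ => le_rfl
  | succ n ih =>
    intro a a' h
    have hmove : ∀ a, I (stepFlow S (n + 1) a z) ≤ I (stepFlow S n a z) := by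
      intro a
      have := hI (stepFlow S n a z) 0 (clip (a - n)) le_rfl (clip_nonneg _) (clip_le_one _)
      rwa [hS0] at this
    rcases le_total a n with h1 | h1
    · have h2 : stepFlow S (n + 1) a z = stepFlow S n a z :=
        stepFlow_eq_of_le hS0 h1 n.le_succ z
      simp only [h2]
      exact (hmove a').trans (ih h)
    · have h2 : stepFlow S n a' z = stepFlow S n a z := stepFlow_of_ge (h1.trans h) h1 z
      simp only [stepFlow, h2]
      exact hI _ _ _ (clip_nonneg _) (clip_mono (by linarith)) (clip_le_one _)

end stepFlow

namespace ScalingGroup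

variable {E : Type*} [NormedAddCommGroup E] [NormedSpace ℝ E] (D : ScalingGroup E)

/-- Length is paid for by energy: the step lengths add and the energy drops telescope, so a motion
that loses little energy is short whatever its number of steps. -/
theorem reach_stepFlow {S : ℝ → E → E} {I : E → ℝ} {κ : ℝ}
    (hS : ∀ z t, 0 ≤ t → t ≤ 1 → D.Reach (κ * (I z - I (S t z))) z (S t z))
    {n m : ℕ} (hnm : n ≤ m) (a : ℝ) (z : E) :
    D.Reach (κ * (I (stepFlow S n a z) - I (stepFlow S m a z))) (stepFlow S n a z)
      (stepFlow S m a z) := by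
  induction m, hnm using Nat.le_induction with
  | base => simpa using D.reach_refl _
  | succ m hnm ih =>
    refine (ih.trans (hS (stepFlow S m a z) (clip (a - m)) (clip_nonneg _) (clip_le_one _))).mono ?_
    rw [stepFlow]
    exact le_of_eq (by ring)

variable [CompleteSpace E]

/-- The deformation lemma: below, `(I ∘ D)` is of class `C¹` on `ℝ × E`, and its differential at the
points `(0, z)` satisfies a Palais–Smale condition at the level `b`. -/
theorem exists_deformation {I : E → ℝ} (hJ : ContDiff ℝ 1 fun p : ℝ × E => I (D.op p.1 p.2))
    (σ : E ≃ₗᵢ[ℝ] E) (hσ : ∀ z, σ (σ z) = z) (hσD : ∀ a z, D.op a (σ z) = σ (D.op a z))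
    (hIσ : ∀ z, I (σ z) = I z) {b : ℝ}
    (hPS : ∀ z : ℕ → E, Tendsto (fun n => I (z n)) atTop (𝓝 b) →
      Tendsto (fun n => fderiv ℝ (fun p : ℝ × E => I (D.op p.1 p.2)) (0, z n)) atTop (𝓝 0) →
      ∃ z₀, ∃ φ : ℕ → ℕ, StrictMono φ ∧ Tendsto (z ∘ φ) atTop (𝓝 z₀))
    {O : Set E}
    (hO : O ∈ 𝓝ˢ {z | I z = b ∧ fderiv ℝ (fun p : ℝ × E => I (D.op p.1 p.2)) (0, z) = 0})
    {εbar : ℝ} (hεbar : 0 < εbar) :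
    ∃ ε : ℝ, 0 < ε ∧ ε < εbar ∧ ∃ η : unitInterval × E → E, Continuous η ∧
      (∀ z, η (0, z) = z) ∧ (∀ t z, I z ≤ b - εbar → η (t, z) = z) ∧
      (∀ z, Antitone fun t : unitInterval => I (η (t, z))) ∧
      (∀ z, I z ≤ b + ε → z ∉ O → I (η (1, z)) ≤ b - ε) ∧
      (∀ z, I z ≤ b + ε → I (η (1, z)) ≤ b - ε ∨ η (1, z) ∈ O) ∧
      ∀ t z, η (t, σ z) = σ (η (t, z)) := by
  set f : E → (ℝ × E →L[ℝ] ℝ) :=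
    fun z => fderiv ℝ (fun p : ℝ × E => I (D.op p.1 p.2)) (0, z) with hf
  set K : Set E := {z | I z = b ∧ f z = 0} with hK
  have hfc : Continuous f := (hJ.continuous_fderiv one_ne_zero).comp (by fun_prop)
  have hIc : Continuous I := by
    have : Continuous fun z : E => I (D.op 0 z) :=
      hJ.continuous.comp (by fun_prop : Continuous fun z : E => ((0 : ℝ), z))
    simpa only [D.op_zero] using this
  have hKc : IsCompact K := by
    rw [isCompact_iff_isSeqCompact]
    intro z hz
    obtain ⟨z₀, φ, hφ, hlim⟩ := hPS z (tendsto_const_nhds.congr fun n => (hz n).1.symm)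
      (tendsto_const_nhds.congr fun n => (hz n).2.symm)
    have hKcl : IsClosed K := (isClosed_eq hIc continuous_const).inter
      (isClosed_eq hfc continuous_const)
    exact ⟨z₀, hKcl.mem_of_tendsto hlim (.of_forall fun n => hz _), φ, hφ, hlim⟩
  let σ₂ : ℝ × E →L[ℝ] ℝ × E :=
    (ContinuousLinearMap.fst ℝ ℝ E).prod ((σ : E →L[ℝ] E).comp (ContinuousLinearMap.snd ℝ ℝ E))
  have hσ₂ : ∀ w, σ₂ w = (w.1, σ w.2) := fun w => rfl
  have hσ₂σ₂ : ∀ w, σ₂ (σ₂ w) = w := by intro w; simp [hσ₂, hσ]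
  have hσ₂n : ∀ w, ‖σ₂ w‖ = ‖w‖ := by intro w; simp [hσ₂, Prod.norm_def]
  have hfσ : ∀ z w, f (σ z) (σ₂ w) = f z w := by
    intro z w
    have h1 : (fun p : ℝ × E => I (D.op p.1 p.2)) ∘ σ₂ = fun p : ℝ × E => I (D.op p.1 p.2) := by
      funext p
      simp [hσ₂, hσD, hIσ]
    have h2 : HasFDerivAt (fun p : ℝ × E => I (D.op p.1 p.2)) (f (σ z)) (σ₂ (0, z)) :=
      (hJ.differentiable one_ne_zero _).hasFDerivAt
    have h3 := h2.comp (0, z) σ₂.hasFDerivAt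
    rw [h1] at h3
    rw [hf]
    simp only [h3.fderiv]
    rfl
  have hKσ : ∀ z, σ z ∈ K ↔ z ∈ K := by
    have h1 : ∀ z, z ∈ K → σ z ∈ K := by
      rintro z ⟨hz1, hz2⟩
      refine ⟨by rw [hIσ, hz1], ?_⟩
      refine ContinuousLinearMap.ext fun w => ?_
      rw [← hσ₂σ₂ w, hfσ, hz2]
      rfl
    intro z
    refine ⟨fun h => ?_, h1 z⟩
    simpa [hσ] using h1 _ h
  obtain ⟨r, hr, L, hL, hreach⟩ := D.exists_reach_mem hKc hO
  -- uniform bound from below on the differential away from `K`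
  obtain ⟨δ, hδ, ε₀, hε₀, hε₀', hlow⟩ : ∃ δ > 0, ∃ ε₀ > 0, ε₀ ≤ εbar ∧ ∀ z, |I z - b| < ε₀ →
      z ∉ Metric.thickening (r / 2) K → δ ≤ ‖f z‖ := by
    by_contra hcon
    push Not at hcon
    have hx : ∀ n : ℕ, ∃ z, |I z - b| < min (1 / ((n : ℝ) + 1)) εbar ∧
        z ∉ Metric.thickening (r / 2) K ∧ ‖f z‖ < 1 / ((n : ℝ) + 1) := fun n =>
      hcon (1 / ((n : ℝ) + 1)) (by positivity) (min (1 / ((n : ℝ) + 1)) εbar) (by positivity)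
        (min_le_right _ _)
    choose z hz1 hz2 hz3 using hx
    have h0 := tendsto_one_div_add_atTop_nhds_zero_nat (𝕜 := ℝ)
    have hI : Tendsto (fun n => I (z n)) atTop (𝓝 b) := by
      rw [tendsto_iff_dist_tendsto_zero]
      exact squeeze_zero (fun _ => dist_nonneg)
        (fun n => ((hz1 n).trans_le (min_le_left _ _)).le) h0
    have hf0 : Tendsto (fun n => f (z n)) atTop (𝓝 0) :=
      squeeze_zero_norm (fun n => (hz3 n).le) h0
    obtain ⟨z₀, φ, hφ, hlim⟩ := hPS z hI hf0
    have hz0 : z₀ ∈ K :=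
      ⟨tendsto_nhds_unique ((hIc.tendsto z₀).comp hlim) (hI.comp hφ.tendsto_atTop),
        tendsto_nhds_unique ((hfc.tendsto z₀).comp hlim) (hf0.comp hφ.tendsto_atTop)⟩
    have := hlim.eventually (Metric.isOpen_thickening.mem_nhds
      (Metric.self_subset_thickening (half_pos hr) K hz0))
    obtain ⟨n, hn⟩ := this.exists
    exact hz2 _ hn
  -- Points move only in A. The radius r/2 here, against r in `hreach`, leaves room for limits of
  -- orbits: a limit outside A at a level near b is in the closed r/2-neighbourhood, so the orbit
  -- itself enters the open r-neighbourhood.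
  let A : Set E := {z | |I z - b| < ε₀} ∩ (Metric.cthickening (r / 2) K)ᶜ
  have hAo : IsOpen A :=
    (isOpen_lt (by fun_prop) continuous_const).inter Metric.isClosed_cthickening.isOpen_compl
  have hAσ : ∀ z, σ z ∈ A ↔ z ∈ A := by
    intro z
    have himg : σ '' K = K := by
      ext y
      constructor
      · rintro ⟨x, hx, rfl⟩
        exact (hKσ x).2 hx
      · intro hy
        exact ⟨σ y, (hKσ y).2 hy, hσ y⟩
    have h1 : Metric.infEDist (σ z) K = Metric.infEDist z K := by
      conv_lhs => rw [← himg]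
      exact Metric.infEDist_image σ.isometry
    simp only [A, mem_inter_iff, mem_ofPred_eq, hIσ, mem_compl_iff, Metric.mem_cthickening_iff, h1]
  obtain ⟨V, hVc, hV1, hVd, hVσ⟩ :=
    exists_descent_field hfc hδ σ.toHomeomorph hσ σ₂ hσ₂σ₂ hσ₂n hfσ
  have hmoveσ : ∀ (t : ℝ) z, D.move (t • V (σ z)) (σ z) = σ (D.move (t • V z) z) := by
    intro t z
    have : V (σ z) = σ₂ (V z) := hVσ z
    simp [this, hσ₂, move, ← hσD, map_add, map_smul]
  obtain ⟨τ, hτc, hτ, hτA, hτσ, hτI⟩ := D.exists_step_length hJ hVc hV1 hAo hδ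
    (fun z hz => hVd z (hlow z hz.1 fun h => hz.2 (Metric.thickening_subset_cthickening _ _ h)))
    σ hAσ (fun t z => by rw [hmoveσ, hIσ])
  let S : ℝ → E → E := fun t z => D.move ((t * τ z) • V z) z
  have hSc : Continuous fun p : ℝ × E => S p.1 p.2 :=
    D.continuous_move.comp
      (by fun_prop : Continuous fun p : ℝ × E => ((p.1 * τ p.2) • V p.2, p.2))
  have hS0 : ∀ z, S 0 z = z := by intro z; simp [S, D.move_zero]
  have hSI : ∀ z t₁ t₂, 0 ≤ t₁ → t₁ ≤ t₂ → t₂ ≤ 1 →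
      I (S t₂ z) ≤ I (S t₁ z) - δ / 4 * (t₂ * τ z - t₁ * τ z) := by
    intro z t₁ t₂ h0 h12 h2
    exact hτI z _ _ (mul_nonneg h0 (hτ z).1) (mul_le_mul_of_nonneg_right h12 (hτ z).1)
      (mul_le_of_le_one_left (hτ z).1 h2)
  have hSanti : ∀ z t₁ t₂, 0 ≤ t₁ → t₁ ≤ t₂ → t₂ ≤ 1 → I (S t₂ z) ≤ I (S t₁ z) := by
    intro z t₁ t₂ h0 h12 h2
    have h3 := hSI z t₁ t₂ h0 h12 h2
    have h4 : t₁ * τ z ≤ t₂ * τ z := mul_le_mul_of_nonneg_right h12 (hτ z).1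
    nlinarith [sub_nonneg.2 h4]
  have hSτ : ∀ z t, 0 ≤ t → t ≤ 1 → t * τ z ≤ 4 / δ * (I z - I (S t z)) := by
    intro z t h0 h1
    have := hSI z 0 t le_rfl h0 h1
    rw [hS0, zero_mul, sub_zero] at this
    rw [div_mul_eq_mul_div, le_div_iff₀ hδ]
    linarith
  have hnorm : ∀ t z, 0 ≤ t → ‖(t * τ z) • V z‖ ≤ t * τ z := by
    intro t z h0
    have h1 : 0 ≤ t * τ z := mul_nonneg h0 (hτ z).1
    rw [norm_smul, Real.norm_eq_abs, abs_of_nonneg h1]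
    exact mul_le_of_le_one_right h1 (hV1 z)
  have hSreach : ∀ z t, 0 ≤ t → t ≤ 1 → D.Reach (4 / δ * (I z - I (S t z))) z (S t z) :=
    fun z t h0 h1 => D.reach_move _ z ((hnorm t z h0).trans (hSτ z t h0 h1))
  have hSfix : ∀ z, z ∉ A → ∀ t, S t z = z := by
    intro z hz t
    have h0 : τ z = 0 := le_antisymm (not_lt.1 fun h => hz ((hτA z).1 h)) (hτ z).1
    simp [S, h0, D.move_zero]
  have hSσ : ∀ t z, S t (σ z) = σ (S t z) := by
    intro t z
    simp only [S, hτσ, hmoveσ]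
  have hanti := fun n z => antitone_stepFlow hS0 hSanti n z
  -- the choice of `ε`
  obtain ⟨ε, hε, hεε₀, hεL⟩ : ∃ ε > 0, ε < ε₀ ∧ 4 / δ * (2 * ε) ≤ L := by
    refine ⟨min (ε₀ / 2) (L * δ / 8), by positivity, (min_le_left _ _).trans_lt (half_lt_self hε₀),
      ?_⟩
    have := min_le_right (ε₀ / 2) (L * δ / 8)
    calc _ ≤ 4 / δ * (2 * (L * δ / 8)) := by gcongr
      _ = L := by field_simp; norm_num
  -- Every number of steps n ≥ a gives the same point, because later steps have parameter 0. Near a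
  -- given time one fixed n works, whence the continuity.
  let Φ : ℝ → E → E := fun a z => stepFlow S ⌈a⌉₊ a z
  have hΦ : ∀ (n : ℕ) (a : ℝ) z, a ≤ n → Φ a z = stepFlow S n a z := by
    intro n a z h
    exact (stepFlow_eq_of_le hS0 (Nat.le_ceil a) (Nat.ceil_le.2 h) z).symm
  have hΦc : Continuous fun p : ℝ × E => Φ p.1 p.2 := by
    rw [continuous_iff_continuousAt]
    rintro ⟨a, z⟩
    obtain ⟨n, hn⟩ := exists_nat_gt a
    refine (continuous_stepFlow hSc n).continuousAt.congr ?_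
    have : ∀ᶠ p : ℝ × E in 𝓝 (a, z), p.1 < n :=
      continuous_fst.continuousAt.eventually (gt_mem_nhds hn)
    filter_upwards [this] with p hp
    exact (hΦ n _ _ hp.le).symm
  have hΦanti : ∀ z, Antitone fun a => I (Φ a z) := by
    intro z a a' h
    obtain ⟨n, hn⟩ := exists_nat_gt a'
    simp only [hΦ n a' z hn.le, hΦ n a z (h.trans hn.le)]
    exact hanti n z h
  have hΦreach : ∀ (n : ℕ) (a : ℝ) z, (n : ℝ) ≤ a →
      D.Reach (4 / δ * (I (Φ n z) - I (Φ a z))) (Φ n z) (Φ a z) := by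
    intro n a z h
    have h1 : Φ n z = stepFlow S n a z := by
      rw [hΦ n n z le_rfl, stepFlow_of_ge le_rfl h]
    rw [h1]
    exact D.reach_stepFlow hSreach (Nat.cast_le.1 (h.trans (Nat.le_ceil a))) a z
  -- the orbit of a point at level `≤ b + ε` goes below `b - ε` or gets close to `K`
  have horbit : ∀ z, I z ≤ b + ε →
      ∃ n : ℕ, I (Φ n z) < b - ε ∨ Φ n z ∈ Metric.thickening r K := by
    intro z hz
    by_contra hcon
    push Not at hcon
    have hstep : ∀ n : ℕ, Φ ((n + 1 : ℕ) : ℝ) z = S 1 (Φ n z) := by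
      intro n
      rw [hΦ (n + 1) _ z le_rfl, hΦ n _ z le_rfl, stepFlow,
        stepFlow_of_ge (a' := (n : ℝ)) (by push_cast; linarith) le_rfl,
        clip_of_one_le (by push_cast; linarith)]
    have hΦ0 : Φ (0 : ℕ) z = z := by rw [hΦ 0 _ z le_rfl]; rfl
    -- An orbit that stays above b - ε loses at most 2ε of energy, so its total length is finite.
    have hsum : Summable fun n : ℕ => τ (Φ n z) := by
      refine summable_of_sum_range_le (c := 4 / δ * (2 * ε)) (fun n => (hτ _).1) fun n => ?_
      have h1 : ∑ i ∈ Finset.range n, τ (Φ i z) ≤ 4 / δ * (I z - I (Φ n z)) := by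
        induction n with
        | zero => rw [hΦ0]; simp
        | succ n ih =>
          rw [Finset.sum_range_succ, hstep]
          have := hSτ (Φ n z) 1 zero_le_one le_rfl
          rw [one_mul] at this
          calc _ ≤ _ := add_le_add ih this
            _ = _ := by ring
      refine h1.trans ?_
      have := (hcon n).1
      gcongr
      linarith
    obtain ⟨z', hz'⟩ := D.exists_tendsto_of_summable
      (z := fun n : ℕ => Φ n z) (w := fun n : ℕ => (1 * τ (Φ n z)) • V (Φ n z)) hstep
      (hsum.of_nonneg_of_le (fun _ => norm_nonneg _) fun n => by
        simpa using hnorm 1 (Φ n z) zero_le_one)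
    -- The step lengths tend to 0, so the limit cannot lie in A, where τ > 0. Since its level is
    -- within ε of b, it must be close to K, and then so is the orbit: a contradiction.
    have hτ0 : τ z' = 0 :=
      tendsto_nhds_unique ((hτc.tendsto z').comp hz') hsum.tendsto_atTop_zero
    have hzA : z' ∉ A := fun h => by
      have := (hτA z').2 h
      linarith
    have hI1 : b - ε ≤ I z' := ge_of_tendsto' ((hIc.tendsto z').comp hz') fun n => (hcon n).1
    have hI2 : I z' ≤ b + ε := le_of_tendsto' ((hIc.tendsto z').comp hz') fun n => by
      have := hΦanti z (Nat.cast_nonneg (α := ℝ) n)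
      simp only [Nat.cast_zero] at hΦ0 this
      rw [hΦ0] at this
      exact this.trans hz
    have hzK : z' ∈ Metric.cthickening (r / 2) K := by
      by_contra h
      have : |I z' - b| < ε₀ := abs_lt.2 ⟨by linarith, by linarith⟩
      exact hzA ⟨this, h⟩
    have hzK' : z' ∈ Metric.thickening r K :=
      Metric.cthickening_subset_thickening' hr (half_lt_self hr) K hzK
    obtain ⟨n, hn⟩ := (hz'.eventually (Metric.isOpen_thickening.mem_nhds hzK')).exists
    exact (hcon n).2 hn
  -- Admissible stopping times. Asking for every later x' makes the set an upper ray, hence convex,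
  -- so that a continuous selection exists. The clause z ∈ O records that only starting points in O
  -- may fail to descend.
  let P : E → Set ℝ := fun z => {x | 0 ≤ x ∧ ∀ x', x ≤ x' → I z ≤ b + ε →
    I (Φ x' z) ≤ b - ε ∨ (Φ x' z ∈ O ∧ z ∈ O)}
  have hPup : ∀ z x y, x ∈ P z → x ≤ y → y ∈ P z := fun z x y hx hxy =>
    ⟨hx.1.trans hxy, fun x' hx' => hx.2 x' (hxy.trans hx')⟩
  have hPconv : ∀ z, Convex ℝ (P z) := fun z =>
    Set.OrdConnected.convex ⟨fun x hx y _ w hw => hPup z x w hx hw.1⟩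
  have hPloc : ∀ z, ∃ c, ∀ᶠ y in 𝓝 z, c ∈ P y := by
    intro z
    by_cases hz : I z ≤ b + ε
    · obtain ⟨n, hn⟩ := horbit z hz
      have hΦn : Continuous fun y => Φ n y :=
        hΦc.comp (by fun_prop : Continuous fun y : E => ((n : ℝ), y))
      refine ⟨n, ?_⟩
      rcases hn with hn | hn
      · have hev := ((hIc.comp hΦn).tendsto z).eventually_lt_const hn
        filter_upwards [hev] with y hy
        exact ⟨Nat.cast_nonneg n, fun x' hx' _ => Or.inl ((hΦanti y hx').trans hy.le)⟩
      · have hev := (hΦn.tendsto z).eventually (Metric.isOpen_thickening.mem_nhds hn)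
        filter_upwards [hev] with y hy
        refine ⟨Nat.cast_nonneg n, fun x' hx' hyb => ?_⟩
        by_contra hcon
        push Not at hcon
        obtain ⟨h1, h2⟩ := hcon
        have hΦ0 : Φ (0 : ℕ) y = y := by rw [hΦ 0 _ y le_rfl]; rfl
        have hn0 : I (Φ n y) ≤ I y := by
          have := hΦanti y (Nat.cast_nonneg (α := ℝ) n)
          simp only [Nat.cast_zero] at hΦ0 this
          rwa [hΦ0] at this
        have hx0 : I (Φ x' y) ≤ I (Φ n y) := hΦanti y hx'
        -- The point at time n is near K. If the orbit is still above b - ε at time x', the parts of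
        -- it before and after time n each lose at most 2ε, so their lengths are at most L. Hence
        -- the final point, reached from near K, and the starting point, from which K is approached,
        -- both lie in O.
        refine h2 (hreach _ hy _ (Or.inl ((hΦreach n x' y hx').mono ?_)))
          (hreach _ hy _ (Or.inr ?_))
        · refine le_trans ?_ hεL
          gcongr
          linarith
        · have := hΦreach 0 n y (by simp)
          rw [hΦ0] at this
          refine this.mono (le_trans ?_ hεL)
          gcongr
          linarith
    · refine ⟨0, ?_⟩
      filter_upwards [(hIc.tendsto z).eventually_const_lt (not_le.1 hz)] with y hy
      exact ⟨le_rfl, fun x' _ h => absurd h (not_le.2 hy)⟩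
  obtain ⟨T, hT⟩ := exists_continuous_forall_mem_convex_of_local_const hPconv hPloc
  -- The maximum makes the stopping time even, and it remains admissible because the admissible
  -- times form an upper set.
  let T' : E → ℝ := fun z => max (T z) (T (σ z))
  have hT'c : Continuous T' := T.continuous.max (T.continuous.comp σ.continuous)
  have hT'σ : ∀ z, T' (σ z) = T' z := by intro z; simp only [T', hσ, max_comm]
  have hT'P : ∀ z, T' z ∈ P z := fun z => hPup z _ _ (hT z) (le_max_left _ _)
  have hT'0 : ∀ z, 0 ≤ T' z := fun z => (hT'P z).1
  refine ⟨ε, hε, hεε₀.trans_le hε₀', fun p => Φ (p.1 * T' p.2) p.2, ?_, ?_, ?_, ?_, ?_, ?_, ?_⟩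
  · exact hΦc.comp (by fun_prop : Continuous fun p : unitInterval × E =>
      ((p.1 : ℝ) * T' p.2, p.2))
  · intro z
    simp only [Set.Icc.coe_zero, zero_mul, Φ]
    exact stepFlow_nonpos hS0 _ le_rfl z
  · intro t z hz
    refine stepFlow_fixed (hSfix z fun h => ?_) _ _
    have h1 : |I z - b| < ε₀ := h.1
    have := (abs_lt.1 h1).1
    linarith
  · intro z t t' h
    exact hΦanti z (mul_le_mul_of_nonneg_right h (hT'0 z))
  · intro z hz hzO
    simp only [Set.Icc.coe_one, one_mul]
    exact ((hT'P z).2 _ le_rfl hz).resolve_right fun h => hzO h.2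
  · intro z hz
    simp only [Set.Icc.coe_one, one_mul]
    exact ((hT'P z).2 _ le_rfl hz).imp_right And.left
  · intro t z
    simp only [hT'σ, Φ]
    exact stepFlow_equivariant hSσ _ _ z

end ScalingGroup

end FracNLS
end

/-! ### Dilations and the Fourier transform on L². -/

noncomputable section

namespace FracNLS

section L2

variable {N : ℕ} {F : Type*} [NormedAddCommGroup F]

theorem norm_sq_eq_integral [InnerProductSpace ℝ F] {α : Type*} [MeasurableSpace α]
    {μ : Measure α} (f : Lp F 2 μ) : ‖f‖ ^ 2 = ∫ x, ‖f x‖ ^ 2 ∂μ := by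
  have h := real_inner_self_eq_norm_sq f
  rw [L2.inner_def] at h
  rw [← h]
  exact integral_congr_ae (.of_forall fun x => real_inner_self_eq_norm_sq (f x))

theorem integrable_norm_sq {α : Type*} [MeasurableSpace α] {μ : Measure α} (f : Lp F 2 μ) :
    Integrable (fun x => ‖f x‖ ^ 2) μ :=
  (memLp_two_iff_integrable_sq_norm (Lp.aestronglyMeasurable f)).1 (Lp.memLp f)

theorem measurePreserving_smul_exp (a : ℝ) :
    MeasurePreserving (fun x : RN N => Real.exp (-a) • x) volume
      (ENNReal.ofReal (Real.exp (N * a)) • volume) := by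
  refine ⟨measurable_const_smul _, ?_⟩
  rw [Measure.map_addHaar_smul _ (Real.exp_pos _).ne', finrank_euclideanSpace_fin,
    ← Real.exp_nat_mul, ← Real.exp_neg, abs_of_pos (Real.exp_pos _)]
  congr 3
  ring

theorem quasiMeasurePreserving_smul_exp (a : ℝ) :
    Measure.QuasiMeasurePreserving (fun x : RN N => Real.exp (-a) • x) volume volume :=
  (measurePreserving_smul_exp a).quasiMeasurePreserving.mono_right
    Measure.smul_absolutelyContinuous

theorem memLp_comp_smul_exp {f : RN N → F} (hf : MemLp f 2 volume) (a : ℝ) :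
    MemLp (fun x => f (Real.exp (-a) • x)) 2 volume :=
  (hf.smul_measure ENNReal.ofReal_ne_top).comp_measurePreserving (measurePreserving_smul_exp a)

theorem comp_smul_exp_congr {G : Type*} {f g : RN N → G} (h : f =ᵐ[volume] g) (a : ℝ) :
    (fun x => f (Real.exp (-a) • x)) =ᵐ[volume] fun x => g (Real.exp (-a) • x) :=
  (quasiMeasurePreserving_smul_exp a).ae_eq_comp h

variable [NormedSpace ℝ F]

/-- The dilation `f ↦ f(e^{-a} ·)` on `L²`. -/
def dil (a : ℝ) : Lp F 2 (volume : Measure (RN N)) →ₗ[ℝ] Lp F 2 (volume : Measure (RN N)) where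
  toFun f := (memLp_comp_smul_exp (Lp.memLp f) a).toLp
  map_add' f g := by
    rw [← MemLp.toLp_add]
    exact MemLp.toLp_congr _ _ (comp_smul_exp_congr (Lp.coeFn_add f g) a)
  map_smul' c f := by
    rw [RingHom.id_apply, ← MemLp.toLp_const_smul]
    exact MemLp.toLp_congr _ _ (comp_smul_exp_congr (Lp.coeFn_smul c f) a)

theorem coeFn_dil (a : ℝ) (f : Lp F 2 (volume : Measure (RN N))) :
    dil a f =ᵐ[volume] fun x => f (Real.exp (-a) • x) :=
  (memLp_comp_smul_exp (Lp.memLp f) a).coeFn_toLp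

theorem dil_zero (f : Lp F 2 (volume : Measure (RN N))) : dil 0 f = f := by
  refine Lp.ext ?_
  filter_upwards [coeFn_dil 0 f] with x hx
  rw [hx]
  simp

theorem dil_add (a b : ℝ) (f : Lp F 2 (volume : Measure (RN N))) :
    dil (a + b) f = dil a (dil b f) := by
  refine Lp.ext ?_
  filter_upwards [coeFn_dil (a + b) f, coeFn_dil a (dil b f),
    comp_smul_exp_congr (coeFn_dil b f) a] with x h1 h2 h3
  rw [h1, h2, h3, smul_smul, ← Real.exp_add]
  ring_nf

theorem dil_toLp {f : RN N → F} (hf : MemLp f 2 volume) (a : ℝ) :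
    dil a hf.toLp = (memLp_comp_smul_exp hf a).toLp :=
  MemLp.toLp_congr (memLp_comp_smul_exp (Lp.memLp _) a) (memLp_comp_smul_exp hf a)
    (comp_smul_exp_congr hf.coeFn_toLp a)

theorem norm_dil (a : ℝ) (f : Lp F 2 (volume : Measure (RN N))) :
    ‖dil a f‖ = Real.exp (N * a / 2) * ‖f‖ := by
  have h1 : ‖dil a f‖ = (eLpNorm (fun x => f (Real.exp (-a) • x)) 2 volume).toReal :=
    Lp.norm_toLp _ (memLp_comp_smul_exp (Lp.memLp f) a)
  have h2 : eLpNorm (fun x => f (Real.exp (-a) • x)) 2 volume =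
      eLpNorm f 2 (ENNReal.ofReal (Real.exp (N * a)) • volume) :=
    eLpNorm_comp_measurePreserving
      ((Lp.aestronglyMeasurable f).mono_ac Measure.smul_absolutelyContinuous)
      (measurePreserving_smul_exp a)
  rw [h1, h2, eLpNorm_smul_measure_of_ne_top ENNReal.ofNat_ne_top, smul_eq_mul, ENNReal.toReal_mul,
    Lp.norm_def, ENNReal.ofReal_rpow_of_pos (Real.exp_pos _),
    ENNReal.toReal_ofReal (by positivity), ← Real.exp_mul]
  congr 2
  norm_num
  ring

end L2

section DilationContinuity

variable {N : ℕ} {F : Type*} [NormedAddCommGroup F] [InnerProductSpace ℝ F]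

theorem tendsto_dil_toLp {g : RN N → F} (hgc : Continuous g) (hgs : HasCompactSupport g)
    (hg : MemLp g 2 volume) (a₀ : ℝ) :
    Tendsto (fun a => dil a hg.toLp) (𝓝 a₀) (𝓝 (dil a₀ hg.toLp)) := by
  rw [tendsto_iff_norm_sub_tendsto_zero]
  have hsq : ∀ a, ‖dil a hg.toLp - dil a₀ hg.toLp‖ ^ 2 =
      ∫ x : RN N, ‖g (Real.exp (-a) • x) - g (Real.exp (-a₀) • x)‖ ^ 2 := by
    intro a
    rw [norm_sq_eq_integral, dil_toLp, dil_toLp]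
    refine integral_congr_ae ?_
    filter_upwards [Lp.coeFn_sub (memLp_comp_smul_exp hg a).toLp (memLp_comp_smul_exp hg a₀).toLp,
      (memLp_comp_smul_exp hg a).coeFn_toLp, (memLp_comp_smul_exp hg a₀).coeFn_toLp]
      with x h1 h2 h3
    rw [h1, Pi.sub_apply, h2, h3]
  obtain ⟨C, hC⟩ := hgc.bounded_above_of_compact_support hgs
  obtain ⟨ρ, hρ⟩ := hgs.isCompact.isBounded.subset_closedBall (0 : RN N)
  set R := ρ * Real.exp (a₀ + 1) with hR
  have hzero : ∀ a x, a < a₀ + 1 → x ∉ Metric.closedBall (0 : RN N) R →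
      g (Real.exp (-a) • x) = 0 := by
    intro a x ha hx
    by_contra hne
    apply hx
    have h1 := hρ (subset_tsupport g hne)
    rw [mem_closedBall_zero_iff, norm_smul, Real.norm_eq_abs, abs_of_pos (Real.exp_pos _)] at h1
    rw [mem_closedBall_zero_iff]
    have h2 : ‖x‖ = Real.exp a * (Real.exp (-a) * ‖x‖) := by
      rw [← mul_assoc, ← Real.exp_add, add_neg_cancel, Real.exp_zero, one_mul]
    have h3 : 0 ≤ ρ := le_trans (by positivity) h1
    calc ‖x‖ = Real.exp a * (Real.exp (-a) * ‖x‖) := h2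
      _ ≤ Real.exp (a₀ + 1) * ρ := by gcongr
      _ = R := by rw [hR, mul_comm]
  have hlim : Tendsto (fun a => ∫ x : RN N, ‖g (Real.exp (-a) • x) - g (Real.exp (-a₀) • x)‖ ^ 2)
      (𝓝 a₀) (𝓝 (∫ _ : RN N, (0 : ℝ))) := by
    refine tendsto_integral_filter_of_dominated_convergence
      ((Metric.closedBall (0 : RN N) R).indicator fun _ => (2 * C) ^ 2) ?_ ?_ ?_ ?_
    · refine .of_forall fun a => Continuous.aestronglyMeasurable ?_
      fun_prop
    · have hev : ∀ᶠ a in 𝓝 a₀, a < a₀ + 1 := gt_mem_nhds (by linarith)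
      filter_upwards [hev] with a ha
      refine .of_forall fun x => ?_
      by_cases hx : x ∈ Metric.closedBall (0 : RN N) R
      · rw [indicator_of_mem hx, norm_pow, norm_norm]
        have h1 := norm_sub_le (g (Real.exp (-a) • x)) (g (Real.exp (-a₀) • x))
        have h2 := hC (Real.exp (-a) • x)
        have h3 := hC (Real.exp (-a₀) • x)
        gcongr
        linarith
      · rw [indicator_of_notMem hx, hzero a x ha hx, hzero a₀ x (by linarith) hx]
        simp
    · refine (integrable_indicator_iff measurableSet_closedBall).2 ?_
      exact integrableOn_const (measure_closedBall_lt_top.ne)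
    · refine .of_forall fun x => ?_
      have hc : Continuous fun a : ℝ => ‖g (Real.exp (-a) • x) - g (Real.exp (-a₀) • x)‖ ^ 2 := by
        fun_prop
      simpa using hc.tendsto a₀
  rw [integral_zero] at hlim
  simp only [← hsq] at hlim
  have := hlim.sqrt
  simpa [Real.sqrt_sq (norm_nonneg _)] using this

/-- Continuous functions of compact support are dense, and for them dominated convergence applies.
The norms of the dilations are bounded for a ≤ a₀ + 1, so the approximation error is uniform near
a₀. -/
theorem continuous_dil (f : Lp F 2 (volume : Measure (RN N))) : Continuous fun a => dil a f := by
  rw [continuous_iff_continuousAt]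
  intro a₀
  rw [ContinuousAt, Metric.tendsto_nhds]
  intro ε hε
  set M := Real.exp (N * (a₀ + 1) / 2) with hM
  have hMpos : 0 < M := Real.exp_pos _
  set δ := ε / (4 * M) with hδ
  have hδpos : 0 < δ := by positivity
  obtain ⟨g, hgs, hfg, hgc, hg⟩ := (Lp.memLp f).exists_hasCompactSupport_eLpNorm_sub_le
    ENNReal.ofNat_ne_top (ε := ENNReal.ofReal δ) (by simpa using hδpos)
  have hnorm : ‖f - hg.toLp‖ ≤ δ := by
    have : f - hg.toLp = ((Lp.memLp f).sub hg).toLp ((f : RN N → F) - g) := by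
      rw [MemLp.toLp_sub (Lp.memLp f) hg, Lp.toLp_coeFn]
    rw [this, Lp.norm_toLp]
    exact ENNReal.toReal_le_of_le_ofReal hδpos.le hfg
  have hev : ∀ᶠ a in 𝓝 a₀, a < a₀ + 1 := gt_mem_nhds (by linarith)
  have hbd : ∀ a, a ≤ a₀ + 1 → ‖dil a f - dil a hg.toLp‖ ≤ ε / 4 := by
    intro a ha
    rw [← map_sub, norm_dil]
    calc Real.exp (N * a / 2) * ‖f - hg.toLp‖ ≤ M * δ := by
          rw [hM]; gcongr
      _ = ε / 4 := by rw [hδ]; field_simp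
  filter_upwards [hev, Metric.tendsto_nhds.1 (tendsto_dil_toLp hgc hgs hg a₀) (ε / 4)
    (by positivity)] with a ha hlt
  rw [dist_eq_norm] at hlt ⊢
  have h1 := hbd a ha.le
  have h2 := hbd a₀ (by linarith)
  have h3 : dil a f - dil a₀ f = (dil a f - dil a hg.toLp) + (dil a hg.toLp - dil a₀ hg.toLp) -
      (dil a₀ f - dil a₀ hg.toLp) := by abel
  rw [h3]
  refine (norm_sub_le _ _).trans_lt ?_
  have := norm_add_le (dil a f - dil a hg.toLp) (dil a hg.toLp - dil a₀ hg.toLp)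
  linarith

end DilationContinuity

section Fourier

variable {N : ℕ}

theorem fourier_comp_smul_exp (f : RN N → ℂ) (a : ℝ) (ξ : RN N) :
    𝓕 (fun x => f (Real.exp (-a) • x)) ξ = Real.exp (N * a) • 𝓕 f (Real.exp a • ξ) := by
  simp only [Real.fourier_eq]
  have h := Measure.integral_comp_smul (volume : Measure (RN N))
    (fun x => 𝐞 (-(inner ℝ x (Real.exp a • ξ))) • f x) (Real.exp (-a))
  rw [finrank_euclideanSpace_fin, ← Real.exp_nat_mul, ← Real.exp_neg,
    abs_of_pos (Real.exp_pos _)] at h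
  have h2 : -(N * -a : ℝ) = N * a := by ring
  rw [h2] at h
  rw [← h]
  congr 1
  ext x
  rw [inner_smul_left, inner_smul_right]
  simp only [conj_trivial]
  rw [← mul_assoc, ← Real.exp_add, neg_add_cancel, Real.exp_zero, one_mul]

/-- The Fourier transform intertwines dilations. -/
theorem fourier_dil (a : ℝ) (f : Lp ℂ 2 (volume : Measure (RN N))) :
    𝓕 (dil a f) = Real.exp (N * a) • dil (-a) (𝓕 f) := by
  have hcont : ∀ a, Continuous (dil a : Lp ℂ 2 (volume : Measure (RN N)) →ₗ[ℝ] _) := by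
    intro a
    exact (AddMonoidHomClass.continuous_of_bound (dil a) _ fun f => (norm_dil a f).le)
  refine DenseRange.induction_on (p := fun f => 𝓕 (dil a f) = Real.exp (N * a) • dil (-a) (𝓕 f))
    (SchwartzMap.denseRange_toLpCLM (p := 2) ENNReal.ofNat_ne_top) f ?_ ?_
  · refine isClosed_eq ?_ ?_
    · exact (Lp.fourierTransformₗᵢ (RN N) ℂ).continuous.comp (hcont a)
    · exact ((hcont (-a)).comp (Lp.fourierTransformₗᵢ (RN N) ℂ).continuous).const_smul (Real.exp (N * a))
  · intro φ
    let e : RN N ≃L[ℝ] RN N := ContinuousLinearEquiv.smulLeft (Units.mk0 _ (Real.exp_pos (-a)).ne')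
    let ψ : SchwartzMap (RN N) ℂ := SchwartzMap.compCLMOfContinuousLinearEquiv ℂ e φ
    have hψ : ∀ x, ψ x = φ (Real.exp (-a) • x) := fun x => rfl
    have h1 : dil a (φ.toLp 2) = ψ.toLp 2 := by
      refine (dil_toLp _ a).trans (MemLp.toLp_congr _ _ (.of_forall fun x => (hψ x).symm))
    rw [SchwartzMap.toLpCLM_apply, h1, SchwartzMap.toLp_fourier_eq, SchwartzMap.toLp_fourier_eq]
    refine Lp.ext ?_
    filter_upwards [(𝓕 ψ).coeFn_toLp 2 volume,
      Lp.coeFn_smul (Real.exp (N * a)) (dil (-a) ((𝓕 φ).toLp 2)), coeFn_dil (-a) ((𝓕 φ).toLp 2),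
      comp_smul_exp_congr ((𝓕 φ).coeFn_toLp 2 volume) (-a)] with ξ h2 h3 h4 h5
    rw [h2, h3, Pi.smul_apply, h4, h5, neg_neg, SchwartzMap.fourier_coe, SchwartzMap.fourier_coe]
    exact fourier_comp_smul_exp _ _ _

/-- The Fourier transform commutes with linear isometries. -/
theorem fourier_compMeasurePreserving (A : RN N ≃ₗᵢ[ℝ] RN N)
    (f : Lp ℂ 2 (volume : Measure (RN N))) :
    𝓕 (Lp.compMeasurePreserving A A.measurePreserving f) =
      Lp.compMeasurePreserving A A.measurePreserving (𝓕 f) := by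
  have hcont := (Lp.isometry_compMeasurePreserving (E := ℂ) (p := 2) A.measurePreserving).continuous
  refine DenseRange.induction_on
    (p := fun f => 𝓕 (Lp.compMeasurePreserving A A.measurePreserving f) =
      Lp.compMeasurePreserving A A.measurePreserving (𝓕 f))
    (SchwartzMap.denseRange_toLpCLM (p := 2) ENNReal.ofNat_ne_top) f ?_ ?_
  · exact isClosed_eq ((Lp.fourierTransformₗᵢ (RN N) ℂ).continuous.comp hcont)
      (hcont.comp (Lp.fourierTransformₗᵢ (RN N) ℂ).continuous)
  · intro φ
    let ψ : SchwartzMap (RN N) ℂ :=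
      SchwartzMap.compCLMOfContinuousLinearEquiv ℂ A.toContinuousLinearEquiv φ
    have hψ : (ψ : RN N → ℂ) = φ ∘ A := rfl
    have h1 : Lp.compMeasurePreserving A A.measurePreserving (φ.toLp 2) = ψ.toLp 2 :=
      (Lp.toLp_compMeasurePreserving _ _).trans (MemLp.toLp_congr _ _ (.of_forall fun x => rfl))
    rw [SchwartzMap.toLpCLM_apply, h1, SchwartzMap.toLp_fourier_eq, SchwartzMap.toLp_fourier_eq]
    refine Lp.ext ?_
    filter_upwards [(𝓕 ψ).coeFn_toLp 2 volume,
      Lp.coeFn_compMeasurePreserving ((𝓕 φ).toLp 2) A.measurePreserving,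
      A.measurePreserving.quasiMeasurePreserving.ae_eq_comp ((𝓕 φ).coeFn_toLp 2 volume)]
      with ξ h2 h3 h4
    rw [h2, h3, h4, Function.comp_apply, SchwartzMap.fourier_coe, SchwartzMap.fourier_coe, hψ]
    exact Real.fourier_comp_linearIsometry _ _ _

/-- On `L¹ ∩ L²` the inverse Fourier transform is given by the integral. -/
theorem fourierInv_ae_eq (f : Lp ℂ 2 (volume : Measure (RN N))) (hf : Integrable f volume) :
    (𝓕⁻ f : Lp ℂ 2 (volume : Measure (RN N))) =ᵐ[volume] 𝓕⁻ (f : RN N → ℂ) := by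
  have hint : LocallyIntegrable (𝓕⁻ f : Lp ℂ 2 (volume : Measure (RN N))) volume :=
    (Lp.memLp _).locallyIntegrable one_le_two
  have hcont : Continuous (𝓕⁻ (f : RN N → ℂ)) := by
    have : 𝓕⁻ (f : RN N → ℂ) = fun x => 𝓕 (f : RN N → ℂ) (-x) := by
      ext x; rw [Real.fourierInv_eq_fourier_neg]
    rw [this]
    exact (VectorFourier.fourierIntegral_continuous Real.continuous_fourierChar
      (by exact continuous_inner) hf).comp continuous_neg
  -- Both sides are compared against smooth test functions. The L² transform is known as a tempered
  -- distribution, and the self-adjointness of the Fourier integral turns its pairing into the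
  -- pairing with the integral formula.
  refine ae_eq_of_integral_contDiff_smul_eq hint hcont.locallyIntegrable fun g hg hgs => ?_
  have hgs' : HasCompactSupport fun x => (g x : ℂ) := hgs.comp_left Complex.ofReal_zero
  have hg' : ContDiff ℝ ((⊤ : ℕ∞) : WithTop ℕ∞) fun x => (g x : ℂ) :=
    Complex.ofRealCLM.contDiff.comp hg
  let φ : SchwartzMap (RN N) ℂ := hgs'.toSchwartzMap hg'
  have hφ : ∀ x, φ x = (g x : ℂ) := fun x => rfl
  have h1 := congrArg (fun T => T φ) (Lp.fourierInv_toTemperedDistribution_eq f)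
  simp only [TemperedDistribution.fourierInv_apply, Lp.toTemperedDistribution_apply] at h1
  have h2 := VectorFourier.integral_fourierIntegral_smul_eq_flip (μ := volume) (ν := volume)
    (L := -(innerₗ (RN N))) (e := Real.fourierChar) (f := φ) (g := (f : RN N → ℂ))
    Real.continuous_fourierChar (by exact (continuous_inner.neg)) φ.integrable hf
  have h4 : ∀ x, g x • ((𝓕⁻ f : Lp ℂ 2 (volume : Measure (RN N))) : RN N → ℂ) x =
      φ x • ((𝓕⁻ f : Lp ℂ 2 (volume : Measure (RN N))) : RN N → ℂ) x := by
    intro x; rw [hφ, Complex.real_smul, smul_eq_mul]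
  have h5 : ∀ ξ, (𝓕⁻ φ) ξ = VectorFourier.fourierIntegral 𝐞 volume (-innerₗ (RN N)) φ ξ := by
    intro ξ
    rw [SchwartzMap.fourierInv_coe]
    rfl
  have h6 : ∀ x, 𝓕⁻ (f : RN N → ℂ) x =
      VectorFourier.fourierIntegral 𝐞 volume (-innerₗ (RN N)).flip (f : RN N → ℂ) x := by
    intro x
    rw [Real.fourierInv_eq]
    simp [VectorFourier.fourierIntegral, real_inner_comm]
  simp only [h4, h6]
  simp only [h5] at h1
  exact h1.symm.trans h2

end Fourier

end FracNLS
end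

/-! ### The space H^s_r: completeness and dilations. -/

noncomputable section

namespace FracNLS

variable {N : ℕ} {s : ℝ}

theorem kinetic_eq_norm_sq (u : Hsr N s) : kinetic u = ‖fracLap u‖ ^ 2 :=
  (norm_sq_eq_integral _).symm

theorem mass_eq_norm_sq (u : Hsr N s) : mass u = ‖Hsr.toL2 u‖ ^ 2 := by
  rw [norm_sq_eq_integral, mass]
  simp only [Real.norm_eq_abs, sq_abs]

theorem kinetic_nonneg (u : Hsr N s) : 0 ≤ kinetic u := by
  rw [kinetic_eq_norm_sq]; positivity

theorem mass_nonneg (u : Hsr N s) : 0 ≤ mass u := by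
  rw [mass_eq_norm_sq]; positivity

theorem norm_fracLap_le (u : Hsr N s) : ‖fracLap u‖ ≤ ‖u‖ := by
  refine le_of_sq_le_sq ?_ (norm_nonneg u)
  rw [Hsr.norm_sq_eq, kinetic_eq_norm_sq]
  linarith [mass_nonneg u]

theorem norm_toL2_le (u : Hsr N s) : ‖Hsr.toL2 u‖ ≤ ‖u‖ := by
  refine le_of_sq_le_sq ?_ (norm_nonneg u)
  rw [Hsr.norm_sq_eq, mass_eq_norm_sq]
  linarith [kinetic_nonneg u]

/-- `(-Δ)^{s/2}` as a bounded operator. -/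
def fracLapL : Hsr N s →L[ℝ] Lp ℂ 2 (volume : Measure (RN N)) :=
  fracLap.mkContinuous 1 fun u => by simpa using norm_fracLap_le u

/-- The inclusion into `L²` as a bounded operator. -/
def toL2L : Hsr N s →L[ℝ] Lp ℝ 2 (volume : Measure (RN N)) :=
  Hsr.toL2.mkContinuous 1 fun u => by simpa using norm_toL2_le u

theorem fracLapL_apply (u : Hsr N s) : fracLapL u = fracLap u := rfl

theorem toL2L_apply (u : Hsr N s) : toL2L u = Hsr.toL2 u := rfl

/-- The complexification `L²(ℝ^N; ℝ) → L²(ℝ^N; ℂ)`. -/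
def complexify (v : Lp ℝ 2 (volume : Measure (RN N))) : Lp ℂ 2 (volume : Measure (RN N)) :=
  Complex.ofRealCLM.compLpL 2 volume v

theorem coeFn_complexify (v : Lp ℝ 2 (volume : Measure (RN N))) :
    complexify v =ᵐ[volume] fun x => (v x : ℂ) :=
  Complex.ofRealCLM.coeFn_compLpL v

theorem norm_complexify (v : Lp ℝ 2 (volume : Measure (RN N))) : ‖complexify v‖ = ‖v‖ := by
  rw [Lp.norm_def, Lp.norm_def, eLpNorm_congr_ae (coeFn_complexify v)]
  congr 1
  refine eLpNorm_congr_norm_ae (.of_forall fun x => ?_)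
  simp

theorem fourierL2_eq (v : Lp ℝ 2 (volume : Measure (RN N))) :
    fourierL2 N v = 𝓕 (complexify v) := rfl

theorem fourierInv_fourierL2 (v : Lp ℝ 2 (volume : Measure (RN N))) :
    𝓕⁻ (fourierL2 N v) = complexify v := by
  rw [fourierL2_eq, FourierTransform.fourierInv_fourier_eq]

theorem norm_fourierL2 (v : Lp ℝ 2 (volume : Measure (RN N))) : ‖fourierL2 N v‖ = ‖v‖ := by
  rw [fourierL2_eq, Lp.norm_fourier_eq, norm_complexify]

theorem continuous_fourierL2 : Continuous (fourierL2 N) :=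
  (Lp.fourierTransformₗᵢ (RN N) ℂ).continuous.comp (Complex.ofRealCLM.compLpL 2 volume).continuous

/-- The Fourier transform of `(-Δ)^{s/2} u`. -/
def fracHat (u : Hsr N s) : Lp ℂ 2 (volume : Measure (RN N)) := 𝓕 (fracLap u)

theorem norm_fracHat (u : Hsr N s) : ‖fracHat u‖ = ‖fracLap u‖ := Lp.norm_fourier_eq _

theorem fracHat_sub (u v : Hsr N s) : fracHat (u - v) = fracHat u - fracHat v := by
  rw [fracHat, map_sub]
  exact map_sub (Lp.fourierTransformₗᵢ (RN N) ℂ) _ _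

theorem coeFn_fracHat (u : Hsr N s) :
    fracHat u =ᵐ[volume] symbolFourier N s (Hsr.toL2 u) := by
  have : fracHat u = (Hsr.memLp_symbolFourier u).toLp := FourierTransform.fourier_fourierInv_eq _
  rw [this]
  exact (Hsr.memLp_symbolFourier u).coeFn_toLp

theorem exists_radial (u : Hsr N s) : ∃ f : ℝ → ℝ, ∀ᵐ x : RN N, u x = f ‖x‖ := u.2.1

/-- Convergence in `L²` gives almost everywhere convergence of a subsequence. -/
theorem exists_subseq_tendsto_ae {F : Type*} [NormedAddCommGroup F] {α : Type*}
    [MeasurableSpace α] {μ : Measure α} {f : ℕ → Lp F 2 μ} {g : Lp F 2 μ}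
    (h : Tendsto f atTop (𝓝 g)) :
    ∃ φ : ℕ → ℕ, StrictMono φ ∧ ∀ᵐ x ∂μ, Tendsto (fun n => f (φ n) x) atTop (𝓝 (g x)) :=
  (tendstoInMeasure_of_tendsto_Lp h).exists_seq_tendsto_ae

/-- The graph of (-Δ)^{s/2} is closed: u_n and (-Δ)^{s/2}u_n converge in L², and almost everywhere
convergent subsequences identify the limit of the symbols and preserve radial symmetry. -/
instance : CompleteSpace (Hsr N s) := by
  refine Metric.complete_of_cauchySeq_tendsto fun u hu => ?_
  have hcv : CauchySeq (toL2L ∘ u) := hu.map toL2L.uniformContinuous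
  have hcw : CauchySeq (fracLapL ∘ u) := hu.map fracLapL.uniformContinuous
  obtain ⟨v, hv⟩ := cauchySeq_tendsto_of_complete hcv
  obtain ⟨w, hw⟩ := cauchySeq_tendsto_of_complete hcw
  have hv' : Tendsto (fun n => Hsr.toL2 (u n)) atTop (𝓝 v) := hv
  have hw' : Tendsto (fun n => fracLap (u n)) atTop (𝓝 w) := hw
  have hrad : ∃ f : ℝ → ℝ, ∀ᵐ x : RN N, v x = f ‖x‖ := by
    choose f hf using fun n => exists_radial (u n)
    obtain ⟨φ, -, hφ⟩ := exists_subseq_tendsto_ae hv'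
    -- The radial profile of the limit is the limit of the profiles; radii at which they diverge
    -- correspond to a null set of points, so the default value there is harmless.
    refine ⟨fun r => limUnder atTop fun n => f (φ n) r, ?_⟩
    filter_upwards [hφ, ae_all_iff.2 hf] with x h1 h2
    simp only [h2] at h1
    exact h1.limUnder_eq.symm
  have hsym : symbolFourier N s v =ᵐ[volume] (𝓕 w : Lp ℂ 2 (volume : Measure (RN N))) := by
    have h1 : Tendsto (fun n => fourierL2 N (Hsr.toL2 (u n))) atTop (𝓝 (fourierL2 N v)) :=
      (continuous_fourierL2.tendsto v).comp hv'
    have h2 : Tendsto (fun n => fracHat (u n)) atTop (𝓝 (𝓕 w)) :=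
      ((Lp.fourierTransformₗᵢ (RN N) ℂ).continuous.tendsto w).comp hw'
    obtain ⟨φ, hφ, h3⟩ := exists_subseq_tendsto_ae h1
    obtain ⟨ψ, hψ, h4⟩ := exists_subseq_tendsto_ae (h2.comp hφ.tendsto_atTop)
    filter_upwards [h3, h4, ae_all_iff.2 fun n => coeFn_fracHat (u n)] with ξ h5 h6 h7
    simp only [Function.comp_apply, h7] at h6
    refine tendsto_nhds_unique ?_ h6
    exact (h5.comp hψ.tendsto_atTop).const_smul _
  have hmem : MemLp (symbolFourier N s v) 2 volume :=
    (memLp_congr_ae hsym).2 (Lp.memLp _)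
  let u' : Hsr N s := ⟨v, hrad, hmem⟩
  have hu'v : Hsr.toL2 u' = v := rfl
  have hu'w : fracLap u' = w := by
    have h1 : fracHat u' = 𝓕 w := by
      refine Lp.ext ((coeFn_fracHat u').trans hsym)
    exact (Lp.fourierTransformₗᵢ (RN N) ℂ).injective h1
  refine ⟨u', ?_⟩
  rw [tendsto_iff_norm_sub_tendsto_zero]
  have h1 : ∀ n, ‖u n - u'‖ = √(‖fracLap (u n) - w‖ ^ 2 + ‖Hsr.toL2 (u n) - v‖ ^ 2) := by
    intro n
    rw [← hu'w, ← hu'v, ← map_sub, ← map_sub, ← kinetic_eq_norm_sq, ← mass_eq_norm_sq,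
      ← Hsr.norm_sq_eq, Real.sqrt_sq (norm_nonneg _)]
  simp only [h1]
  have h2 := (((tendsto_iff_norm_sub_tendsto_zero.1 hw').pow 2).add
    ((tendsto_iff_norm_sub_tendsto_zero.1 hv').pow 2)).sqrt
  simpa using h2

section Dilation

theorem complexify_dil (a : ℝ) (v : Lp ℝ 2 (volume : Measure (RN N))) :
    complexify (dil a v) = dil a (complexify v) := by
  refine Lp.ext ?_
  filter_upwards [coeFn_complexify (dil a v), coeFn_dil a v, coeFn_dil a (complexify v),
    comp_smul_exp_congr (coeFn_complexify v) a] with x h1 h2 h3 h4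
  rw [h1, h2, h3, h4]

theorem fourierL2_dil (a : ℝ) (v : Lp ℝ 2 (volume : Measure (RN N))) :
    fourierL2 N (dil a v) = Real.exp (N * a) • dil (-a) (fourierL2 N v) := by
  rw [fourierL2_eq, complexify_dil, fourier_dil, fourierL2_eq]

/-- Dilating u by e^a dilates its transform by e^{-a} and multiplies it by e^{Na}. The symbol is
homogeneous of degree s, which contributes the remaining e^{-sa}. -/
theorem symbolFourier_dil (a : ℝ) (u : Hsr N s) :
    symbolFourier N s (dil a (Hsr.toL2 u)) =ᵐ[volume]
      (Real.exp ((N - s) * a) • dil (-a) (fracHat u) : Lp ℂ 2 (volume : Measure (RN N))) := by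
  filter_upwards [Lp.coeFn_smul (Real.exp ((N - s) * a)) (dil (-a) (fracHat u)),
    Lp.coeFn_smul (Real.exp (N * a)) (dil (-a) (fourierL2 N (Hsr.toL2 u))),
    coeFn_dil (-a) (fracHat u), coeFn_dil (-a) (fourierL2 N (Hsr.toL2 u)),
    comp_smul_exp_congr (coeFn_fracHat u) (-a)] with ξ h1 h2 h3 h4 h5
  rw [h1, Pi.smul_apply, h3, h5, symbolFourier, symbolFourier, fourierL2_dil, h2, Pi.smul_apply, h4,
    smul_smul, smul_smul, neg_neg, norm_smul, Real.norm_eq_abs, abs_of_pos (Real.exp_pos _)]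
  congr 1
  rw [show 2 * Real.pi * (Real.exp a * ‖ξ‖) = Real.exp a * (2 * Real.pi * ‖ξ‖) by ring,
    Real.mul_rpow (Real.exp_pos _).le (by positivity), ← Real.exp_mul, ← mul_assoc,
    ← Real.exp_add, mul_comm]
  congr 2
  ring

/-- The dilation `u ↦ u(e^{-a} ·)` of `H^s_r`. -/
def hsrDil (a : ℝ) : Hsr N s →ₗ[ℝ] Hsr N s where
  toFun u := ⟨dil a (Hsr.toL2 u), by
    obtain ⟨f, hf⟩ := exists_radial u
    refine ⟨⟨fun r => f (Real.exp (-a) * r), ?_⟩,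
      (memLp_congr_ae (symbolFourier_dil a u)).2 (Lp.memLp _)⟩
    filter_upwards [coeFn_dil a (Hsr.toL2 u), (quasiMeasurePreserving_smul_exp a).ae hf]
      with x h1 h2
    rw [h1, h2, norm_smul, Real.norm_eq_abs, abs_of_pos (Real.exp_pos _)]⟩
  map_add' u v := Subtype.ext ((congrArg _ (map_add _ _ _)).trans (map_add _ _ _))
  map_smul' c u := Subtype.ext ((congrArg _ (map_smul _ _ _)).trans (map_smul _ _ _))

theorem toL2_hsrDil (a : ℝ) (u : Hsr N s) : Hsr.toL2 (hsrDil a u) = dil a (Hsr.toL2 u) := rfl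

theorem coeFn_hsrDil (a : ℝ) (u : Hsr N s) :
    ∀ᵐ x : RN N, hsrDil a u x = u (Real.exp (-a) • x) := coeFn_dil a _

theorem hsr_ext {u v : Hsr N s} (h : Hsr.toL2 u = Hsr.toL2 v) : u = v := Subtype.ext h

theorem fracHat_hsrDil (a : ℝ) (u : Hsr N s) :
    fracHat (hsrDil a u) = Real.exp ((N - s) * a) • dil (-a) (fracHat u) :=
  Lp.ext ((coeFn_fracHat _).trans (symbolFourier_dil a u))

theorem norm_fracLap_hsrDil (a : ℝ) (u : Hsr N s) :
    ‖fracLap (hsrDil a u)‖ = Real.exp ((N / 2 - s) * a) * ‖fracLap u‖ := by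
  rw [← norm_fracHat, fracHat_hsrDil, norm_smul, norm_dil, norm_fracHat,
    Real.norm_eq_abs, abs_of_pos (Real.exp_pos _), ← mul_assoc, ← Real.exp_add]
  congr 2
  ring

theorem kinetic_hsrDil (a : ℝ) (u : Hsr N s) :
    kinetic (hsrDil a u) = Real.exp ((N - 2 * s) * a) * kinetic u := by
  rw [kinetic_eq_norm_sq, norm_fracLap_hsrDil, mul_pow, ← kinetic_eq_norm_sq, ← Real.exp_nat_mul]
  congr 2
  push_cast
  ring

theorem mass_hsrDil (a : ℝ) (u : Hsr N s) : mass (hsrDil a u) = Real.exp (N * a) * mass u := by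
  rw [mass_eq_norm_sq, toL2_hsrDil, norm_dil, mul_pow, ← mass_eq_norm_sq, ← Real.exp_nat_mul]
  congr 2
  push_cast
  ring

theorem norm_hsrDil_le (hs0 : 0 ≤ s) (hsN : s ≤ N) (a : ℝ) (u : Hsr N s) :
    ‖hsrDil a u‖ ≤ Real.exp (N / 2 * |a|) * ‖u‖ := by
  refine le_of_sq_le_sq ?_ (by positivity)
  rw [mul_pow, Hsr.norm_sq_eq, Hsr.norm_sq_eq, kinetic_hsrDil, mass_hsrDil, ← Real.exp_nat_mul,
    mul_add]
  have h1 : (N : ℝ) * a ≤ (2 : ℕ) * (N / 2 * |a|) := by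
    push_cast
    have := mul_le_mul_of_nonneg_left (le_abs_self a) (Nat.cast_nonneg (α := ℝ) N)
    linarith
  have h2 : ((N : ℝ) - 2 * s) * a ≤ (2 : ℕ) * (N / 2 * |a|) := by
    push_cast
    have h3 : |(N : ℝ) - 2 * s| ≤ N := abs_le.2 ⟨by linarith, by linarith⟩
    calc ((N : ℝ) - 2 * s) * a ≤ |((N : ℝ) - 2 * s) * a| := le_abs_self _
      _ = |(N : ℝ) - 2 * s| * |a| := abs_mul _ _
      _ ≤ N * |a| := by gcongr
      _ = _ := by ring
  have := kinetic_nonneg u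
  have := mass_nonneg u
  gcongr

theorem continuous_hsrDil_apply (u : Hsr N s) : Continuous fun a => hsrDil a u := by
  rw [continuous_iff_continuousAt]
  intro a₀
  rw [ContinuousAt, tendsto_iff_norm_sub_tendsto_zero]
  have h1 : ∀ a, ‖hsrDil a u - hsrDil a₀ u‖ =
      √(‖fracHat (hsrDil a u) - fracHat (hsrDil a₀ u)‖ ^ 2 +
        ‖Hsr.toL2 (hsrDil a u) - Hsr.toL2 (hsrDil a₀ u)‖ ^ 2) := by
    intro a
    rw [← fracHat_sub, norm_fracHat, ← map_sub,
      ← kinetic_eq_norm_sq, ← mass_eq_norm_sq, ← Hsr.norm_sq_eq, Real.sqrt_sq (norm_nonneg _)]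
  simp only [h1, fracHat_hsrDil, toL2_hsrDil]
  have hc : Continuous fun a =>
      √(‖Real.exp ((N - s) * a) • dil (-a) (fracHat u) -
          Real.exp ((N - s) * a₀) • dil (-a₀) (fracHat u)‖ ^ 2 +
        ‖dil a (Hsr.toL2 u) - dil a₀ (Hsr.toL2 u)‖ ^ 2) := by
    have h2 : Continuous fun a : ℝ => dil (-a) (fracHat u) :=
      (continuous_dil _).comp continuous_neg
    have h3 := continuous_dil (Hsr.toL2 u)
    fun_prop
  simpa using hc.tendsto a₀

/-- The dilations `(μ, u) ↦ (μ, u(e^{-a} ·))` form a scaling group. -/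
def dilationGroup (hs0 : 0 ≤ s) (hsN : s ≤ N) : ScalingGroup (ℝ × Hsr N s) where
  op a := (ContinuousLinearMap.fst ℝ ℝ (Hsr N s)).prod
    (((hsrDil a).mkContinuous _ (norm_hsrDil_le hs0 hsN a)).comp
      (ContinuousLinearMap.snd ℝ ℝ (Hsr N s)))
  op_zero z := Prod.ext rfl (hsr_ext (dil_zero _))
  op_add a b z := Prod.ext rfl (hsr_ext (dil_add a b _))
  continuous_op := by
    refine Continuous.prodMk (by fun_prop) ?_
    change Continuous fun p : ℝ × (ℝ × Hsr N s) => hsrDil p.1 p.2.2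
    rw [continuous_iff_continuousAt]
    rintro ⟨a₀, c₀, u₀⟩
    -- Joint continuity follows from continuity of a ↦ D_a u₀ together with a locally uniform bound
    -- for D_a(u - u₀).
    have h1 : Tendsto (fun p : ℝ × (ℝ × Hsr N s) => hsrDil p.1 u₀) (𝓝 (a₀, c₀, u₀))
        (𝓝 (hsrDil a₀ u₀)) :=
      ((continuous_hsrDil_apply u₀).comp continuous_fst).tendsto (a₀, c₀, u₀)
    have h2 : Tendsto (fun p : ℝ × (ℝ × Hsr N s) => hsrDil p.1 (p.2.2 - u₀)) (𝓝 (a₀, c₀, u₀))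
        (𝓝 0) := by
      refine squeeze_zero_norm (fun p => norm_hsrDil_le hs0 hsN p.1 (p.2.2 - u₀)) ?_
      have hc : Continuous fun p : ℝ × (ℝ × Hsr N s) =>
          Real.exp (N / 2 * |p.1|) * ‖p.2.2 - u₀‖ := by fun_prop
      simpa using hc.tendsto (a₀, c₀, u₀)
    have h3 := h2.add h1
    simp only [map_sub, sub_add_cancel, zero_add] at h3
    exact h3
  rate := N / 2
  rate_nonneg := by positivity
  norm_op_le a z := by
    change max ‖z.1‖ ‖hsrDil a z.2‖ ≤ _
    have h1 : (1 : ℝ) ≤ Real.exp (N / 2 * |a|) := Real.one_le_exp (by positivity)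
    refine max_le ?_ ?_
    · exact (norm_fst_le z).trans (le_mul_of_one_le_left (norm_nonneg _) h1)
    · refine (norm_hsrDil_le hs0 hsN a z.2).trans ?_
      gcongr
      exact norm_snd_le z

theorem dilationGroup_op (hs0 : 0 ≤ s) (hsN : s ≤ N) (a : ℝ) (z : ℝ × Hsr N s) :
    (dilationGroup hs0 hsN).op a z = (z.1, hsrDil a z.2) := rfl

/-- The reflection `(μ, u) ↦ (μ, -u)` as a linear isometry. -/
def reflectIso : (ℝ × Hsr N s) ≃ₗᵢ[ℝ] (ℝ × Hsr N s) where
  toLinearEquiv := (LinearEquiv.refl ℝ ℝ).prodCongr (LinearEquiv.neg ℝ)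
  norm_map' z := by
    change max ‖z.1‖ ‖-z.2‖ = max ‖z.1‖ ‖z.2‖
    rw [norm_neg]

theorem reflectIso_apply (z : ℝ × Hsr N s) : reflectIso z = reflect z := rfl

end Dilation

end FracNLS
end

/-! ### Frequency splitting and the Gagliardo–Nirenberg inequality. -/

noncomputable section

namespace FracNLS

variable {N : ℕ} {s : ℝ}

theorem lintegral_enorm_sq {F : Type*} [NormedAddCommGroup F] [InnerProductSpace ℝ F] {α : Type*}
    [MeasurableSpace α] {μ : Measure α} (f : Lp F 2 μ) :
    ∫⁻ x, ‖f x‖ₑ ^ 2 ∂μ = ENNReal.ofReal (‖f‖ ^ 2) := by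
  rw [norm_sq_eq_integral, ofReal_integral_eq_lintegral_ofReal (integrable_norm_sq f)
    (.of_forall fun x => by positivity)]
  refine lintegral_congr fun x => ?_
  rw [ENNReal.ofReal_pow (norm_nonneg _), ofReal_norm]

/-- The plane wave `ξ ↦ e^{-2πi⟨ξ, x⟩}`, truncated to the ball of radius `R`. -/
def waveFun (R : ℝ) (x : RN N) : RN N → ℂ :=
  (Metric.ball (0 : RN N) R).indicator fun ξ => (𝐞 (-(inner ℝ ξ x)) : ℂ)

theorem memLp_waveFun (R : ℝ) (x : RN N) : MemLp (waveFun R x) 2 volume := by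
  refine (memLp_indicator_iff_restrict measurableSet_ball).2 ?_
  have : IsFiniteMeasure (volume.restrict (Metric.ball (0 : RN N) R)) :=
    ⟨by simpa using measure_ball_lt_top⟩
  refine MemLp.of_bound (Continuous.aestronglyMeasurable ?_) 1 (.of_forall fun ξ => ?_)
  · exact Continuous.subtype_val (Real.continuous_fourierChar.comp (by fun_prop))
  · exact (Circle.norm_coe _).le

/-- The truncated plane wave as an element of `L²`. -/
def wave (R : ℝ) (x : RN N) : Lp ℂ 2 (volume : Measure (RN N)) := (memLp_waveFun R x).toLp

theorem inner_wave_wave (R : ℝ) (x y : RN N) :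
    inner ℂ (wave R x) (wave R y) =
      ∫ ξ, 𝐞 (-(inner ℝ ξ (y - x))) • (Metric.ball (0 : RN N) R).indicator (fun _ => (1 : ℂ)) ξ := by
  rw [L2.inner_def]
  refine integral_congr_ae ?_
  filter_upwards [(memLp_waveFun R x).coeFn_toLp, (memLp_waveFun R y).coeFn_toLp] with ξ h1 h2
  rw [wave, wave, h1, h2, waveFun, waveFun]
  by_cases hξ : ξ ∈ Metric.ball (0 : RN N) R
  · simp only [indicator_of_mem hξ]
    rw [inner_sub_right, neg_sub, sub_eq_add_neg, AddChar.map_add_eq_mul, Circle.smul_def,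
      smul_eq_mul, mul_one, Circle.coe_mul, RCLike.inner_apply, AddChar.map_neg_eq_inv 𝐞 (inner ℝ ξ x),
      Circle.coe_inv_eq_conj, Complex.conj_conj, mul_comm]
  · simp [indicator_of_notMem hξ]

theorem norm_wave_sq (R : ℝ) (x : RN N) :
    ‖wave R x‖ ^ 2 = (volume (Metric.ball (0 : RN N) R)).toReal := by
  have h := inner_self_eq_norm_sq_to_K (𝕜 := ℂ) (wave R x)
  rw [inner_wave_wave] at h
  simp only [sub_self, inner_zero_right, neg_zero, AddChar.map_zero_eq_one, one_smul] at h
  rw [integral_indicator measurableSet_ball, integral_const] at h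
  simp only [MeasurableSet.univ, measureReal_restrict_apply, univ_inter, Complex.real_smul,
    mul_one] at h
  rw [measureReal_def] at h
  exact Complex.ofReal_injective (by simpa using h.symm)

/-- The low frequency part of the function with Fourier transform `f`. -/
def lowPass (R : ℝ) (f : Lp ℂ 2 (volume : Measure (RN N))) (x : RN N) : ℂ :=
  inner ℂ (wave R x) f

theorem norm_lowPass_le (R : ℝ) (f : Lp ℂ 2 (volume : Measure (RN N))) (x : RN N) :
    ‖lowPass R f x‖ ≤ √(volume (Metric.ball (0 : RN N) R)).toReal * ‖f‖ := by
  rw [← norm_wave_sq R x, Real.sqrt_sq (norm_nonneg _)]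
  exact norm_inner_le_norm _ _

theorem lowPass_eq_fourierInv (R : ℝ) (f : Lp ℂ 2 (volume : Measure (RN N))) (x : RN N) :
    lowPass R f x = 𝓕⁻ ((Metric.ball (0 : RN N) R).indicator f) x := by
  rw [lowPass, L2.inner_def, Real.fourierInv_eq]
  refine integral_congr_ae ?_
  filter_upwards [(memLp_waveFun R x).coeFn_toLp] with ξ h1
  rw [wave, h1, waveFun]
  by_cases hξ : ξ ∈ Metric.ball (0 : RN N) R
  · simp only [indicator_of_mem hξ]
    rw [RCLike.inner_apply, AddChar.map_neg_eq_inv, Circle.coe_inv_eq_conj, Complex.conj_conj,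
      Circle.smul_def, smul_eq_mul, mul_comm]
  · simp [indicator_of_notMem hξ]

/-- Splitting of an `L²` function into its low and high frequency parts. -/
theorem exists_highPass (R : ℝ) (v : Lp ℝ 2 (volume : Measure (RN N))) :
    ∃ h : Lp ℂ 2 (volume : Measure (RN N)),
      (∀ᵐ x : RN N, (v x : ℂ) = lowPass R (fourierL2 N v) x + h x) ∧
      ∫⁻ x, ‖h x‖ₑ ^ 2 = ∫⁻ ξ in (Metric.ball (0 : RN N) R)ᶜ, ‖fourierL2 N v ξ‖ₑ ^ 2 := by
  set f := fourierL2 N v with hf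
  set B := Metric.ball (0 : RN N) R with hB
  have hBm : MeasurableSet B := measurableSet_ball
  have hm1 : MemLp (B.indicator f) 2 volume := (Lp.memLp f).indicator hBm
  have hm2 : MemLp (Bᶜ.indicator f) 2 volume := (Lp.memLp f).indicator hBm.compl
  have hsum : f = hm1.toLp + hm2.toLp := by
    rw [← MemLp.toLp_add]
    refine Lp.ext ?_
    filter_upwards [(hm1.add hm2).coeFn_toLp] with ξ h
    rw [h, indicator_self_add_compl]
  have hint : Integrable (B.indicator f) volume := by
    refine (integrable_indicator_iff hBm).2 ?_
    have : IsFiniteMeasure (volume.restrict B) := ⟨by simpa using measure_ball_lt_top⟩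
    exact ((Lp.memLp f).restrict B).integrable one_le_two
  refine ⟨𝓕⁻ hm2.toLp, ?_, ?_⟩
  · have h1 : complexify v = 𝓕⁻ hm1.toLp + 𝓕⁻ hm2.toLp := by
      rw [← FourierTransform.fourierInv_add, ← hsum, hf, fourierInv_fourierL2]
    have h2 := fourierInv_ae_eq hm1.toLp ((integrable_congr hm1.coeFn_toLp).2 hint)
    filter_upwards [coeFn_complexify v, h2, Lp.coeFn_add (𝓕⁻ hm1.toLp) (𝓕⁻ hm2.toLp)]
      with x h3 h4 h5
    rw [← h3, h1, h5, Pi.add_apply, h4, lowPass_eq_fourierInv]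
    congr 1
    rw [Real.fourierInv_eq_fourier_neg, Real.fourierInv_eq_fourier_neg]
    exact Real.fourier_congr_ae hm1.coeFn_toLp _
  · have h1 : ‖(𝓕⁻ hm2.toLp : Lp ℂ 2 (volume : Measure (RN N)))‖ = ‖hm2.toLp‖ :=
      (Lp.fourierTransformₗᵢ (RN N) ℂ).symm.norm_map _
    rw [lintegral_enorm_sq, h1, ← lintegral_enorm_sq, ← lintegral_indicator hBm.compl]
    refine lintegral_congr_ae ?_
    filter_upwards [hm2.coeFn_toLp] with ξ h2
    rw [h2]
    by_cases hξ : ξ ∈ Bᶜ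
    · simp only [indicator_of_mem hξ]
    · simp [indicator_of_notMem hξ]

/-- Where the low frequency part is small, large values are controlled by the high frequencies. -/
theorem volume_lt_le (R : ℝ) (v : Lp ℝ 2 (volume : Measure (RN N))) {t : ℝ} (ht : 0 < t)
    (hlow : ∀ x, ‖lowPass R (fourierL2 N v) x‖ ≤ t / 2) :
    volume {x | t < |v x|} ≤ ENNReal.ofReal (4 / t ^ 2) *
      ∫⁻ ξ in (Metric.ball (0 : RN N) R)ᶜ, ‖fourierL2 N v ξ‖ₑ ^ 2 := by
  obtain ⟨h, hv, hh⟩ := exists_highPass R v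
  rw [← hh]
  have h1 : volume {x | t < |v x|} ≤ volume {x | ENNReal.ofReal ((t / 2) ^ 2) ≤ ‖h x‖ₑ ^ 2} := by
    refine measure_mono_ae ?_
    filter_upwards [hv] with x hx hxt
    have hxt' : t < |v x| := hxt
    change ENNReal.ofReal ((t / 2) ^ 2) ≤ ‖h x‖ₑ ^ 2
    rw [← ofReal_norm, ← ENNReal.ofReal_pow (norm_nonneg _)]
    refine ENNReal.ofReal_le_ofReal (pow_le_pow_left₀ (by positivity) ?_ 2)
    have h2 : ‖(v x : ℂ)‖ = |v x| := by simp
    have h3 := norm_add_le (lowPass R (fourierL2 N v) x) (h x)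
    rw [← hx, h2] at h3
    linarith [hlow x]
  refine h1.trans ?_
  have h2 := mul_meas_ge_le_lintegral₀ (μ := volume) (f := fun x => ‖h x‖ₑ ^ 2)
    ((Lp.aestronglyMeasurable h).enorm.pow_const 2) (ENNReal.ofReal ((t / 2) ^ 2))
  have h3 : ENNReal.ofReal (4 / t ^ 2) * ENNReal.ofReal ((t / 2) ^ 2) = 1 := by
    rw [← ENNReal.ofReal_mul (by positivity), ← ENNReal.ofReal_one]
    congr 1
    field_simp
    norm_num
  calc _ = ENNReal.ofReal (4 / t ^ 2) * (ENNReal.ofReal ((t / 2) ^ 2) *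
        volume {x | ENNReal.ofReal ((t / 2) ^ 2) ≤ ‖h x‖ₑ ^ 2}) := by
          rw [← mul_assoc, h3, one_mul]
    _ ≤ _ := by gcongr

/-- The exponent `2 + 4s/N`. -/
def critExp (N : ℕ) (s : ℝ) : ℝ := 2 + 4 * s / N

theorem enorm_fracHat_sq (u : Hsr N s) : ∀ᵐ ξ : RN N, ‖fracHat u ξ‖ₑ ^ 2 =
    ENNReal.ofReal ((2 * Real.pi) ^ (2 * s)) *
      (ENNReal.ofReal (‖ξ‖ ^ (2 * s)) * ‖fourierL2 N (Hsr.toL2 u) ξ‖ₑ ^ 2) := by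
  filter_upwards [coeFn_fracHat u] with ξ h
  have h0 : 0 ≤ 2 * Real.pi * ‖ξ‖ := by positivity
  have h1 : ((2 * Real.pi * ‖ξ‖) ^ s) ^ 2 = (2 * Real.pi) ^ (2 * s) * ‖ξ‖ ^ (2 * s) := by
    rw [← Real.rpow_two, ← Real.rpow_mul h0, mul_comm s 2,
      Real.mul_rpow (by positivity) (norm_nonneg _)]
  rw [h, symbolFourier, enorm_smul, mul_pow, ← mul_assoc, ← ENNReal.ofReal_mul (by positivity),
    ← h1, ENNReal.ofReal_pow (by positivity), Real.enorm_eq_ofReal (by positivity)]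

/-- Outside the ball the squared symbol is at least (2πR)^{2s}, so the kinetic energy controls the
high frequencies. -/
theorem lintegral_high_le {R : ℝ} (hR : 0 < R) (hs : 0 < s) (u : Hsr N s) :
    ∫⁻ ξ in (Metric.ball (0 : RN N) R)ᶜ, ‖fourierL2 N (Hsr.toL2 u) ξ‖ₑ ^ 2 ≤
      ENNReal.ofReal (kinetic u / (2 * Real.pi * R) ^ (2 * s)) := by
  have h0 : 0 < (2 * Real.pi * R) ^ (2 * s) := by positivity
  have hc : ENNReal.ofReal ((2 * Real.pi * R) ^ (2 * s)) ≠ 0 := by simpa using h0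
  have h1 : ENNReal.ofReal ((2 * Real.pi * R) ^ (2 * s)) *
      ∫⁻ ξ in (Metric.ball (0 : RN N) R)ᶜ, ‖fourierL2 N (Hsr.toL2 u) ξ‖ₑ ^ 2 ≤
      ENNReal.ofReal (kinetic u) := by
    rw [kinetic_eq_norm_sq, ← norm_fracHat, ← lintegral_enorm_sq,
      ← lintegral_const_mul' _ _ ENNReal.ofReal_ne_top]
    refine (setLIntegral_mono_ae' measurableSet_ball.compl ?_).trans
      (setLIntegral_le_lintegral (Metric.ball (0 : RN N) R)ᶜ _)
    filter_upwards [enorm_fracHat_sq u] with ξ h hξ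
    rw [h, ← mul_assoc, ← ENNReal.ofReal_mul (by positivity)]
    have h2 : R ≤ ‖ξ‖ := by simpa using hξ
    gcongr
    rw [Real.mul_rpow (by positivity) hR.le]
    gcongr
  rw [ENNReal.ofReal_div_of_pos h0, ENNReal.le_div_iff_mul_le (Or.inl hc)
    (Or.inl ENNReal.ofReal_ne_top), mul_comm]
  exact h1

theorem lintegral_Ioc_rpow {T q : ℝ} (hT : 0 ≤ T) (hq : 0 < q) :
    ∫⁻ t in Ioc 0 T, ENNReal.ofReal (t ^ (q - 1)) = ENNReal.ofReal (T ^ q / q) := by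
  have h1 : IntegrableOn (fun t : ℝ => t ^ (q - 1)) (Ioc 0 T) :=
    (intervalIntegrable_iff_integrableOn_Ioc_of_le hT).1
      (intervalIntegral.intervalIntegrable_rpow' (by linarith))
  rw [← ofReal_integral_eq_lintegral_ofReal h1
    ((ae_restrict_mem measurableSet_Ioc).mono fun t ht => Real.rpow_nonneg ht.1.le _),
    ← intervalIntegral.integral_of_le hT, integral_rpow (Or.inl (by linarith)), sub_add_cancel,
    Real.zero_rpow hq.ne', sub_zero]

/-- The Gagliardo–Nirenberg inequality at the mass critical exponent. -/
theorem exists_gagliardo_nirenberg (hN : 2 ≤ N) (hs : 0 < s) : ∃ C : ℝ, 0 ≤ C ∧ ∀ u : Hsr N s,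
    ∫⁻ x, ENNReal.ofReal (|u x| ^ critExp N s) ≤
      ENNReal.ofReal (C * mass u ^ (2 * s / N) * kinetic u) := by
  have hN0 : (0 : ℝ) < N := by positivity
  set q : ℝ := 4 * s / N with hq
  have hq0 : 0 < q := by positivity
  set ω : ℝ := (volume (Metric.ball (0 : RN N) 1)).toReal with hω
  have hω0 : 0 < ω := ENNReal.toReal_pos (Metric.measure_ball_pos _ _ one_pos).ne'
    measure_ball_lt_top.ne
  set C : ℝ := (2 + q) * (4 * ((2 * √ω) ^ q / q) / (2 * Real.pi) ^ (2 * s)) with hC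
  refine ⟨C, by positivity, fun u => ?_⟩
  set f := fourierL2 N (Hsr.toL2 u) with hf
  set M : ℝ := ‖Hsr.toL2 u‖ with hM
  rcases (norm_nonneg (Hsr.toL2 u)).eq_or_lt with hM0 | hM0
  · have h0 : Hsr.toL2 u = 0 := norm_eq_zero.1 hM0.symm
    have h1 : ∫⁻ x, ENNReal.ofReal (|u x| ^ critExp N s) = ∫⁻ _ : RN N, 0 := by
      refine lintegral_congr_ae ?_
      filter_upwards [Lp.coeFn_zero ℝ 2 (volume : Measure (RN N))] with x hx
      rw [h0, hx, Pi.zero_apply, abs_zero, Real.zero_rpow (by rw [critExp]; positivity),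
        ENNReal.ofReal_zero]
    rw [h1, lintegral_zero]
    exact zero_le
  set c : ℝ := 2 * √ω * M with hc
  have hc0 : 0 < c := by positivity
  have hmeas : Measurable fun z : ℝ × RN N => c * ‖z.2‖ ^ ((N : ℝ) / 2) := by fun_prop
  have hE : MeasurableSet {z : ℝ × RN N | z.1 ≤ c * ‖z.2‖ ^ ((N : ℝ) / 2)} :=
    measurableSet_le measurable_fst hmeas
  -- the distribution function
  have hdist : ∀ t : ℝ, 0 < t → volume {x | t < |u x|} ≤ ENNReal.ofReal (4 / t ^ 2) *
      ∫⁻ ξ, {z : ℝ × RN N | z.1 ≤ c * ‖z.2‖ ^ ((N : ℝ) / 2)}.indicator (fun z => ‖f z.2‖ₑ ^ 2)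
        (t, ξ) := by
    intro t ht
    -- The cut-off depends on the height t: it is chosen so that the bound √|B_R| · M for the low
    -- frequency part equals exactly t/2. Then ‖ξ‖ ≥ R reads t ≤ c‖ξ‖^{N/2}, a condition on the pair
    -- (t, ξ) to which Tonelli's theorem applies.
    set R : ℝ := (t / c) ^ (2 / (N : ℝ)) with hR
    have hR0 : 0 < R := by positivity
    have hvol : (volume (Metric.ball (0 : RN N) R)).toReal = R ^ N * ω := by
      rw [Measure.addHaar_ball_of_pos _ _ hR0, finrank_euclideanSpace_fin, ENNReal.toReal_mul,
        ENNReal.toReal_ofReal (by positivity)]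
    have hRN : R ^ N = (t / c) ^ 2 := by
      rw [hR, ← Real.rpow_natCast, ← Real.rpow_mul (by positivity),
        div_mul_cancel₀ _ hN0.ne', Real.rpow_two]
    refine (volume_lt_le R (Hsr.toL2 u) ht fun x => ?_).trans ?_
    · refine (norm_lowPass_le _ _ _).trans (le_of_eq ?_)
      rw [hvol, hRN, norm_fourierL2, ← hM, Real.sqrt_mul (by positivity), Real.sqrt_sq (by positivity), hc]
      field_simp
      exact div_self hM0.ne'
    · refine mul_le_mul' le_rfl ?_
      rw [← lintegral_indicator measurableSet_ball.compl]
      refine lintegral_mono fun ξ => ?_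
      by_cases hξ : ξ ∈ (Metric.ball (0 : RN N) R)ᶜ
      · have h1 : R ≤ ‖ξ‖ := by simpa using hξ
        have h2 : (t, ξ) ∈ {z : ℝ × RN N | z.1 ≤ c * ‖z.2‖ ^ ((N : ℝ) / 2)} := by
          change t ≤ c * ‖ξ‖ ^ ((N : ℝ) / 2)
          have h3 : R ^ ((N : ℝ) / 2) = t / c := by
            rw [hR, ← Real.rpow_mul (by positivity)]
            rw [show 2 / (N : ℝ) * ((N : ℝ) / 2) = 1 by field_simp, Real.rpow_one]
          calc t = c * R ^ ((N : ℝ) / 2) := by rw [h3]; field_simp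
            _ ≤ _ := by gcongr
        rw [indicator_of_mem hξ, indicator_of_mem h2]
      · rw [indicator_of_notMem hξ]
        exact zero_le
  have hmeasf : AEMeasurable (fun ξ => ‖f ξ‖ₑ ^ 2) volume :=
    (Lp.aestronglyMeasurable f).enorm.pow_const 2
  have hp : critExp N s - 1 = 2 + (q - 1) := by rw [critExp, hq]; ring
  rw [lintegral_rpow_eq_lintegral_meas_lt_mul volume (.of_forall fun x => abs_nonneg _)
    (Lp.aestronglyMeasurable (Hsr.toL2 u)).aemeasurable.abs (by rw [critExp]; positivity)]
  have hstep : ∫⁻ t in Ioi (0 : ℝ), volume {x | t < |u x|} * ENNReal.ofReal (t ^ (critExp N s - 1)) ≤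
      ∫⁻ t in Ioi (0 : ℝ), ∫⁻ ξ, {z : ℝ × RN N | z.1 ≤ c * ‖z.2‖ ^ ((N : ℝ) / 2)}.indicator
        (fun z => ENNReal.ofReal (4 * z.1 ^ (q - 1)) * ‖f z.2‖ₑ ^ 2) (t, ξ) := by
    refine setLIntegral_mono_ae' measurableSet_Ioi (.of_forall fun t ht => ?_)
    have ht : 0 < t := ht
    have h1 : ENNReal.ofReal (4 / t ^ 2) * ENNReal.ofReal (t ^ (critExp N s - 1)) =
        ENNReal.ofReal (4 * t ^ (q - 1)) := by
      rw [← ENNReal.ofReal_mul (by positivity), hp, Real.rpow_add ht, Real.rpow_two]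
      congr 1
      field_simp
    calc _ ≤ (ENNReal.ofReal (4 / t ^ 2) * ∫⁻ ξ, {z : ℝ × RN N | z.1 ≤ c * ‖z.2‖ ^ ((N : ℝ) / 2)}.indicator
          (fun z => ‖f z.2‖ₑ ^ 2) (t, ξ)) * ENNReal.ofReal (t ^ (critExp N s - 1)) := by
            gcongr; exact hdist t ht
      _ = ENNReal.ofReal (4 * t ^ (q - 1)) * ∫⁻ ξ, {z : ℝ × RN N | z.1 ≤ c * ‖z.2‖ ^ ((N : ℝ) / 2)}.indicator
          (fun z => ‖f z.2‖ₑ ^ 2) (t, ξ) := by rw [mul_right_comm, h1]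
      _ = _ := by
        rw [← lintegral_const_mul' _ _ ENNReal.ofReal_ne_top]
        refine lintegral_congr fun ξ => ?_
        by_cases hξ : (t, ξ) ∈ {z : ℝ × RN N | z.1 ≤ c * ‖z.2‖ ^ ((N : ℝ) / 2)}
        · rw [indicator_of_mem hξ, indicator_of_mem hξ]
        · rw [indicator_of_notMem hξ, indicator_of_notMem hξ, mul_zero]
  have hswap := lintegral_lintegral_swap (μ := volume.restrict (Ioi (0 : ℝ)))
    (ν := (volume : Measure (RN N)))
    (f := fun t ξ => {z : ℝ × RN N | z.1 ≤ c * ‖z.2‖ ^ ((N : ℝ) / 2)}.indicator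
        (fun z => ENNReal.ofReal (4 * z.1 ^ (q - 1)) * ‖f z.2‖ₑ ^ 2) (t, ξ)) (by
      have h1 : Measurable fun z : ℝ × RN N => ENNReal.ofReal (4 * z.1 ^ (q - 1)) := by fun_prop
      have h2 := h1.aemeasurable.mul (hmeasf.comp_quasiMeasurePreserving
        (Measure.quasiMeasurePreserving_snd (μ := volume.restrict (Ioi (0 : ℝ)))))
      exact h2.indicator hE)
  -- For fixed ξ the integral of t^{q-1} up to c‖ξ‖^{N/2} is c^q‖ξ‖^{Nq/2}/q. With q = 4s/N the
  -- exponent Nq/2 is 2s, so the kinetic energy appears to the first power.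
  have hinner : ∀ ξ, ∫⁻ t in Ioi (0 : ℝ), {z : ℝ × RN N | z.1 ≤ c * ‖z.2‖ ^ ((N : ℝ) / 2)}.indicator
        (fun z => ENNReal.ofReal (4 * z.1 ^ (q - 1)) * ‖f z.2‖ₑ ^ 2) (t, ξ) =
      ENNReal.ofReal (4 * (c ^ q / q)) * (ENNReal.ofReal (‖ξ‖ ^ (2 * s)) * ‖f ξ‖ₑ ^ 2) := by
    intro ξ
    have hT : 0 ≤ c * ‖ξ‖ ^ ((N : ℝ) / 2) := by positivity
    have h1 : ∀ t, {z : ℝ × RN N | z.1 ≤ c * ‖z.2‖ ^ ((N : ℝ) / 2)}.indicator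
        (fun z => ENNReal.ofReal (4 * z.1 ^ (q - 1)) * ‖f z.2‖ₑ ^ 2) (t, ξ) =
        (Iic (c * ‖ξ‖ ^ ((N : ℝ) / 2))).indicator
        (fun t => ENNReal.ofReal (4 * t ^ (q - 1)) * ‖f ξ‖ₑ ^ 2) t := fun t => rfl
    simp only [h1]
    rw [lintegral_indicator measurableSet_Iic, Measure.restrict_restrict measurableSet_Iic,
      inter_comm, Ioi_inter_Iic, lintegral_mul_const _ (by fun_prop)]
    have h2 : ∀ t : ℝ, ENNReal.ofReal (4 * t ^ (q - 1)) = ENNReal.ofReal 4 *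
      ENNReal.ofReal (t ^ (q - 1)) := fun t => ENNReal.ofReal_mul (by norm_num)
    simp only [h2]
    rw [lintegral_const_mul _ (by fun_prop), lintegral_Ioc_rpow hT hq0, ← mul_assoc,
      ← ENNReal.ofReal_mul (by norm_num), ← ENNReal.ofReal_mul (by positivity)]
    congr 2
    rw [Real.mul_rpow hc0.le (by positivity), ← Real.rpow_mul (norm_nonneg _)]
    rw [show (N : ℝ) / 2 * q = 2 * s by rw [hq]; field_simp; ring]
    ring
  calc _ ≤ ENNReal.ofReal (critExp N s) * (ENNReal.ofReal (4 * (c ^ q / q)) *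
        ∫⁻ ξ, ENNReal.ofReal (‖ξ‖ ^ (2 * s)) * ‖f ξ‖ₑ ^ 2) := by
        gcongr
        refine hstep.trans (le_of_eq ?_)
        rw [hswap]
        simp only [hinner]
        rw [lintegral_const_mul' _ _ ENNReal.ofReal_ne_top]
    _ = ENNReal.ofReal (C * mass u ^ (2 * s / N) * kinetic u) := by
        have hπ : (0 : ℝ) < (2 * Real.pi) ^ (2 * s) := by positivity
        have h1 : ENNReal.ofReal ((2 * Real.pi) ^ (2 * s)) *
            ∫⁻ ξ, ENNReal.ofReal (‖ξ‖ ^ (2 * s)) * ‖f ξ‖ₑ ^ 2 = ENNReal.ofReal (kinetic u) := by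
          rw [kinetic_eq_norm_sq, ← norm_fracHat, ← lintegral_enorm_sq,
            ← lintegral_const_mul' _ _ ENNReal.ofReal_ne_top]
          refine lintegral_congr_ae ?_
          filter_upwards [enorm_fracHat_sq u] with ξ h
          rw [h]
        have h2 : ∫⁻ ξ, ENNReal.ofReal (‖ξ‖ ^ (2 * s)) * ‖f ξ‖ₑ ^ 2 =
            ENNReal.ofReal (kinetic u / (2 * Real.pi) ^ (2 * s)) := by
          rw [ENNReal.ofReal_div_of_pos hπ]
          exact (ENNReal.eq_div_iff (by simpa using hπ) ENNReal.ofReal_ne_top).2 h1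
        have h3 : c ^ q = (2 * √ω) ^ q * mass u ^ (2 * s / N) := by
          rw [hc, Real.mul_rpow (by positivity) (norm_nonneg _), mass_eq_norm_sq, ← Real.rpow_two,
            ← Real.rpow_mul (norm_nonneg _)]
          congr 2
          rw [hq]; ring
        rw [h2, ← ENNReal.ofReal_mul (by positivity), ← ENNReal.ofReal_mul (by rw [critExp]; positivity)]
        congr 1
        rw [h3, hC, critExp, ← hq]
        ring

end FracNLS
end

/-! ### Decay of radial functions and compactness in measure. -/

noncomputable section

namespace FracNLS

variable {N : ℕ} {s : ℝ}

/-- The Fourier transform of the indicator function of a ball. -/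
def ballKernel (R : ℝ) (z : RN N) : ℂ :=
  𝓕 ((Metric.ball (0 : RN N) R).indicator fun _ => (1 : ℂ)) z

theorem inner_wave_eq_ballKernel (R : ℝ) (x y : RN N) :
    inner ℂ (wave R x) (wave R y) = ballKernel R (y - x) := by
  rw [inner_wave_wave, ballKernel, Real.fourier_eq]

theorem continuous_ballKernel (R : ℝ) : Continuous (ballKernel R : RN N → ℂ) := by
  refine VectorFourier.fourierIntegral_continuous Real.continuous_fourierChar
    (by exact continuous_inner) ?_
  exact (integrable_indicator_iff measurableSet_ball).2
    (integrableOn_const measure_ball_lt_top.ne)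

/-- This is the Riemann–Lebesgue lemma; it makes truncated waves at distant points almost
orthogonal. -/
theorem tendsto_ballKernel (R : ℝ) : Tendsto (ballKernel R : RN N → ℂ) (cocompact _) (𝓝 0) := by
  have := tendsto_integral_exp_inner_smul_cocompact
    ((Metric.ball (0 : RN N) R).indicator fun _ => (1 : ℂ))
  simp only [← Real.fourier_eq] at this
  exact this

theorem ballKernel_zero (R : ℝ) :
    ballKernel R (0 : RN N) = ((volume (Metric.ball (0 : RN N) R)).toReal : ℂ) := by
  rw [← norm_wave_sq R 0, ← sub_self (0 : RN N), ← inner_wave_eq_ballKernel]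
  have h := inner_self_eq_norm_sq_to_K (𝕜 := ℂ) (wave R (0 : RN N))
  rw [sub_self, h]
  simp

/-- The squared distance of two waves is 2(k(0) - Re k(y - x)) with k the ball kernel, which is
continuous. Hence low frequency parts of an L²-bounded family are uniformly equicontinuous. -/
theorem exists_norm_wave_sub_le (R : ℝ) {ε : ℝ} (hε : 0 < ε) :
    ∃ δ > 0, ∀ x y : RN N, dist x y < δ → ‖wave R x - wave R y‖ ≤ ε := by
  obtain ⟨δ, hδ, h⟩ := Metric.continuousAt_iff.1
    ((continuous_ballKernel (N := N) R).continuousAt (x := 0)) (ε ^ 2 / 2) (by positivity)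
  refine ⟨δ, hδ, fun x y hxy => ?_⟩
  have h1 := @norm_sub_sq ℂ _ _ _ _ (wave R x) (wave R y)
  rw [inner_wave_eq_ballKernel, norm_wave_sq, norm_wave_sq] at h1
  have h2 := h (x := y - x) (by rwa [dist_zero_right, ← dist_eq_norm, dist_comm])
  rw [ballKernel_zero, dist_comm, dist_eq_norm] at h2
  have h3 := (Complex.abs_re_le_norm _).trans_lt h2
  rw [Complex.sub_re, Complex.ofReal_re] at h3
  have h4 := (abs_lt.1 h3).2
  refine le_of_sq_le_sq ?_ hε.le
  rw [h1]
  change _ - 2 * (ballKernel R (y - x)).re + _ ≤ _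
  linarith

theorem compMeasurePreserving_fourierL2 (A : RN N ≃ₗᵢ[ℝ] RN N) (u : Hsr N s) :
    Lp.compMeasurePreserving A A.measurePreserving (fourierL2 N (Hsr.toL2 u)) =
      fourierL2 N (Hsr.toL2 u) := by
  rw [fourierL2_eq, ← fourier_compMeasurePreserving]
  congr 1
  refine Lp.ext ?_
  obtain ⟨f, hf⟩ := exists_radial u
  filter_upwards [Lp.coeFn_compMeasurePreserving (complexify (Hsr.toL2 u)) A.measurePreserving,
    A.measurePreserving.quasiMeasurePreserving.ae_eq_comp (coeFn_complexify (Hsr.toL2 u)),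
    coeFn_complexify (Hsr.toL2 u), hf, A.measurePreserving.quasiMeasurePreserving.ae hf]
    with x h1 h2 h3 h4 h5
  rw [h1, h2, h3, Function.comp_apply, h4, h5, A.norm_map]

theorem compMeasurePreserving_wave (A : RN N ≃ₗᵢ[ℝ] RN N) (R : ℝ) (x : RN N) :
    Lp.compMeasurePreserving A A.measurePreserving (wave R (A x)) = wave R x := by
  refine Lp.ext ?_
  filter_upwards [Lp.coeFn_compMeasurePreserving (wave R (A x)) A.measurePreserving,
    A.measurePreserving.quasiMeasurePreserving.ae_eq_comp (memLp_waveFun R (A x)).coeFn_toLp,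
    (memLp_waveFun R x).coeFn_toLp] with ξ h1 h2 h3
  rw [h1, wave, h2, wave, h3, Function.comp_apply, waveFun, waveFun]
  simp only [indicator, mem_ball_zero_iff, A.norm_map, A.inner_map_map]

theorem lowPass_comp_isometry (A : RN N ≃ₗᵢ[ℝ] RN N) (R : ℝ) (u : Hsr N s) (x : RN N) :
    lowPass R (fourierL2 N (Hsr.toL2 u)) (A x) = lowPass R (fourierL2 N (Hsr.toL2 u)) x := by
  have h := (Lp.compMeasurePreservingₗᵢ (E := ℂ) (p := 2) ℂ A A.measurePreserving).inner_map_map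
    (wave R (A x)) (fourierL2 N (Hsr.toL2 u))
  change inner ℂ (Lp.compMeasurePreserving A A.measurePreserving (wave R (A x)))
    (Lp.compMeasurePreserving A A.measurePreserving (fourierL2 N (Hsr.toL2 u))) = _ at h
  rw [compMeasurePreserving_wave, compMeasurePreserving_fourierL2] at h
  exact h.symm

/-- The reflection in the hyperplane orthogonal to x - y carries x to y, and low frequency parts of
radial functions are invariant under isometries. -/
theorem lowPass_eq_of_norm_eq (R : ℝ) (u : Hsr N s) {x y : RN N} (h : ‖x‖ = ‖y‖) :
    lowPass R (fourierL2 N (Hsr.toL2 u)) x = lowPass R (fourierL2 N (Hsr.toL2 u)) y := by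
  have := lowPass_comp_isometry ((Submodule.span ℝ {x - y})ᗮ.reflection) R u x
  rw [Submodule.reflection_sub h] at this
  exact this.symm

/-- In dimension at least two there are arbitrarily many unit vectors. -/
theorem exists_unit_vectors (hN : 2 ≤ N) :
    ∃ e : ℕ → RN N, Function.Injective e ∧ ∀ j, ‖e j‖ = 1 := by
  let v : ℕ → RN N := fun j =>
    EuclideanSpace.single ⟨0, by omega⟩ 1 + EuclideanSpace.single ⟨1, by omega⟩ (j : ℝ)
  have hv0 : ∀ j, v j ⟨0, by omega⟩ = 1 := by intro j; simp [v]
  have hv1 : ∀ j, v j ⟨1, by omega⟩ = j := by intro j; simp [v]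
  have hv : ∀ j, ‖v j‖ ≠ 0 := by
    intro j h
    have := hv0 j
    rw [norm_eq_zero.1 h] at this
    simp at this
  refine ⟨fun j => ‖v j‖⁻¹ • v j, fun i j hij => ?_, fun j => ?_⟩
  · have h0 := congrArg (fun w : RN N => w ⟨0, by omega⟩) hij
    have h1 := congrArg (fun w : RN N => w ⟨1, by omega⟩) hij
    simp only [PiLp.smul_apply, hv0, hv1, smul_eq_mul, mul_one] at h0 h1
    rw [h0] at h1
    exact_mod_cast mul_left_cancel₀ (inv_ne_zero (hv j)) h1
  · rw [norm_smul, norm_inv, norm_norm, inv_mul_cancel₀ (hv j)]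

theorem norm_sum_wave_sq_le (R : ℝ) {k : ℕ} (y : Fin k → RN N) {δ : ℝ}
    (h : ∀ i j, i ≠ j → ‖ballKernel R (y j - y i)‖ ≤ δ) (hδ : 0 ≤ δ) :
    ‖∑ i, wave R (y i)‖ ^ 2 ≤ k * (volume (Metric.ball (0 : RN N) R)).toReal + k ^ 2 * δ := by
  have h1 : ((‖∑ i, wave R (y i)‖ ^ 2 : ℝ) : ℂ) =
      ∑ i, ∑ j, inner ℂ (wave R (y i)) (wave R (y j)) := by
    have := inner_self_eq_norm_sq_to_K (𝕜 := ℂ) (∑ i, wave R (y i))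
    rw [sum_inner] at this
    simp only [inner_sum] at this
    rw [this]
    simp
  have h2 : ‖∑ i, wave R (y i)‖ ^ 2 = ‖((‖∑ i, wave R (y i)‖ ^ 2 : ℝ) : ℂ)‖ := by
    rw [Complex.norm_real, Real.norm_eq_abs, abs_of_nonneg (by positivity)]
  rw [h2, h1]
  have h3 : ∀ i j, ‖(inner ℂ (wave R (y i)) (wave R (y j)) : ℂ)‖ ≤
      (if i = j then (volume (Metric.ball (0 : RN N) R)).toReal else 0) + δ := by
    intro i j
    rw [inner_wave_eq_ballKernel]
    split_ifs with hij
    · subst hij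
      rw [sub_self, ballKernel_zero, Complex.norm_real, Real.norm_eq_abs,
        abs_of_nonneg ENNReal.toReal_nonneg]
      linarith
    · rw [zero_add]
      exact h i j hij
  calc _ ≤ ∑ i, ∑ j, ((if i = j then (volume (Metric.ball (0 : RN N) R)).toReal else 0) + δ) := by
        refine (norm_sum_le _ _).trans (Finset.sum_le_sum fun i _ => ?_)
        exact (norm_sum_le _ _).trans (Finset.sum_le_sum fun j _ => h3 i j)
    _ = _ := by
        simp only [Finset.sum_add_distrib, Finset.sum_ite_eq, Finset.mem_univ, if_true,
          Finset.sum_const, Finset.card_univ, Fintype.card_fin, nsmul_eq_mul]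
        ring

/-- Low frequency parts of radial functions decay uniformly at infinity. -/
theorem exists_lowPass_decay (hN : 2 ≤ N) (R : ℝ) {η : ℝ} (hη : 0 < η) :
    ∃ ρ : ℝ, ∀ u : Hsr N s, ∀ x : RN N, ρ ≤ ‖x‖ →
      ‖lowPass R (fourierL2 N (Hsr.toL2 u)) x‖ ≤ η * ‖Hsr.toL2 u‖ := by
  set vol := (volume (Metric.ball (0 : RN N) R)).toReal with hvol
  have hvol0 : 0 ≤ vol := ENNReal.toReal_nonneg
  -- With k points the normalised diagonal contribution vol / k is below η²/2; δ = η²/2 reserves the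
  -- other half for the off-diagonal terms.
  obtain ⟨k, hk⟩ := exists_nat_gt (2 * vol / η ^ 2)
  have hk0 : (0 : ℝ) < k := lt_of_le_of_lt (by positivity) hk
  set δ := η ^ 2 / 2 with hδ
  have hδ0 : 0 < δ := by positivity
  obtain ⟨e, he, he1⟩ := exists_unit_vectors hN
  have hev : ∀ᶠ r : ℝ in atTop, ∀ i j : Fin k, i ≠ j →
      ‖ballKernel R (r • (e j - e i))‖ ≤ δ := by
    refine eventually_all.2 fun i => eventually_all.2 fun j => ?_
    by_cases hij : i = j
    · exact .of_forall fun r h => absurd hij h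
    · have hne : 0 < ‖e j - e i‖ := by
        rw [norm_pos_iff, sub_ne_zero]
        exact fun h => hij (Fin.ext (he h).symm)
      have h1 : Tendsto (fun r : ℝ => r • (e j - e i)) atTop (cocompact (RN N)) := by
        rw [← Metric.cobounded_eq_cocompact, ← tendsto_norm_atTop_iff_cobounded]
        have : Tendsto (fun r : ℝ => r * ‖e j - e i‖) atTop atTop :=
          tendsto_id.atTop_mul_const hne
        refine tendsto_atTop_mono' _ ?_ this
        filter_upwards with r
        rw [norm_smul]
        gcongr
        exact le_abs_self r
      have h2 := ((tendsto_ballKernel (N := N) R).comp h1).norm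
      rw [norm_zero] at h2
      filter_upwards [h2.eventually_le_const hδ0] with r hr _
      exact hr
  obtain ⟨ρ, hρ⟩ := eventually_atTop.1 hev
  refine ⟨ρ, fun u x hx => ?_⟩
  set f := fourierL2 N (Hsr.toL2 u) with hf
  -- The value at x is repeated at k points of the sphere through x. For large ‖x‖ their waves are
  -- almost orthogonal, so the sum has norm about √k rather than k.
  have h1 : (k : ℂ) * lowPass R f x = inner ℂ (∑ i : Fin k, wave R (‖x‖ • e i)) f := by
    rw [sum_inner]
    have h2 : ∀ i : Fin k, inner ℂ (wave R (‖x‖ • e i)) f = lowPass R f x := by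
      intro i
      refine lowPass_eq_of_norm_eq R u ?_
      rw [norm_smul, he1, norm_norm, mul_one]
    simp [h2]
  have h3 := norm_sum_wave_sq_le R (fun i : Fin k => ‖x‖ • e i) (δ := δ)
    (fun i j hij => by rw [← smul_sub]; exact hρ ‖x‖ hx i j hij) hδ0.le
  have h4 : ‖∑ i : Fin k, wave R (‖x‖ • e i)‖ ≤ k * η := by
    refine le_of_sq_le_sq (h3.trans ?_) (by positivity)
    rw [div_lt_iff₀ (by positivity)] at hk
    have h5 : (k : ℝ) * vol ≤ k * (k * η ^ 2 / 2) := by gcongr; linarith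
    rw [hδ]
    nlinarith
  have h5 : (k : ℝ) * ‖lowPass R f x‖ ≤ k * (η * ‖Hsr.toL2 u‖) := by
    have h6 : (k : ℝ) * ‖lowPass R f x‖ = ‖(k : ℂ) * lowPass R f x‖ := by
      rw [norm_mul, Complex.norm_natCast]
    rw [h6, h1]
    refine (norm_inner_le_norm _ _).trans ?_
    rw [hf, norm_fourierL2, ← mul_assoc]
    gcongr
  exact le_of_mul_le_mul_left h5 hk0

/-- Bounded sequences of `H^s_r` have subsequences that are Cauchy in measure. -/
theorem exists_subseq_cauchy_in_measure (hN : 2 ≤ N) (hs : 0 < s) {u : ℕ → Hsr N s} {M : ℝ}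
    (hu : ∀ n, ‖u n‖ ≤ M) : ∃ φ : ℕ → ℕ, StrictMono φ ∧ ∀ η > 0, ∀ κ > 0, ∃ n₀, ∀ n ≥ n₀, ∀ k ≥ n₀,
      volume {x | η < |(u (φ n) - u (φ k)) x|} ≤ ENNReal.ofReal κ := by
  have hM0 : 0 ≤ M := (norm_nonneg _).trans (hu 0)
  let q := TopologicalSpace.denseSeq (RN N)
  -- Low frequency parts are sampled at all integer cut-offs and all points of a dense sequence.
  -- Compactness of the countable product gives one subsequence serving every η and κ.
  let c : ℕ → ℕ × ℕ → ℂ := fun n p => lowPass p.1 (fourierL2 N (Hsr.toL2 (u n))) (q p.2)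
  have hc : ∀ n, c n ∈ Set.univ.pi fun p : ℕ × ℕ => Metric.closedBall (0 : ℂ)
      (√(volume (Metric.ball (0 : RN N) (p.1 : ℝ))).toReal * M) := by
    intro n p _
    rw [mem_closedBall_zero_iff]
    refine (norm_lowPass_le _ _ _).trans ?_
    rw [norm_fourierL2]
    gcongr
    exact (norm_toL2_le _).trans (hu n)
  obtain ⟨a, -, φ, hφ, hlim⟩ := (isCompact_univ_pi fun p : ℕ × ℕ => isCompact_closedBall (0 : ℂ)
      (√(volume (Metric.ball (0 : RN N) (p.1 : ℝ))).toReal * M)).tendsto_subseq hc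
  refine ⟨φ, hφ, fun η hη κ hκ => ?_⟩
  have hdiff : ∀ n k, ‖u n - u k‖ ≤ 2 * M := fun n k =>
    (norm_sub_le _ _).trans (by linarith [hu n, hu k])
  -- the cut-off frequency
  obtain ⟨R, hR, hR0⟩ : ∃ R : ℕ, 4 / η ^ 2 * ((2 * M) ^ 2 / (2 * Real.pi * R) ^ (2 * s)) ≤ κ ∧ 0 < R := by
    have h1 : Tendsto (fun R : ℕ => (2 * Real.pi * R) ^ (2 * s)) atTop atTop :=
      (tendsto_rpow_atTop (by positivity)).comp
        (tendsto_natCast_atTop_atTop.const_mul_atTop (by positivity))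
    have h2 := (h1.const_div_atTop ((2 * M) ^ 2)).const_mul (4 / η ^ 2)
    rw [mul_zero] at h2
    exact ((h2.eventually_le_const hκ).and (eventually_gt_atTop 0)).exists
  have hR0' : (0 : ℝ) < R := Nat.cast_pos.2 hR0
  obtain ⟨ρ, hρ⟩ := exists_lowPass_decay (s := s) hN (R : ℝ) (η := η / (2 * (2 * M + 1)))
    (by positivity)
  obtain ⟨δ, hδ, hwave⟩ := exists_norm_wave_sub_le (N := N) (R : ℝ) (ε := η / (4 * (2 * M + 1)))
    (by positivity)
  obtain ⟨I, hI⟩ := (isCompact_closedBall (0 : RN N) ρ).elim_finite_subcover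
    (fun i : ℕ => Metric.ball (q i) δ) (fun i => Metric.isOpen_ball) (fun x _ => by
      obtain ⟨i, hi⟩ := (TopologicalSpace.denseRange_denseSeq (RN N)).exists_dist_lt x hδ
      exact mem_iUnion.2 ⟨i, hi⟩)
  have hcau : ∀ i, ∃ n₀, ∀ n ≥ n₀, ∀ k ≥ n₀, ‖c (φ n) (R, i) - c (φ k) (R, i)‖ ≤ η / 4 := by
    intro i
    have h1 : Tendsto (fun n => c (φ n) (R, i)) atTop (𝓝 (a (R, i))) :=
      ((continuous_apply (R, i)).tendsto a).comp hlim
    obtain ⟨n₀, hn₀⟩ := Metric.cauchySeq_iff.1 h1.cauchySeq (η / 4) (by positivity)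
    exact ⟨n₀, fun n hn k hk => by
      rw [← dist_eq_norm]
      exact (hn₀ n hn k hk).le⟩
  choose n₀ hn₀ using hcau
  refine ⟨I.sup n₀, fun n hn k hk => ?_⟩
  set w := u (φ n) - u (φ k) with hw
  have hwn : ‖Hsr.toL2 w‖ ≤ 2 * M := (norm_toL2_le w).trans (hdiff _ _)
  have hlowsub : ∀ x, lowPass R (fourierL2 N (Hsr.toL2 w)) x =
      lowPass R (fourierL2 N (Hsr.toL2 (u (φ n)))) x -
        lowPass R (fourierL2 N (Hsr.toL2 (u (φ k)))) x := by
    intro x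
    rw [hw, map_sub, map_sub]
    exact inner_sub_right _ _ _
  have hfrac : ∀ y : ℝ, 0 ≤ y → y ≤ 2 * M → η / (4 * (2 * M + 1)) * y ≤ η / 4 := by
    intro y hy0 hy
    rw [div_mul_eq_mul_div, div_le_div_iff₀ (by positivity) (by positivity)]
    nlinarith
  -- Far out this is the radial decay. In the ball of radius ρ it holds at the points of a finite
  -- net and extends by equicontinuity.
  have hsmall : ∀ x, ‖lowPass R (fourierL2 N (Hsr.toL2 w)) x‖ ≤ η / 2 := by
    intro x
    rcases le_total ρ ‖x‖ with hx | hx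
    · refine (hρ w x hx).trans ?_
      have := hfrac _ (norm_nonneg _) hwn
      calc _ = 2 * (η / (4 * (2 * M + 1)) * ‖Hsr.toL2 w‖) := by field_simp; ring
        _ ≤ _ := by linarith
    · obtain ⟨i, hi, hxi⟩ := mem_iUnion₂.1 (hI (mem_closedBall_zero_iff.2 hx))
      have h1 : ‖lowPass R (fourierL2 N (Hsr.toL2 w)) (q i)‖ ≤ η / 4 := by
        rw [hlowsub]
        exact hn₀ i n ((Finset.le_sup hi).trans hn) k ((Finset.le_sup hi).trans hk)
      have h2 : ‖lowPass R (fourierL2 N (Hsr.toL2 w)) x -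
          lowPass R (fourierL2 N (Hsr.toL2 w)) (q i)‖ ≤ η / 4 := by
        rw [lowPass, lowPass, ← inner_sub_left]
        refine (norm_inner_le_norm _ _).trans ?_
        rw [norm_fourierL2]
        refine le_trans ?_ (hfrac _ (norm_nonneg _) hwn)
        gcongr
        exact hwave _ _ hxi
      have h3 := norm_add_le (lowPass R (fourierL2 N (Hsr.toL2 w)) x -
          lowPass R (fourierL2 N (Hsr.toL2 w)) (q i)) (lowPass R (fourierL2 N (Hsr.toL2 w)) (q i))
      rw [sub_add_cancel] at h3
      linarith
  refine (volume_lt_le R (Hsr.toL2 w) hη hsmall).trans ?_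
  refine (mul_le_mul' le_rfl (lintegral_high_le hR0' hs w)).trans ?_
  rw [← ENNReal.ofReal_mul (by positivity)]
  refine ENNReal.ofReal_le_ofReal (le_trans ?_ hR)
  have hk2 : kinetic w ≤ (2 * M) ^ 2 := by
    rw [kinetic_eq_norm_sq]
    exact pow_le_pow_left₀ (norm_nonneg _) ((norm_fracLap_le w).trans (hdiff _ _)) 2
  gcongr

end FracNLS
end

/-! ### Pointwise estimates for the nonlinearity. -/

noncomputable section

namespace FracNLS

/-- A continuous nonlinearity that is `o(|t|)` at zero and `o(|t|^{p-1})` at infinity. -/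
structure Subcritical (g : ℝ → ℝ) (p : ℝ) : Prop where
  two_lt : 2 < p
  continuous : Continuous g
  zero : ∀ ε > 0, ∃ δ > 0, ∀ t, |t| ≤ δ → |g t| ≤ ε * |t|
  infty : ∀ ε > 0, ∃ L, ∀ t, L ≤ |t| → |g t| ≤ ε * |t| ^ (p - 1)

/-- The energy density `t² + |t|^p`. -/
def dens (p t : ℝ) : ℝ := t ^ 2 + |t| ^ p

/-- The weight `|t| + |t|^{p-1}`. -/
def wgt (p t : ℝ) : ℝ := |t| + |t| ^ (p - 1)

theorem dens_nonneg (p t : ℝ) : 0 ≤ dens p t := by unfold dens; positivity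

theorem wgt_nonneg (p t : ℝ) : 0 ≤ wgt p t := by unfold wgt; positivity

theorem wgt_mono {p x y : ℝ} (hp : 2 < p) (h : |x| ≤ |y|) : wgt p x ≤ wgt p y :=
  add_le_add h (Real.rpow_le_rpow (abs_nonneg _) h (by linarith))

theorem rpow_sub_one_mul_le {p a b : ℝ} (hp : 2 < p) (ha : 0 ≤ a) (hb : 0 ≤ b) :
    a ^ (p - 1) * b ≤ a ^ p + b ^ p := by
  have key : ∀ c : ℝ, 0 ≤ c → c ^ (p - 1) * c = c ^ p := by
    intro c hc
    rw [← Real.rpow_add_one' hc (by linarith), sub_add_cancel]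
  rcases le_total a b with h | h
  · calc a ^ (p - 1) * b ≤ b ^ (p - 1) * b := by gcongr; linarith
      _ = b ^ p := key b hb
      _ ≤ _ := le_add_of_nonneg_left (by positivity)
  · calc a ^ (p - 1) * b ≤ a ^ (p - 1) * a := by gcongr
      _ = a ^ p := key a ha
      _ ≤ _ := le_add_of_nonneg_right (by positivity)

theorem wgt_mul_le {p : ℝ} (hp : 2 < p) (a b : ℝ) : wgt p a * |b| ≤ dens p a + dens p b := by
  have h1 := rpow_sub_one_mul_le hp (abs_nonneg a) (abs_nonneg b)
  have h2 : |a| * |b| ≤ a ^ 2 + b ^ 2 := by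
    rw [← sq_abs a, ← sq_abs b]
    nlinarith [sq_nonneg (|a| - |b|), sq_nonneg |a|, sq_nonneg |b|]
  rw [wgt, add_mul, dens, dens]
  linarith

theorem dens_add_abs_le {p : ℝ} (hp : 2 < p) (a b : ℝ) :
    dens p (|a| + |b|) ≤ 2 ^ p * (dens p a + dens p b) := by
  have key : ∀ a b : ℝ, |b| ≤ |a| → dens p (|a| + |b|) ≤ 2 ^ p * dens p a := by
    intro a b h
    have h1 : (|a| + |b|) ^ p ≤ 2 ^ p * |a| ^ p := by
      rw [← Real.mul_rpow (by norm_num) (abs_nonneg _)]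
      exact Real.rpow_le_rpow (by positivity) (by linarith) (by linarith)
    have h2 : (|a| + |b|) ^ 2 ≤ 4 * a ^ 2 := by
      rw [← sq_abs a]
      nlinarith [abs_nonneg a, abs_nonneg b]
    have h3 : (4 : ℝ) ≤ 2 ^ p := by
      calc (4 : ℝ) = 2 ^ (2 : ℝ) := by norm_num
        _ ≤ 2 ^ p := Real.rpow_le_rpow_of_exponent_le (by norm_num) hp.le
    rw [dens, dens, abs_of_nonneg (by positivity : 0 ≤ |a| + |b|), mul_add]
    have h4 : 4 * a ^ 2 ≤ 2 ^ p * a ^ 2 := mul_le_mul_of_nonneg_right h3 (sq_nonneg a)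
    linarith
  have h2p : (0 : ℝ) ≤ 2 ^ p := by positivity
  rcases le_total |b| |a| with h | h
  · refine (key a b h).trans ?_
    have := mul_nonneg h2p (dens_nonneg p b)
    linarith
  · rw [add_comm |a|]
    refine (key b a h).trans ?_
    have := mul_nonneg h2p (dens_nonneg p a)
    linarith

namespace Subcritical

variable {g : ℝ → ℝ} {p : ℝ} (hg : Subcritical g p)

include hg

theorem growth {ε : ℝ} (hε : 0 < ε) : ∃ C, 0 ≤ C ∧ ∀ t, |g t| ≤ ε * |t| ^ (p - 1) + C * |t| := by
  obtain ⟨δ, hδ, h0⟩ := hg.zero 1 one_pos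
  obtain ⟨L, hL⟩ := hg.infty ε hε
  obtain ⟨B, hB⟩ := (isCompact_Icc (a := -L) (b := L)).exists_bound_of_continuousOn
    hg.continuous.continuousOn
  refine ⟨1 + |B| / δ, by positivity, fun t => ?_⟩
  have h1 : 0 ≤ ε * |t| ^ (p - 1) := by positivity
  have h2 : 0 ≤ |B| / δ * |t| := by positivity
  rcases le_total |t| δ with h | h
  · have := h0 t h
    linarith
  · rcases le_total L |t| with h' | h'
    · have := hL t h'
      have := abs_nonneg t
      nlinarith
    · have h3 := hB t (abs_le.1 h')
      rw [Real.norm_eq_abs] at h3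
      have h4 : |B| ≤ |B| / δ * |t| := by
        rw [div_mul_eq_mul_div, le_div_iff₀ hδ]
        gcongr
      have := abs_nonneg t
      have := le_abs_self B
      linarith

theorem growth_wgt : ∃ C, 0 ≤ C ∧ ∀ t, |g t| ≤ C * wgt p t := by
  obtain ⟨C, hC, h⟩ := hg.growth one_pos
  refine ⟨1 + C, by positivity, fun t => (h t).trans ?_⟩
  have h1 : 0 ≤ |t| ^ (p - 1) := by positivity
  have h2 := mul_nonneg hC h1
  rw [wgt]
  linarith [abs_nonneg t]

/-- For close arguments: if both are small or both large, the two limits of g apply; otherwise they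
lie in a compact interval, where uniform continuity gives an error εδ/2 that ε|x| absorbs. For
distant arguments a bounded term is added, which convergence in measure will make negligible. -/
theorem oscillation {ε : ℝ} (hε : 0 < ε) : ∃ η > 0, ∃ C, 0 ≤ C ∧ ∀ x y,
    |g x - g y| ≤ ε * (wgt p x + wgt p y) + if η < |x - y| then C else 0 := by
  obtain ⟨δ, hδ, h0⟩ := hg.zero ε hε
  obtain ⟨L, hL⟩ := hg.infty ε hε
  obtain ⟨B, hB⟩ := (isCompact_Icc (a := -L) (b := L)).exists_bound_of_continuousOn
    hg.continuous.continuousOn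
  have huc := (isCompact_Icc (a := -(L + 1)) (b := L + 1)).uniformContinuousOn_of_continuous
    hg.continuous.continuousOn
  obtain ⟨η, hη, hu⟩ := Metric.uniformContinuousOn_iff_le.1 huc (ε * (δ / 2)) (by positivity)
  have hsmall : ∀ t, ε * |t| ≤ ε * wgt p t := fun t => by
    rw [wgt]; gcongr; exact le_add_of_nonneg_right (by positivity)
  have hlarge : ∀ t, ε * |t| ^ (p - 1) ≤ ε * wgt p t := fun t => by
    rw [wgt]; gcongr; exact le_add_of_nonneg_left (abs_nonneg t)
  have hw : ∀ t, 0 ≤ ε * wgt p t := fun t => mul_nonneg hε.le (wgt_nonneg p t)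
  have hall : ∀ t, |g t| ≤ |B| + ε * wgt p t := by
    intro t
    rcases le_total L |t| with h | h
    · linarith [hL t h, hlarge t, abs_nonneg B]
    · have h3 := hB t (abs_le.1 h)
      rw [Real.norm_eq_abs] at h3
      linarith [le_abs_self B, hw t]
  refine ⟨min η (min (δ / 2) 1), by positivity, 2 * |B|, by positivity, fun x y => ?_⟩
  have htri : |g x - g y| ≤ |g x| + |g y| := abs_sub _ _
  rw [mul_add]
  split_ifs with h
  · linarith [hall x, hall y]
  · have h1 : |x - y| ≤ η := (not_lt.1 h).trans (min_le_left _ _)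
    have h2 : |x - y| ≤ δ / 2 := (not_lt.1 h).trans ((min_le_right _ _).trans (min_le_left _ _))
    have h3 : |x - y| ≤ 1 := (not_lt.1 h).trans ((min_le_right _ _).trans (min_le_right _ _))
    have h4 : |y| ≤ |x| + |x - y| := by
      have := abs_sub_abs_le_abs_sub y x
      rw [abs_sub_comm] at this
      linarith
    have h5 : |x| ≤ |y| + |x - y| := by
      have := abs_sub_abs_le_abs_sub x y
      linarith
    rw [add_zero]
    rcases le_total |x| (δ / 2) with hx | hx
    · linarith [h0 x (by linarith), h0 y (by linarith), hsmall x, hsmall y]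
    · by_cases hb : L ≤ |x| ∧ L ≤ |y|
      · linarith [hL x hb.1, hL y hb.2, hlarge x, hlarge y]
      · have hxy : |x| ≤ L + 1 ∧ |y| ≤ L + 1 := by
          rw [not_and_or, not_le, not_le] at hb
          rcases hb with hb | hb <;> constructor <;> linarith
        have := hu x (abs_le.1 hxy.1) y (abs_le.1 hxy.2) (by rwa [Real.dist_eq])
        rw [Real.dist_eq] at this
        have h6 : ε * (δ / 2) ≤ ε * |x| := by gcongr
        linarith [hsmall x, hw y]

/-- The oscillation estimate is integrated along the segment from x to x + v. Its bounded term
occurs only for displacements above η, so it is at most C|v|/η and yields the quadratic remainder.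
-/
theorem primitive_taylor {ε : ℝ} (hε : 0 < ε) : ∃ K, 0 ≤ K ∧ ∀ x v,
    |primitive g (x + v) - primitive g x - g x * v| ≤
      ε * (wgt p (|x| + |v|) * |v|) + K * v ^ 2 := by
  obtain ⟨η, hη, C, hC, hosc⟩ := hg.oscillation (ε := ε / 2) (by positivity)
  refine ⟨C / η, by positivity, fun x v => ?_⟩
  have hint : ∀ a b, IntervalIntegrable g volume a b := fun a b =>
    hg.continuous.intervalIntegrable a b
  have h1 : primitive g (x + v) - primitive g x - g x * v = ∫ τ in x..(x + v), (g τ - g x) := by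
    rw [intervalIntegral.integral_sub (hint _ _) (by simp), intervalIntegral.integral_const,
      primitive, primitive, intervalIntegral.integral_interval_sub_left (hint _ _) (hint _ _)]
    simp [mul_comm]
  have h2 : ∀ τ ∈ uIoc x (x + v), ‖g τ - g x‖ ≤ ε * wgt p (|x| + |v|) + C / η * |v| := by
    intro τ hτ
    have h3 : |τ - x| ≤ |v| := by
      have := abs_sub_left_of_mem_uIcc (uIoc_subset_uIcc hτ)
      simpa using this
    have h4 : |τ| ≤ |(|x| + |v|)| := by
      rw [abs_of_nonneg (by positivity : 0 ≤ |x| + |v|)]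
      have := abs_sub_abs_le_abs_sub τ x
      linarith
    have h5 : |x| ≤ |(|x| + |v|)| := by
      rw [abs_of_nonneg (by positivity : 0 ≤ |x| + |v|)]
      linarith [abs_nonneg v]
    have h6 := wgt_mono hg.two_lt h4
    have h7 := wgt_mono hg.two_lt h5
    have h8 : (if η < |τ - x| then C else 0) ≤ C / η * |v| := by
      split_ifs with h
      · rw [div_mul_eq_mul_div, le_div_iff₀ hη]
        gcongr
        linarith
      · positivity
    rw [Real.norm_eq_abs]
    have h9 := hosc τ x
    have h10 : ε / 2 * (wgt p τ + wgt p x) ≤ ε / 2 * (2 * wgt p (|x| + |v|)) := by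
      gcongr
      linarith
    linarith
  rw [h1, ← Real.norm_eq_abs]
  refine (intervalIntegral.norm_integral_le_of_norm_le_const h2).trans (le_of_eq ?_)
  rw [add_sub_cancel_left, add_mul, ← sq_abs v]
  ring

theorem primitive_growth {ε : ℝ} (hε : 0 < ε) :
    ∃ C, 0 ≤ C ∧ ∀ t, |primitive g t| ≤ ε * |t| ^ p + C * t ^ 2 := by
  obtain ⟨C, hC, h⟩ := hg.growth hε
  have hp := hg.two_lt
  refine ⟨C, hC, fun t => ?_⟩
  have h1 : ∀ τ ∈ uIoc 0 t, ‖g τ‖ ≤ ε * |t| ^ (p - 1) + C * |t| := by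
    intro τ hτ
    have h3 : |τ| ≤ |t| := by
      have := abs_sub_left_of_mem_uIcc (uIoc_subset_uIcc hτ)
      simpa using this
    refine (h τ).trans ?_
    have : |τ| ^ (p - 1) ≤ |t| ^ (p - 1) := Real.rpow_le_rpow (abs_nonneg _) h3 (by linarith)
    gcongr
  rw [← Real.norm_eq_abs]
  refine (intervalIntegral.norm_integral_le_of_norm_le_const h1).trans (le_of_eq ?_)
  rw [sub_zero, add_mul, ← sq_abs t, mul_assoc, ← Real.rpow_add_one' (abs_nonneg _) (by linarith),
    sub_add_cancel]
  ring

theorem continuous_primitive : Continuous (primitive g) :=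
  intervalIntegral.continuous_primitive (fun a b => hg.continuous.intervalIntegrable a b) 0

end Subcritical

end FracNLS
end

/-! ### The potential energy as a C¹ functional. -/

noncomputable section

namespace FracNLS

variable {N : ℕ} {s : ℝ}

theorem aestronglyMeasurable_coe (u : Hsr N s) :
    AEStronglyMeasurable (fun x : RN N => u x) volume := Lp.aestronglyMeasurable _

theorem coeFn_add (u v : Hsr N s) : ∀ᵐ x : RN N, (u + v) x = u x + v x := by
  rw [map_add]; exact Lp.coeFn_add _ _

theorem coeFn_sub (u v : Hsr N s) : ∀ᵐ x : RN N, (u - v) x = u x - v x := by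
  rw [map_sub]; exact Lp.coeFn_sub _ _

theorem coeFn_smul (c : ℝ) (u : Hsr N s) : ∀ᵐ x : RN N, (c • u) x = c * u x := by
  rw [map_smul]; exact Lp.coeFn_smul _ _

theorem coeFn_neg (u : Hsr N s) : ∀ᵐ x : RN N, (-u) x = -u x := by
  rw [map_neg]; exact Lp.coeFn_neg _

theorem integrable_sq (u : Hsr N s) : Integrable fun x : RN N => u x ^ 2 := by
  simpa [Real.norm_eq_abs, sq_abs] using integrable_norm_sq (Hsr.toL2 u)

theorem kinetic_le (u : Hsr N s) : kinetic u ≤ ‖u‖ ^ 2 := by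
  rw [Hsr.norm_sq_eq]; linarith [mass_nonneg u]

theorem mass_le (u : Hsr N s) : mass u ≤ ‖u‖ ^ 2 := by
  rw [Hsr.norm_sq_eq]; linarith [kinetic_nonneg u]

theorem two_lt_critExp (hN : 2 ≤ N) (hs : 0 < s) : 2 < critExp N s := by
  have : (0 : ℝ) < N := by positivity
  unfold critExp
  have : 0 < 4 * s / N := by positivity
  linarith

/-- The Gagliardo–Nirenberg inequality, in terms of Bochner integrals. -/
theorem exists_integral_rpow_le (hN : 2 ≤ N) (hs : 0 < s) : ∃ C, 0 ≤ C ∧ ∀ u : Hsr N s,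
    (Integrable fun x => |u x| ^ critExp N s) ∧
      ∫ x, |u x| ^ critExp N s ≤ C * mass u ^ (2 * s / N) * kinetic u := by
  obtain ⟨C, hC, h⟩ := exists_gagliardo_nirenberg hN hs
  refine ⟨C, hC, fun u => ?_⟩
  have hp := two_lt_critExp hN hs
  have hm : AEStronglyMeasurable (fun x => |u x| ^ critExp N s) volume :=
    (Real.continuous_rpow_const (by linarith)).comp_aestronglyMeasurable
      (continuous_abs.comp_aestronglyMeasurable (aestronglyMeasurable_coe u))
  have h0 : 0 ≤ C * mass u ^ (2 * s / N) * kinetic u :=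
    mul_nonneg (mul_nonneg hC (Real.rpow_nonneg (mass_nonneg u) _)) (kinetic_nonneg u)
  have hnn : 0 ≤ᵐ[volume] fun x => |u x| ^ critExp N s := .of_forall fun x => by
    simp only [Pi.zero_apply]; positivity
  refine ⟨⟨hm, ?_⟩, ?_⟩
  · rw [hasFiniteIntegral_iff_ofReal hnn]
    exact (h u).trans_lt ENNReal.ofReal_lt_top
  · rw [integral_eq_lintegral_of_nonneg_ae hnn hm]
    exact ENNReal.toReal_le_of_le_ofReal h0 (h u)

theorem integrable_dens (hN : 2 ≤ N) (hs : 0 < s) (u : Hsr N s) :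
    Integrable fun x => dens (critExp N s) (u x) :=
  (integrable_sq u).add ((exists_integral_rpow_le hN hs).choose_spec.2 u).1

theorem exists_integral_dens_le (hN : 2 ≤ N) (hs : 0 < s) (M : ℝ) : ∃ Q, 0 ≤ Q ∧
    ∀ u : Hsr N s, ‖u‖ ≤ M → ∫ x, dens (critExp N s) (u x) ≤ Q := by
  obtain ⟨C, hC, h⟩ := exists_integral_rpow_le (s := s) hN hs
  refine ⟨M ^ 2 + C * (M ^ 2) ^ (2 * s / N) * M ^ 2, by positivity, fun u hu => ?_⟩
  have hM : ‖u‖ ^ 2 ≤ M ^ 2 := by gcongr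
  have hm := (mass_le u).trans hM
  have hk := (kinetic_le u).trans hM
  have := mass_nonneg u
  have := kinetic_nonneg u
  unfold dens
  rw [integral_add (integrable_sq u) (h u).1]
  refine add_le_add hm ((h u).2.trans ?_)
  gcongr

variable {g : ℝ → ℝ}

/-- The potential energy `∫ G(u)`. -/
def potential (g : ℝ → ℝ) (u : Hsr N s) : ℝ := ∫ x, primitive g (u x)

theorem aestronglyMeasurable_comp {f : ℝ → ℝ} (hf : Continuous f) (u : Hsr N s) :
    AEStronglyMeasurable (fun x : RN N => f (u x)) volume :=
  hf.comp_aestronglyMeasurable (aestronglyMeasurable_coe u)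

theorem integrable_primitive (hN : 2 ≤ N) (hs : 0 < s) (hg : Subcritical g (critExp N s))
    (u : Hsr N s) : Integrable fun x => primitive g (u x) := by
  obtain ⟨C, hC, h⟩ := hg.primitive_growth one_pos
  refine (((exists_integral_rpow_le hN hs).choose_spec.2 u).1.add
    ((integrable_sq u).const_mul C)).mono' (aestronglyMeasurable_comp hg.continuous_primitive u)
    (.of_forall fun x => ?_)
  simpa using h (u x)

/-- A substitute for Hölder's inequality obtained from a pointwise Young inequality. It is not
homogeneous in h, so norm bounds use it on the unit sphere only. -/
theorem integrable_wgt_mul (hN : 2 ≤ N) (hs : 0 < s) (u v h : Hsr N s) :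
    (Integrable fun x => wgt (critExp N s) (|u x| + |v x|) * |h x|) ∧
      ∫ x, wgt (critExp N s) (|u x| + |v x|) * |h x| ≤
        2 ^ critExp N s * ((∫ x, dens (critExp N s) (u x)) + ∫ x, dens (critExp N s) (v x)) +
          ∫ x, dens (critExp N s) (h x) := by
  have hp := two_lt_critExp hN hs
  have hi := ((integrable_dens hN hs u).add (integrable_dens hN hs v)).const_mul
    (2 ^ critExp N s)
  have hle : ∀ x, wgt (critExp N s) (|u x| + |v x|) * |h x| ≤
      2 ^ critExp N s * (dens (critExp N s) (u x) + dens (critExp N s) (v x)) +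
        dens (critExp N s) (h x) := fun x =>
    (wgt_mul_le hp _ _).trans (add_le_add (dens_add_abs_le hp _ _) le_rfl)
  have hc : Continuous (wgt (critExp N s)) := by
    unfold wgt
    exact continuous_abs.add (continuous_abs.rpow_const fun x => .inr (by linarith))
  have hI : Integrable fun x => wgt (critExp N s) (|u x| + |v x|) * |h x| := by
    refine (hi.add (integrable_dens hN hs h)).mono' ?_ (.of_forall fun x => ?_)
    · exact (hc.comp_aestronglyMeasurable ((aestronglyMeasurable_comp continuous_abs u).add
        (aestronglyMeasurable_comp continuous_abs v))).mul
        (aestronglyMeasurable_comp continuous_abs h)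
    · rw [Real.norm_eq_abs, abs_of_nonneg (mul_nonneg (wgt_nonneg _ _) (abs_nonneg _))]
      exact hle x
  refine ⟨hI, (integral_mono hI (hi.add (integrable_dens hN hs h)) hle).trans_eq ?_⟩
  rw [← integral_add (integrable_dens hN hs u) (integrable_dens hN hs v), ← integral_const_mul]
  exact integral_add hi (integrable_dens hN hs h)

theorem integrable_comp_mul (hN : 2 ≤ N) (hs : 0 < s) (hg : Subcritical g (critExp N s))
    (u h : Hsr N s) : Integrable fun x => g (u x) * h x := by
  obtain ⟨C, hC, hgr⟩ := hg.growth_wgt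
  refine ((integrable_wgt_mul hN hs u 0 h).1.const_mul C).mono'
    ((aestronglyMeasurable_comp hg.continuous u).mul (aestronglyMeasurable_coe h))
    (.of_forall fun x => ?_)
  rw [norm_mul, Real.norm_eq_abs, Real.norm_eq_abs, ← mul_assoc]
  gcongr
  refine (hgr _).trans ?_
  gcongr
  refine wgt_mono hg.two_lt ?_
  rw [abs_of_nonneg (by positivity : 0 ≤ |u x| + |(0 : Hsr N s) x|)]
  linarith [abs_nonneg ((0 : Hsr N s) x)]

/-- The linear functional `h ↦ ∫ g(u) h`. -/
def potentialDerivₗ (hN : 2 ≤ N) (hs : 0 < s) (hg : Subcritical g (critExp N s)) (u : Hsr N s) :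
    Hsr N s →ₗ[ℝ] ℝ where
  toFun h := ∫ x, g (u x) * h x
  map_add' h k := by
    rw [← integral_add (integrable_comp_mul hN hs hg u h) (integrable_comp_mul hN hs hg u k)]
    refine integral_congr_ae ?_
    filter_upwards [coeFn_add h k] with x hx
    rw [hx, mul_add]
  map_smul' c h := by
    rw [RingHom.id_apply, smul_eq_mul, ← integral_const_mul]
    refine integral_congr_ae ?_
    filter_upwards [coeFn_smul c h] with x hx
    rw [hx]
    ring

/-- The derivative `h ↦ ∫ g(u) h` of the potential energy. -/
def potentialDeriv (hN : 2 ≤ N) (hs : 0 < s) (hg : Subcritical g (critExp N s)) (u : Hsr N s) :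
    Hsr N s →L[ℝ] ℝ :=
  (potentialDerivₗ hN hs hg u).mkContinuousOfExistsBound <| by
    obtain ⟨C, hC, hgr⟩ := hg.growth_wgt
    obtain ⟨Q, hQ, hQ'⟩ := exists_integral_dens_le (s := s) hN hs 1
    refine ⟨_, LinearMap.bound_of_sphere_bound one_pos (C * (2 ^ critExp N s *
      ((∫ x, dens (critExp N s) (u x)) + ∫ x, dens (critExp N s) ((0 : Hsr N s) x)) + Q)) _
      fun h hh => ?_⟩
    have hi := integrable_wgt_mul hN hs u 0 h
    refine (norm_integral_le_of_norm_le (hi.1.const_mul C) (.of_forall fun x => ?_)).trans ?_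
    · rw [norm_mul, Real.norm_eq_abs, Real.norm_eq_abs, ← mul_assoc]
      gcongr
      refine (hgr _).trans ?_
      gcongr
      refine wgt_mono hg.two_lt ?_
      rw [abs_of_nonneg (by positivity : 0 ≤ |u x| + |(0 : Hsr N s) x|)]
      linarith [abs_nonneg ((0 : Hsr N s) x)]
    · rw [integral_const_mul]
      gcongr
      refine hi.2.trans ?_
      gcongr
      exact hQ' h (by simpa using (mem_sphere_zero_iff_norm.1 hh).le)

theorem potentialDeriv_apply (hN : 2 ≤ N) (hs : 0 < s) (hg : Subcritical g (critExp N s))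
    (u h : Hsr N s) : potentialDeriv hN hs hg u h = ∫ x, g (u x) * h x := rfl

/-- On bounded sets the derivative of the potential energy varies little between functions that
are close in measure. -/
theorem potentialDeriv_oscillation (hN : 2 ≤ N) (hs : 0 < s) (hg : Subcritical g (critExp N s))
    (M : ℝ) {ε : ℝ} (hε : 0 < ε) : ∃ η > 0, ∃ κ > 0, ∀ u v : Hsr N s, ‖u‖ ≤ M → ‖v‖ ≤ M →
      volume {x | η < |(u - v) x|} ≤ ENNReal.ofReal κ →
      ‖potentialDeriv hN hs hg u - potentialDeriv hN hs hg v‖ ≤ ε := by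
  have hp := hg.two_lt
  obtain ⟨Q, hQ, hQM⟩ := exists_integral_dens_le (s := s) hN hs M
  obtain ⟨R, hR, hR1⟩ := exists_integral_dens_le (s := s) hN hs 1
  set W := 2 ^ critExp N s * (Q + Q) + R with hW
  have hW0 : 0 ≤ W := by positivity
  obtain ⟨η, hη, C, hC, hosc⟩ := hg.oscillation (show 0 < ε / (6 * (W + 1)) by positivity)
  set κ := ε / (3 * (C + 1)) with hκ
  have hκ0 : 0 < κ := by positivity
  -- On the set D where u and v differ by more than η, C|h| ≤ Cκh² + C/κ. Both terms integrate to at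
  -- most Cκ exactly when |D| ≤ κ² and the mass of h is at most 1.
  refine ⟨η, hη, κ ^ 2, by positivity, fun u v hu hv hvol => ?_⟩
  refine ContinuousLinearMap.opNorm_le_of_unit_norm hε.le fun h hh => ?_
  rw [sub_apply, potentialDeriv_apply, potentialDeriv_apply,
    ← integral_sub (integrable_comp_mul hN hs hg u h) (integrable_comp_mul hN hs hg v h)]
  have hi := integrable_wgt_mul hN hs u v h
  have hiW : ∫ x, wgt (critExp N s) (|u x| + |v x|) * |h x| ≤ W := by
    rw [hW]
    refine hi.2.trans ?_
    gcongr
    · exact hQM u hu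
    · exact hQM v hv
    · exact hR1 h hh.le
  set D : Set (RN N) := {x | η < |(u - v) x|} with hD
  have hDm : NullMeasurableSet D volume :=
    nullMeasurableSet_lt aemeasurable_const
      (aestronglyMeasurable_comp continuous_abs (u - v)).aemeasurable
  have hDfin : volume D ≠ ⊤ := (hvol.trans_lt ENNReal.ofReal_lt_top).ne
  have hDi : Integrable (D.indicator fun _ => (1 : ℝ)) volume :=
    IntegrableOn.integrable_indicator₀ (integrableOn_const hDfin) hDm
  have hDint : ∫ x, D.indicator (fun _ => (1 : ℝ)) x ≤ κ ^ 2 := by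
    rw [integral_indicator₀ hDm, setIntegral_const, smul_eq_mul, mul_one]
    exact ENNReal.toReal_le_of_le_ofReal (by positivity) hvol
  have hhm : ∫ x, h x ^ 2 ≤ 1 := by simpa [hh, mass] using mass_le h
  have hb := ((hi.1.const_mul (2 * (ε / (6 * (W + 1))))).add
    ((integrable_sq h).const_mul (C * κ))).add (hDi.const_mul (C / κ))
  refine (norm_integral_le_of_norm_le hb ?_).trans ?_
  · filter_upwards [coeFn_sub u v] with x hx
    simp only [Pi.add_apply]
    rw [← sub_mul, norm_mul, Real.norm_eq_abs, Real.norm_eq_abs]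
    have h1 := hosc (u x) (v x)
    rw [← hx] at h1
    have hm1 : wgt (critExp N s) (u x) ≤ wgt (critExp N s) (|u x| + |v x|) :=
      wgt_mono hp (by rw [abs_of_nonneg (by positivity : 0 ≤ |u x| + |v x|)]
                      linarith [abs_nonneg (v x)])
    have hm2 : wgt (critExp N s) (v x) ≤ wgt (critExp N s) (|u x| + |v x|) :=
      wgt_mono hp (by rw [abs_of_nonneg (by positivity : 0 ≤ |u x| + |v x|)]
                      linarith [abs_nonneg (u x)])
    have hE : 0 < ε / (6 * (W + 1)) := by positivity
    set E := ε / (6 * (W + 1))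
    set w := wgt (critExp N s) (|u x| + |v x|)
    have h2 : E * (wgt (critExp N s) (u x) + wgt (critExp N s) (v x)) ≤ 2 * E * w := by
      nlinarith
    have h3 : (if η < |(u - v) x| then C else 0) * |h x| ≤
        C * κ * h x ^ 2 + C / κ * D.indicator (fun _ => (1 : ℝ)) x := by
      by_cases hxD : η < |(u - v) x|
      · rw [if_pos hxD, indicator_of_mem (show x ∈ D from hxD), mul_one]
        have : C * |h x| ≤ C * (κ * h x ^ 2 + 1 / κ) := by
          gcongr
          rw [← sq_abs (h x)]
          have h4 : κ * |h x| ^ 2 + 1 / κ - |h x| =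
            ((κ * |h x| - 1) ^ 2 + κ * |h x|) / κ := by field_simp; ring
          have : 0 ≤ ((κ * |h x| - 1) ^ 2 + κ * |h x|) / κ := by positivity
          linarith
        calc _ ≤ _ := this
          _ = _ := by ring
      · rw [if_neg hxD, indicator_of_notMem (show x ∉ D from hxD), zero_mul]
        positivity
    calc |g (u x) - g (v x)| * |h x|
        ≤ (2 * E * w + if η < |(u - v) x| then C else 0) * |h x| := by
          gcongr
          linarith
      _ ≤ _ := by rw [add_mul]; linarith
  · have hA := (hi.1.const_mul (2 * (ε / (6 * (W + 1))))).add ((integrable_sq h).const_mul (C * κ))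
    have hB := hi.1.const_mul (2 * (ε / (6 * (W + 1))))
    have e1 : ∫ x, ((fun x => 2 * (ε / (6 * (W + 1))) * (wgt (critExp N s) (|u x| + |v x|) * |h x|)) +
        (fun x => C * κ * h x ^ 2) + fun x => C / κ * D.indicator (fun _ => (1 : ℝ)) x) x =
        2 * (ε / (6 * (W + 1))) * (∫ x, wgt (critExp N s) (|u x| + |v x|) * |h x|) +
        C * κ * (∫ x, h x ^ 2) + C / κ * ∫ x, D.indicator (fun _ => (1 : ℝ)) x := by
      rw [integral_add' hA (hDi.const_mul _), integral_add' hB ((integrable_sq h).const_mul (C * κ)),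
        integral_const_mul, integral_const_mul, integral_const_mul]
    rw [e1]
    have hCκ : C * κ ≤ ε / 3 := by
      rw [hκ, mul_div_assoc', div_le_div_iff₀ (by positivity) (by positivity)]
      nlinarith
    have hW1 : 2 * (ε / (6 * (W + 1))) * W ≤ ε / 3 := by
      rw [mul_div_assoc', div_mul_eq_mul_div, div_le_div_iff₀ (by positivity) (by positivity)]
      nlinarith
    calc _ ≤ 2 * (ε / (6 * (W + 1))) * W + C * κ * 1 + C / κ * κ ^ 2 := by gcongr
      _ = 2 * (ε / (6 * (W + 1))) * W + C * κ + C * κ := by field_simp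
      _ ≤ ε := by linarith

/-- Chebyshev's inequality. -/
theorem volume_lt_abs_le (u : Hsr N s) {η : ℝ} (hη : 0 < η) :
    volume {x | η < |u x|} ≤ ENNReal.ofReal (‖u‖ ^ 2 / η ^ 2) := by
  have hsub : {x | η < |u x|} ⊆ {x | η ^ 2 ≤ u x ^ 2} := fun x hx => by
    have hx' : η < |u x| := hx
    change η ^ 2 ≤ u x ^ 2
    rw [← sq_abs (u x)]
    gcongr
  have h1 := mul_meas_ge_le_integral_of_nonneg (.of_forall fun x => sq_nonneg (u x))
    (integrable_sq u) (η ^ 2)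
  have h2 : (volume {x | η ^ 2 ≤ u x ^ 2}) ≠ ⊤ :=
    ((integrable_sq u).measure_ge_lt_top (by positivity)).ne
  refine (measure_mono hsub).trans ?_
  rw [← ENNReal.ofReal_toReal h2]
  refine ENNReal.ofReal_le_ofReal ?_
  rw [le_div_iff₀ (by positivity), mul_comm]
  exact h1.trans (mass_le u)

/-- Norm convergence gives convergence in measure by Chebyshev, so the oscillation estimate applies.
-/
theorem continuous_potentialDeriv (hN : 2 ≤ N) (hs : 0 < s) (hg : Subcritical g (critExp N s)) :
    Continuous (potentialDeriv hN hs hg) := by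
  rw [Metric.continuous_iff']
  intro u ε hε
  obtain ⟨η, hη, κ, hκ, h⟩ := potentialDeriv_oscillation hN hs hg (‖u‖ + 1) (half_pos hε)
  have h1 : ∀ᶠ v in 𝓝 u, ‖v‖ < ‖u‖ + 1 :=
    continuous_norm.continuousAt.eventually_lt continuousAt_const (by linarith)
  have h2 : ∀ᶠ v in 𝓝 u, ‖v - u‖ ^ 2 / η ^ 2 < κ := by
    have hc : ContinuousAt (fun v => ‖v - u‖ ^ 2 / η ^ 2) u := by fun_prop
    exact hc.eventually_lt continuousAt_const (by simpa using hκ)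
  filter_upwards [h1, h2] with v hv1 hv2
  rw [dist_eq_norm]
  refine (h v u hv1.le (by linarith) ((volume_lt_abs_le _ hη).trans ?_)).trans_lt (by linarith)
  exact ENNReal.ofReal_le_ofReal hv2.le

theorem hasFDerivAt_potential (hN : 2 ≤ N) (hs : 0 < s) (hg : Subcritical g (critExp N s))
    (u : Hsr N s) : HasFDerivAt (potential g) (potentialDeriv hN hs hg u) u := by
  rw [hasFDerivAt_iff_isLittleO_nhds_zero, Asymptotics.isLittleO_iff]
  intro c hc
  obtain ⟨R, hR, hR1⟩ := exists_integral_dens_le (s := s) hN hs 1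
  set W := 2 ^ critExp N s * ((∫ x, dens (critExp N s) (u x)) + R) + R with hW
  have hu0 : 0 ≤ ∫ x, dens (critExp N s) (u x) := integral_nonneg fun x => dens_nonneg _ _
  have hW0 : 0 ≤ W := by positivity
  obtain ⟨K, hK, htay⟩ := hg.primitive_taylor (show 0 < c / (2 * (W + 1)) by positivity)
  set E := c / (2 * (W + 1)) with hE
  have hE0 : 0 < E := by positivity
  have h1 : ∀ᶠ v : Hsr N s in 𝓝 0, ‖v‖ < 1 :=
    continuous_norm.continuousAt.eventually_lt continuousAt_const (by simp)
  have h2 : ∀ᶠ v : Hsr N s in 𝓝 0, K * ‖v‖ < c / 2 := by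
    have hc' : ContinuousAt (fun v : Hsr N s => K * ‖v‖) 0 := by fun_prop
    exact hc'.eventually_lt continuousAt_const (by simpa using hc)
  filter_upwards [h1, h2] with v hv1 hv2
  have hi := integrable_wgt_mul hN hs u v v
  -- Only the last factor is normalised: the weight keeps the original v. This recovers the factor
  -- ‖v‖ that the inhomogeneous estimate lacks.
  have key : ∫ x, wgt (critExp N s) (|u x| + |v x|) * |v x| ≤ ‖v‖ * W := by
    rcases eq_or_ne v 0 with rfl | hv
    · rw [norm_zero, zero_mul]
      exact (integral_eq_zero_of_ae (.of_forall fun x => by simp)).le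
    · have hn : ‖v‖ ≠ 0 := norm_ne_zero_iff.2 hv
      have h3 := (integrable_wgt_mul hN hs u v (‖v‖⁻¹ • v)).2
      have h4 : ‖‖v‖⁻¹ • v‖ = 1 := by rw [norm_smul, norm_inv, norm_norm, inv_mul_cancel₀ hn]
      have h5 : ∫ x, wgt (critExp N s) (|u x| + |v x|) * |v x| =
          ‖v‖ * ∫ x, wgt (critExp N s) (|u x| + |v x|) * |(‖v‖⁻¹ • v) x| := by
        rw [← integral_const_mul]
        refine integral_congr_ae ?_
        filter_upwards [coeFn_smul ‖v‖⁻¹ v] with x hx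
        rw [hx, abs_mul, abs_inv, abs_norm]
        field_simp
      rw [h5, hW]
      refine mul_le_mul_of_nonneg_left (h3.trans ?_) (norm_nonneg v)
      gcongr
      · exact hR1 v hv1.le
      · exact hR1 _ h4.le
  have hv2i := integrable_sq v
  have e1 : potential g (u + v) - potential g u - potentialDeriv hN hs hg u v =
      ∫ x, (primitive g (u x + v x) - primitive g (u x) - g (u x) * v x) := by
    have hcong : (fun x => primitive g ((u + v) x)) =ᵐ[volume]
        fun x => primitive g (u x + v x) := by
      filter_upwards [coeFn_add u v] with x hx
      rw [hx]
    rw [integral_sub, integral_sub, potential, integral_congr_ae hcong]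
    · rfl
    · exact (integrable_primitive hN hs hg (u + v)).congr hcong
    · exact integrable_primitive hN hs hg u
    · exact ((integrable_primitive hN hs hg (u + v)).congr hcong).sub
        (integrable_primitive hN hs hg u)
    · exact integrable_comp_mul hN hs hg u v
  rw [e1]
  refine (norm_integral_le_of_norm_le ((hi.1.const_mul E).add (hv2i.const_mul K))
    (.of_forall fun x => htay (u x) (v x))).trans ?_
  rw [integral_add' (hi.1.const_mul E) (hv2i.const_mul K), integral_const_mul, integral_const_mul]
  have hm : ∫ x, v x ^ 2 ≤ ‖v‖ ^ 2 := mass_le v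
  have hEW : E * W ≤ c / 2 := by
    rw [hE, div_mul_eq_mul_div, div_le_div_iff₀ (by positivity) (by positivity)]
    nlinarith
  calc _ ≤ E * (‖v‖ * W) + K * ‖v‖ ^ 2 := by gcongr
    _ = ‖v‖ * (E * W + K * ‖v‖) := by ring
    _ ≤ ‖v‖ * (c / 2 + c / 2) := by gcongr
    _ = c * ‖v‖ := by ring

theorem contDiff_potential (hN : 2 ≤ N) (hs : 0 < s) (hg : Subcritical g (critExp N s)) :
    ContDiff ℝ 1 (potential g : Hsr N s → ℝ) :=
  contDiff_one_iff_hasFDerivAt.2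
    ⟨_, continuous_potentialDeriv hN hs hg, hasFDerivAt_potential hN hs hg⟩

theorem potential_hsrDil (g : ℝ → ℝ) (a : ℝ) (u : Hsr N s) :
    potential g (hsrDil a u) = Real.exp (N * a) * potential g u := by
  have h1 : potential g (hsrDil a u) = ∫ x : RN N, primitive g (u (Real.exp (-a) • x)) := by
    refine integral_congr_ae ?_
    filter_upwards [coeFn_hsrDil a u] with x hx
    rw [hx]
  rw [h1, Measure.integral_comp_smul volume (fun y => primitive g (u y)), finrank_euclideanSpace,
    Fintype.card_fin, smul_eq_mul, potential, ← Real.exp_nat_mul, ← Real.exp_neg,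
    abs_of_pos (Real.exp_pos _)]
  congr 2
  ring

theorem primitive_neg (hodd : ∀ t, g (-t) = -g t) (t : ℝ) : primitive g (-t) = primitive g t := by
  have h := intervalIntegral.integral_comp_neg (a := 0) (b := t) (f := g)
  simp only [hodd, intervalIntegral.integral_neg, neg_zero] at h
  rw [primitive, primitive, intervalIntegral.integral_symm, ← h, neg_neg]

theorem potential_neg (hodd : ∀ t, g (-t) = -g t) (u : Hsr N s) :
    potential g (-u) = potential g u := by
  refine integral_congr_ae ?_
  filter_upwards [coeFn_neg u] with x hx
  rw [hx, primitive_neg hodd]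

/-- Since g is o(|t|^{p-1}) at infinity, the critical power carries an arbitrarily small
coefficient, and Gagliardo–Nirenberg makes it linear in the kinetic energy. For bounded mass it can
thus be absorbed. -/
theorem exists_abs_potentialDeriv_self_le (hN : 2 ≤ N) (hs : 0 < s)
    (hg : Subcritical g (critExp N s)) {ε : ℝ} (hε : 0 < ε) : ∃ C, 0 ≤ C ∧ ∀ u : Hsr N s,
      |potentialDeriv hN hs hg u u| ≤
        ε * mass u ^ (2 * s / N) * kinetic u + C * mass u := by
  obtain ⟨A, hA, hgn⟩ := exists_integral_rpow_le (s := s) hN hs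
  obtain ⟨C, hC, hgr⟩ := hg.growth (show 0 < ε / (A + 1) by positivity)
  refine ⟨C, hC, fun u => ?_⟩
  have hi := (hgn u).1.const_mul (ε / (A + 1))
  have hj := (integrable_sq u).const_mul C
  refine (norm_integral_le_of_norm_le (f := fun x => g (u x) * u x) (hi.add hj)
    (.of_forall fun x => ?_)).trans ?_
  · rw [norm_mul, Real.norm_eq_abs, Real.norm_eq_abs]
    simp only [Pi.add_apply]
    refine (mul_le_mul_of_nonneg_right (hgr (u x)) (abs_nonneg _)).trans_eq ?_
    have hp := hg.two_lt
    have : |u x| ^ critExp N s = |u x| ^ (critExp N s - 1) * |u x| := by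
      rw [← Real.rpow_add_one' (abs_nonneg _) (by linarith), sub_add_cancel]
    rw [this, ← sq_abs (u x)]
    ring
  · rw [integral_add' hi hj, integral_const_mul, integral_const_mul]
    have h0 : 0 ≤ mass u ^ (2 * s / N) * kinetic u :=
      mul_nonneg (Real.rpow_nonneg (mass_nonneg u) _) (kinetic_nonneg u)
    refine add_le_add ?_ le_rfl
    calc ε / (A + 1) * ∫ x, |u x| ^ critExp N s
        ≤ ε / (A + 1) * (A * mass u ^ (2 * s / N) * kinetic u) := by
          gcongr
          exact (hgn u).2
      _ = (ε / (A + 1) * A) * (mass u ^ (2 * s / N) * kinetic u) := by ring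
      _ ≤ ε * (mass u ^ (2 * s / N) * kinetic u) := by
          gcongr
          rw [div_mul_eq_mul_div, div_le_iff₀ (by positivity)]
          nlinarith
      _ = _ := by ring

theorem subcritical_of_tendsto (hN : 2 ≤ N) (hs : 0 < s) (hc : Continuous g)
    (hodd : ∀ t, g (-t) = -g t) (h0 : Tendsto (fun t => g t / t) (𝓝[≠] 0) (𝓝 0))
    (h1 : Tendsto (fun t => g t / |t| ^ (1 + 4 * s / (N : ℝ))) (cocompact ℝ) (𝓝 0)) :
    Subcritical g (critExp N s) where
  two_lt := two_lt_critExp hN hs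
  continuous := hc
  zero ε hε := by
    obtain ⟨δ, hδ, h⟩ := Metric.tendsto_nhdsWithin_nhds.1 h0 ε hε
    refine ⟨δ / 2, half_pos hδ, fun t ht => ?_⟩
    rcases eq_or_ne t 0 with rfl | hne
    -- The quotient limit says nothing at t = 0; oddness supplies g(0) = 0.
    · have := hodd 0
      rw [neg_zero] at this
      simp [show g 0 = 0 by linarith]
    · have := h hne (by rw [Real.dist_eq, sub_zero]; linarith)
      rw [Real.dist_eq, sub_zero, abs_div, div_lt_iff₀ (abs_pos.2 hne)] at this
      exact this.le
  infty ε hε := by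
    have h2 := h1.eventually (Metric.ball_mem_nhds 0 hε)
    rw [← Metric.cobounded_eq_cocompact, ← comap_norm_atTop, eventually_comap] at h2
    obtain ⟨L, hL⟩ := eventually_atTop.1 h2
    refine ⟨max L 1, fun t ht => ?_⟩
    have h3 : dist _ _ < _ := hL ‖t‖ ((le_max_left _ _).trans ht) t rfl
    have ht0 : 0 < |t| := lt_of_lt_of_le (by positivity) ht
    rw [Real.dist_eq, sub_zero, abs_div,
      abs_of_nonneg (Real.rpow_nonneg (abs_nonneg t) _),
      div_lt_iff₀ (Real.rpow_pos_of_pos ht0 _)] at h3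
    rw [show critExp N s - 1 = 1 + 4 * s / N by unfold critExp; ring]
    exact h3.le

end FracNLS
end

/-! ### The Lagrangian along dilations and its differential. -/

noncomputable section

namespace FracNLS

variable {N : ℕ} {s : ℝ} {g : ℝ → ℝ} {m : ℝ}

theorem lagrangian_eq (z : ℝ × Hsr N s) : lagrangian g m z =
    kinetic z.2 / 2 - potential g z.2 + Real.exp z.1 / 2 * (mass z.2 - m) := rfl

theorem lagrangian_hsrDil (a : ℝ) (z : ℝ × Hsr N s) : lagrangian g m (z.1, hsrDil a z.2) =
    Real.exp ((N - 2 * s) * a) * kinetic z.2 / 2 - Real.exp (N * a) * potential g z.2 +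
      Real.exp z.1 / 2 * (Real.exp (N * a) * mass z.2 - m) := by
  rw [lagrangian_eq, kinetic_hsrDil, mass_hsrDil, potential_hsrDil]

theorem lagrangian_reflect (hodd : ∀ t, g (-t) = -g t) (z : ℝ × Hsr N s) :
    lagrangian g m (reflect z) = lagrangian g m z := by
  simp only [lagrangian_eq, reflect, potential_neg hodd, kinetic_eq_norm_sq, mass_eq_norm_sq,
    map_neg, norm_neg]

theorem pohozaev_eq (hN : 2 ≤ N) (hs : 0 < s) (hg : Subcritical g (critExp N s))
    (z : ℝ × Hsr N s) : pohozaev g z = (N - 2 * s) / 2 * kinetic z.2 +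
      N * (Real.exp z.1 / 2 * mass z.2 - potential g z.2) := by
  rw [pohozaev, integral_sub ((integrable_sq z.2).const_mul _) (integrable_primitive hN hs hg z.2),
    integral_const_mul]
  rfl

/-- Differentiability of the dilations themselves is not needed: each term is an exponential in a
and λ times a C¹ functional of u. -/
theorem contDiff_lagrangian_hsrDil (hN : 2 ≤ N) (hs : 0 < s) (hg : Subcritical g (critExp N s)) :
    ContDiff ℝ 1 fun p : ℝ × (ℝ × Hsr N s) => lagrangian g m (p.2.1, hsrDil p.1 p.2.2) := by
  have hk : ContDiff ℝ 1 fun p : ℝ × (ℝ × Hsr N s) => kinetic p.2.2 := by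
    simp only [kinetic_eq_norm_sq, ← fracLapL_apply]
    exact (fracLapL.contDiff.comp contDiff_snd.snd).norm_sq ℝ
  have hm : ContDiff ℝ 1 fun p : ℝ × (ℝ × Hsr N s) => mass p.2.2 := by
    simp only [mass_eq_norm_sq, ← toL2L_apply]
    exact (toL2L.contDiff.comp contDiff_snd.snd).norm_sq ℝ
  have hp : ContDiff ℝ 1 fun p : ℝ × (ℝ × Hsr N s) => potential g p.2.2 :=
    (contDiff_potential hN hs hg).comp contDiff_snd.snd
  simp only [lagrangian_hsrDil]
  fun_prop

/-- The partial derivative of the Lagrangian in the function variable. -/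
def lagrangianDeriv (hN : 2 ≤ N) (hs : 0 < s) (hg : Subcritical g (critExp N s))
    (z : ℝ × Hsr N s) : Hsr N s →L[ℝ] ℝ :=
  (innerSL ℝ (fracLapL z.2)).comp fracLapL - potentialDeriv hN hs hg z.2 +
    Real.exp z.1 • (innerSL ℝ (toL2L z.2)).comp toL2L

theorem lagrangianDeriv_apply (hN : 2 ≤ N) (hs : 0 < s) (hg : Subcritical g (critExp N s))
    (z : ℝ × Hsr N s) (h : Hsr N s) : lagrangianDeriv hN hs hg z h =
      inner ℝ (fracLap z.2) (fracLap h) - potentialDeriv hN hs hg z.2 h +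
        Real.exp z.1 * inner ℝ (Hsr.toL2 z.2) (Hsr.toL2 h) := rfl

theorem hasFDerivAt_lagrangian (hN : 2 ≤ N) (hs : 0 < s) (hg : Subcritical g (critExp N s))
    (z : ℝ × Hsr N s) :
    HasFDerivAt (fun v => lagrangian g m (z.1, v)) (lagrangianDeriv hN hs hg z) z.2 := by
  have hk := (fracLapL (N := N) (s := s)).hasFDerivAt (x := z.2) |>.norm_sq
  have hm := (toL2L (N := N) (s := s)).hasFDerivAt (x := z.2) |>.norm_sq
  have h := ((hk.const_mul (1 / 2)).sub (hasFDerivAt_potential hN hs hg z.2)).add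
    ((hm.sub_const m).const_mul (Real.exp z.1 / 2))
  refine (h.congr_fderiv ?_).congr_of_eventuallyEq (.of_forall fun v => ?_)
  · ext h
    simp only [lagrangianDeriv_apply, add_apply, sub_apply, smul_apply, 
      ContinuousLinearMap.comp_apply, innerSL_apply_apply, smul_eq_mul, nsmul_eq_mul,
      fracLapL_apply, toL2L_apply]
    push_cast
    ring
  · simp only [lagrangian_eq, kinetic_eq_norm_sq, mass_eq_norm_sq, fracLapL_apply, toL2L_apply,
      Pi.add_apply, Pi.sub_apply]
    ring

theorem hsrDil_zero (u : Hsr N s) : hsrDil 0 u = u := hsr_ext (dil_zero _)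

theorem hasDerivAt_lagrangian_fst (z : ℝ × Hsr N s) :
    HasDerivAt (fun l => lagrangian g m (l, z.2)) (Real.exp z.1 / 2 * (mass z.2 - m)) z.1 := by
  have h := (((Real.hasDerivAt_exp z.1).div_const 2).mul_const (mass z.2 - m)).const_add
    (kinetic z.2 / 2 - potential g z.2)
  exact h

theorem hasDerivAt_lagrangian_dil (hN : 2 ≤ N) (hs : 0 < s) (hg : Subcritical g (critExp N s))
    (z : ℝ × Hsr N s) :
    HasDerivAt (fun a => lagrangian g m (z.1, hsrDil a z.2)) (pohozaev g z) 0 := by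
  simp only [lagrangian_hsrDil]
  have h1 : HasDerivAt (fun a : ℝ => Real.exp ((N - 2 * s) * a)) (N - 2 * s) 0 := by
    simpa using ((hasDerivAt_id (0 : ℝ)).const_mul ((N : ℝ) - 2 * s)).exp
  have h2 : HasDerivAt (fun a : ℝ => Real.exp (N * a)) N 0 := by
    simpa using ((hasDerivAt_id (0 : ℝ)).const_mul (N : ℝ)).exp
  have h := (((h1.mul_const (kinetic z.2)).div_const 2).sub (h2.mul_const (potential g z.2))).add
    (((h2.mul_const (mass z.2)).sub_const m).const_mul (Real.exp z.1 / 2))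
  refine h.congr_deriv ?_
  rw [pohozaev_eq hN hs hg]
  ring

theorem fderiv_lagrangian_hsrDil_dil (hN : 2 ≤ N) (hs : 0 < s) (hg : Subcritical g (critExp N s))
    (z : ℝ × Hsr N s) :
    fderiv ℝ (fun p : ℝ × (ℝ × Hsr N s) => lagrangian g m (p.2.1, hsrDil p.1 p.2.2)) (0, z)
      (1, 0) = pohozaev g z := by
  have hd := ((contDiff_lagrangian_hsrDil (m := m) hN hs hg).differentiable one_ne_zero
    (0, z)).hasFDerivAt
  have hc : HasDerivAt (fun a : ℝ => (a, z)) ((1 : ℝ), (0 : ℝ × Hsr N s)) 0 :=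
    (hasDerivAt_id (0 : ℝ)).prodMk (hasDerivAt_const (0 : ℝ) z)
  have h := hd.comp_hasDerivAt (0 : ℝ) hc
  exact h.unique (hasDerivAt_lagrangian_dil (m := m) hN hs hg z)

theorem fderiv_lagrangian_hsrDil_fst (hN : 2 ≤ N) (hs : 0 < s) (hg : Subcritical g (critExp N s))
    (z : ℝ × Hsr N s) :
    fderiv ℝ (fun p : ℝ × (ℝ × Hsr N s) => lagrangian g m (p.2.1, hsrDil p.1 p.2.2)) (0, z)
      (0, (1, 0)) = Real.exp z.1 / 2 * (mass z.2 - m) := by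
  have hd := ((contDiff_lagrangian_hsrDil (m := m) hN hs hg).differentiable one_ne_zero
    (0, z)).hasFDerivAt
  have hc : HasDerivAt (fun l : ℝ => ((0 : ℝ), (l, z.2))) ((0 : ℝ), ((1 : ℝ), (0 : Hsr N s))) z.1 :=
    (hasDerivAt_const z.1 (0 : ℝ)).prodMk
      ((hasDerivAt_id z.1).prodMk (hasDerivAt_const z.1 z.2))
  have h := hd.comp_hasDerivAt z.1 hc
  refine h.unique ((hasDerivAt_lagrangian_fst (g := g) z).congr_of_eventuallyEq
    (.of_forall fun l => ?_))
  simp [hsrDil_zero]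

theorem fderiv_lagrangian_hsrDil_snd (hN : 2 ≤ N) (hs : 0 < s) (hg : Subcritical g (critExp N s))
    (z : ℝ × Hsr N s) (h : Hsr N s) :
    fderiv ℝ (fun p : ℝ × (ℝ × Hsr N s) => lagrangian g m (p.2.1, hsrDil p.1 p.2.2)) (0, z)
      (0, (0, h)) = lagrangianDeriv hN hs hg z h := by
  have hd := ((contDiff_lagrangian_hsrDil (m := m) hN hs hg).differentiable one_ne_zero
    (0, z)).hasFDerivAt
  have hc : HasFDerivAt (fun v : Hsr N s => ((0 : ℝ), (z.1, v)))
      ((ContinuousLinearMap.inr ℝ ℝ (ℝ × Hsr N s)).comp (ContinuousLinearMap.inr ℝ ℝ (Hsr N s)))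
      z.2 :=
    ((hasFDerivAt_const (0 : ℝ) z.2).prodMk
      ((hasFDerivAt_const z.1 z.2).prodMk (hasFDerivAt_id z.2))).congr_fderiv (by ext <;> rfl)
  have h1 := hd.comp z.2 hc
  have h2 := h1.unique ((hasFDerivAt_lagrangian (m := m) hN hs hg z).congr_of_eventuallyEq
    (.of_forall fun l => by simp [hsrDil_zero]))
  exact DFunLike.congr_fun h2 h

/-- Only this inclusion is needed: a neighbourhood of the Pohozaev critical set is one of any
smaller set. -/
theorem mem_critPSP (hN : 2 ≤ N) (hs : 0 < s) (hg : Subcritical g (critExp N s)) {b : ℝ}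
    {z : ℝ × Hsr N s} (hb : lagrangian g m z = b)
    (h0 : fderiv ℝ (fun p : ℝ × (ℝ × Hsr N s) => lagrangian g m (p.2.1, hsrDil p.1 p.2.2)) (0, z)
      = 0) : z ∈ critPSP N s g m b := by
  have h1 := fderiv_lagrangian_hsrDil_dil (m := m) hN hs hg z
  have h2 := fderiv_lagrangian_hsrDil_fst (m := m) hN hs hg z
  have h3 := fderiv_lagrangian_hsrDil_snd (m := m) hN hs hg z
  simp only [h0, zero_apply] at h1 h2 h3
  refine ⟨hb, h2 ▸ hasDerivAt_lagrangian_fst z, ?_, h1.symm⟩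
  have h4 : lagrangianDeriv hN hs hg z = 0 := ContinuousLinearMap.ext fun h => (h3 h).symm
  exact h4 ▸ hasFDerivAt_lagrangian hN hs hg z

end FracNLS
end

/-! ### The Palais–Smale–Pohozaev condition and the deformation. -/

noncomputable section

namespace FracNLS

variable {N : ℕ} {s : ℝ} {g : ℝ → ℝ} {m : ℝ}

theorem norm_le_one_add (u : Hsr N s) : ‖u‖ ≤ 1 + kinetic u + mass u := by
  have := Hsr.norm_sq_eq u
  nlinarith [sq_nonneg (‖u‖ - 1)]

/-- At negative levels, the Pohozaev functional controls `e^μ` from below, hence the mass. -/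
theorem eventually_exp_ge_and_mass (hN : 2 ≤ N) (hs : 0 < s)
    (hg : Subcritical g (critExp N s)) (hm : 0 < m) {b : ℝ} (hb : b < 0) {z : ℕ → ℝ × Hsr N s}
    (hI : Tendsto (fun n => lagrangian g m (z n)) atTop (𝓝 b))
    (hP : Tendsto (fun n => pohozaev g (z n)) atTop (𝓝 0))
    (hl : Tendsto (fun n => Real.exp (z n).1 / 2 * (mass (z n).2 - m)) atTop (𝓝 0)) :
    ∀ᶠ n in atTop, -b / m ≤ Real.exp (z n).1 ∧ m / 2 ≤ mass (z n).2 ∧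
      mass (z n).2 ≤ 2 * m := by
  have hN0 : (0 : ℝ) < N := by positivity
  have h1 := hP.sub (hI.const_mul (N : ℝ))
  have h2 : ∀ᶠ n in atTop, N * -b / 2 < pohozaev g (z n) - N * lagrangian g m (z n) := by
    refine h1.eventually_const_lt ?_
    nlinarith [mul_pos hN0 (neg_pos.2 hb)]
  have h3 : ∀ᶠ n in atTop,
      |Real.exp (z n).1 / 2 * (mass (z n).2 - m)| < -b / 4 := by
    have := hl.abs
    rw [abs_zero] at this
    exact this.eventually_lt_const (by linarith)
  filter_upwards [h2, h3] with n h4 h5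
  have hE : -b / m ≤ Real.exp (z n).1 := by
    -- Here P - N I equals (N/2) e^μ m minus s times the kinetic energy: potential energy and mass
    -- cancel, and dropping the kinetic term leaves a lower bound for e^μ.
    rw [pohozaev_eq hN hs hg, lagrangian_eq] at h4
    rw [div_le_iff₀ hm]
    have h6 : N * -b < N * (Real.exp (z n).1 * m) := by
      nlinarith [mul_nonneg hs.le (kinetic_nonneg (z n).2)]
    exact (lt_of_mul_lt_mul_left h6 hN0.le).le
  rw [abs_mul, abs_of_pos (by positivity)] at h5
  have h6 : -b / m / 2 * |mass (z n).2 - m| < -b / 4 := by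
    refine lt_of_le_of_lt ?_ h5
    gcongr
  have h7 : |mass (z n).2 - m| < m / 2 := by
    have : -b / m / 2 * (m / 2) = -b / 4 := by field_simp; ring
    rw [← this] at h6
    exact lt_of_mul_lt_mul_left h6 (by have := neg_pos.2 hb; positivity)
  have := abs_lt.1 h7
  exact ⟨hE, by linarith, by linarith⟩

/-- Testing the derivative with u itself bounds the kinetic energy plus e^μ times the mass. One
quarter of the kinetic energy absorbs the nonlinear term and another the small derivative; the mass
bound from below then controls e^μ. -/
theorem eventually_bounded (hN : 2 ≤ N) (hs : 0 < s)
    (hg : Subcritical g (critExp N s)) (hm : 0 < m) {z : ℕ → ℝ × Hsr N s}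
    (hmass : ∀ᶠ n in atTop, m / 2 ≤ mass (z n).2 ∧ mass (z n).2 ≤ 2 * m)
    (hu : Tendsto (fun n => lagrangianDeriv hN hs hg (z n)) atTop (𝓝 0)) :
    ∃ M > 0, ∀ᶠ n in atTop, Real.exp (z n).1 ≤ M ∧ ‖(z n).2‖ ≤ M := by
  have hA : 0 < (2 * m) ^ (2 * s / N) := by positivity
  obtain ⟨C, hC, hΨ⟩ := exists_abs_potentialDeriv_self_le (s := s) hN hs hg
    (show 0 < 1 / (4 * (2 * m) ^ (2 * s / N)) by positivity)
  have h1 : ∀ᶠ n in atTop, ‖lagrangianDeriv hN hs hg (z n)‖ < 1 / 4 := by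
    have := hu.norm
    rw [norm_zero] at this
    exact this.eventually_lt_const (by norm_num)
  set R := C * (2 * m) + 1 / 4 * (1 + 2 * m) with hR
  have hR0 : 0 < R := by positivity
  refine ⟨2 * R / m + (1 + 2 * R + 2 * m), by positivity, ?_⟩
  filter_upwards [h1, hmass] with n hn hmn
  have h2 := lagrangianDeriv_apply hN hs hg (z n) (z n).2
  rw [real_inner_self_eq_norm_sq, real_inner_self_eq_norm_sq, ← kinetic_eq_norm_sq,
    ← mass_eq_norm_sq] at h2
  have hk := kinetic_nonneg (z n).2
  have h3 : lagrangianDeriv hN hs hg (z n) (z n).2 ≤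
      1 / 4 * (1 + kinetic (z n).2 + mass (z n).2) := by
    refine (le_abs_self _).trans (((lagrangianDeriv hN hs hg (z n)).le_opNorm _).trans ?_)
    gcongr
    exact norm_le_one_add _
  have h4 : potentialDeriv hN hs hg (z n).2 (z n).2 ≤
      1 / 4 * kinetic (z n).2 + C * (2 * m) := by
    refine (le_abs_self _).trans ((hΨ _).trans ?_)
    have hm0 := mass_nonneg (z n).2
    have h5 : mass (z n).2 ^ (2 * s / N) ≤ (2 * m) ^ (2 * s / N) :=
      Real.rpow_le_rpow hm0 hmn.2 (by positivity)
    have h6 : 1 / (4 * (2 * m) ^ (2 * s / N)) * mass (z n).2 ^ (2 * s / N) ≤ 1 / 4 := by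
      rw [div_mul_eq_mul_div, div_le_div_iff₀ (by positivity) (by positivity)]
      linarith
    gcongr
    exact hmn.2
  have h7 : kinetic (z n).2 / 2 + Real.exp (z n).1 * (m / 2) ≤ R := by
    have : Real.exp (z n).1 * (m / 2) ≤ Real.exp (z n).1 * mass (z n).2 := by
      gcongr; exact hmn.1
    rw [hR]
    linarith [hmn.2]
  have h8 : 0 ≤ Real.exp (z n).1 * (m / 2) := by positivity
  constructor
  · have : Real.exp (z n).1 ≤ 2 * R / m := by
      rw [le_div_iff₀ hm]; linarith
    have : 0 < 1 + 2 * R + 2 * m := by positivity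
    linarith
  · have : 0 < 2 * R / m := by positivity
    linarith [norm_le_one_add (z n).2, hmn.2]

/-- Strong monotonicity of the quadratic part of the Lagrangian. -/
theorem norm_sub_le_of_lagrangianDeriv (hN : 2 ≤ N) (hs : 0 < s)
    (hg : Subcritical g (critExp N s)) {c M : ℝ} (hc1 : c ≤ 1)
    {z w : ℝ × Hsr N s} (hz : c ≤ Real.exp z.1) (hw : ‖w.2‖ ≤ M) :
    c * ‖z.2 - w.2‖ ≤ ‖lagrangianDeriv hN hs hg z‖ + ‖lagrangianDeriv hN hs hg w‖ +
      ‖potentialDeriv hN hs hg z.2 - potentialDeriv hN hs hg w.2‖ +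
      |Real.exp z.1 - Real.exp w.1| * M := by
  set h := z.2 - w.2 with hh
  -- The difference of the two derivatives is tested with h, keeping e^{z.1} in front of the mass;
  -- the mismatch of the multipliers goes into the last term.
  have e : kinetic h + Real.exp z.1 * mass h = lagrangianDeriv hN hs hg z h -
      lagrangianDeriv hN hs hg w h + (potentialDeriv hN hs hg z.2 - potentialDeriv hN hs hg w.2) h -
      (Real.exp z.1 - Real.exp w.1) * inner ℝ (Hsr.toL2 w.2) (Hsr.toL2 h) := by
    rw [kinetic_eq_norm_sq, mass_eq_norm_sq, ← real_inner_self_eq_norm_sq,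
      ← real_inner_self_eq_norm_sq, lagrangianDeriv_apply, lagrangianDeriv_apply, sub_apply]
    have e1 : inner ℝ (fracLap h) (fracLap h) =
        inner ℝ (fracLap z.2) (fracLap h) - inner ℝ (fracLap w.2) (fracLap h) := by
      rw [← inner_sub_left, ← map_sub]
    have e2 : inner ℝ (Hsr.toL2 h) (Hsr.toL2 h) =
        inner ℝ (Hsr.toL2 z.2) (Hsr.toL2 h) - inner ℝ (Hsr.toL2 w.2) (Hsr.toL2 h) := by
      rw [← inner_sub_left, ← map_sub]
    rw [e1, e2]
    ring
  have h1 : c * ‖h‖ ^ 2 ≤ kinetic h + Real.exp z.1 * mass h := by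
    rw [Hsr.norm_sq_eq]
    nlinarith [kinetic_nonneg h, mass_nonneg h]
  have h2 := abs_le.1 ((lagrangianDeriv hN hs hg z).le_opNorm h)
  have h3 := abs_le.1 ((lagrangianDeriv hN hs hg w).le_opNorm h)
  have h4 := abs_le.1 ((potentialDeriv hN hs hg z.2 - potentialDeriv hN hs hg w.2).le_opNorm h)
  have h5 : |(Real.exp z.1 - Real.exp w.1) * inner ℝ (Hsr.toL2 w.2) (Hsr.toL2 h)| ≤
      |Real.exp z.1 - Real.exp w.1| * (M * ‖h‖) := by
    rw [abs_mul]
    gcongr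
    refine (abs_real_inner_le_norm _ _).trans ?_
    exact mul_le_mul ((norm_toL2_le _).trans hw) (norm_toL2_le _) (norm_nonneg _)
      ((norm_nonneg _).trans hw)
  have h6 := abs_le.1 h5
  rcases (norm_nonneg h).eq_or_lt with h0 | h0
  · rw [← h0, mul_zero]
    have : 0 ≤ M := (norm_nonneg _).trans hw
    positivity
  · refine le_of_mul_le_mul_right ?_ h0
    nlinarith [h2.2, h3.1, h4.2, h6.1]

/-- The Palais–Smale–Pohozaev condition at negative levels. -/
theorem exists_convergent_subseq (hN : 2 ≤ N) (hs : 0 < s)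
    (hg : Subcritical g (critExp N s)) (hm : 0 < m) {b : ℝ} (hb : b < 0) {z : ℕ → ℝ × Hsr N s}
    (hI : Tendsto (fun n => lagrangian g m (z n)) atTop (𝓝 b))
    (hP : Tendsto (fun n => pohozaev g (z n)) atTop (𝓝 0))
    (hl : Tendsto (fun n => Real.exp (z n).1 / 2 * (mass (z n).2 - m)) atTop (𝓝 0))
    (hu : Tendsto (fun n => lagrangianDeriv hN hs hg (z n)) atTop (𝓝 0)) :
    ∃ z₀, ∃ φ : ℕ → ℕ, StrictMono φ ∧ Tendsto (z ∘ φ) atTop (𝓝 z₀) := by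
  have h1 := eventually_exp_ge_and_mass hN hs hg hm hb hI hP hl
  obtain ⟨M, hM, h2⟩ := eventually_bounded hN hs hg hm (h1.mono fun n h => h.2) hu
  obtain ⟨n₀, hn₀⟩ := eventually_atTop.1 (h1.and h2)
  have hbm : 0 < -b / m := div_pos (neg_pos.2 hb) hm
  have hmem : ∀ n, (z (n + n₀)).1 ∈ Icc (Real.log (-b / m)) (Real.log M) := fun n => by
    obtain ⟨⟨h3, -⟩, h4, -⟩ := hn₀ (n + n₀) (Nat.le_add_left _ _)
    exact ⟨(Real.log_le_iff_le_exp hbm).2 h3, (Real.le_log_iff_exp_le hM).2 h4⟩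
  obtain ⟨l, -, φ, hφ, hlim⟩ := isCompact_Icc.tendsto_subseq hmem
  obtain ⟨ψ, hψ, hcm⟩ := exists_subseq_cauchy_in_measure hN hs
    (u := fun n => (z (φ n + n₀)).2) (M := M) fun n => (hn₀ _ (Nat.le_add_left _ _)).2.2
  set ρ : ℕ → ℕ := fun n => φ (ψ n) + n₀ with hρ
  have hρm : StrictMono ρ := fun a c hac => Nat.add_lt_add_right (hφ (hψ hac)) n₀
  have hlρ : Tendsto (fun n => (z (ρ n)).1) atTop (𝓝 l) := hlim.comp hψ.tendsto_atTop
  have hcauchy : CauchySeq fun n => (z (ρ n)).2 := by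
    rw [Metric.cauchySeq_iff]
    intro ε hε
    set c := min (-b / m) 1 with hc
    have hc0 : 0 < c := lt_min hbm one_pos
    -- Four error terms enter the monotonicity estimate, so a fifth for each gives a strict
    -- inequality.
    have hδ : 0 < c * ε / 5 := by positivity
    obtain ⟨η, hη, κ, hκ, hosc⟩ := potentialDeriv_oscillation hN hs hg M hδ
    obtain ⟨n₁, hn₁⟩ := hcm η hη κ hκ
    have hu' : ∀ᶠ n in atTop, ‖lagrangianDeriv hN hs hg (z (ρ n))‖ < c * ε / 5 := by
      have := (hu.comp hρm.tendsto_atTop).norm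
      rw [norm_zero] at this
      exact this.eventually_lt_const hδ
    obtain ⟨n₂, hn₂⟩ := eventually_atTop.1 hu'
    have he : CauchySeq fun n => Real.exp (z (ρ n)).1 :=
      ((Real.continuous_exp.tendsto l).comp hlρ).cauchySeq
    obtain ⟨n₃, hn₃⟩ := Metric.cauchySeq_iff.1 he (c * ε / 5 / M) (by positivity)
    refine ⟨max n₁ (max n₂ n₃), fun i hi j hj => ?_⟩
    simp only [ge_iff_le, max_le_iff] at hi hj
    have hb1 := (hn₀ (ρ i) (Nat.le_add_left _ _))
    have hb2 := (hn₀ (ρ j) (Nat.le_add_left _ _))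
    have key := norm_sub_le_of_lagrangianDeriv hN hs hg (min_le_right _ _)
      ((min_le_left _ _).trans hb1.1.1) hb2.2.2
    have k1 := hn₂ i hi.2.1
    have k2 := hn₂ j hj.2.1
    have k3 := hosc _ _ hb1.2.2 hb2.2.2 (hn₁ i hi.1 j hj.1)
    have k4 : |Real.exp (z (ρ i)).1 - Real.exp (z (ρ j)).1| * M < c * ε / 5 := by
      have := hn₃ i hi.2.2 j hj.2.2
      rwa [Real.dist_eq, lt_div_iff₀ hM] at this
    rw [dist_eq_norm]
    refine lt_of_mul_lt_mul_left ?_ hc0.le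
    nlinarith [mul_pos hc0 hε]
  obtain ⟨u₀, hu₀⟩ := cauchySeq_tendsto_of_complete hcauchy
  exact ⟨(l, u₀), ρ, hρm, hlρ.prodMk_nhds hu₀⟩

theorem exists_lagrangian_deformation (hN : 2 ≤ N) (hs0 : 0 < s) (hs1 : s < 1) (hm : 0 < m)
    (hg : Subcritical g (critExp N s)) (hodd : ∀ t, g (-t) = -g t) {b : ℝ} (hb : b < 0)
    {O : Set (ℝ × Hsr N s)}
    (hO : O ∈ 𝓝ˢ (critPSP N s g m b)) {εbar : ℝ} (hεbar : 0 < εbar) :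
    ∃ ε, 0 < ε ∧ ε < εbar ∧ ∃ η : unitInterval × (ℝ × Hsr N s) → ℝ × Hsr N s, Continuous η ∧
      (∀ z, η (0, z) = z) ∧ (∀ t z, lagrangian g m z ≤ b - εbar → η (t, z) = z) ∧
      (∀ z, Antitone fun t : unitInterval => lagrangian g m (η (t, z))) ∧
      (∀ z, lagrangian g m z ≤ b + ε → z ∉ O → lagrangian g m (η (1, z)) ≤ b - ε) ∧
      (∀ z, lagrangian g m z ≤ b + ε → lagrangian g m (η (1, z)) ≤ b - ε ∨ η (1, z) ∈ O) ∧
      ∀ t z, η (t, reflect z) = reflect (η (t, z)) := by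
  have hsN : s ≤ N := hs1.le.trans (by exact_mod_cast (by omega : 1 ≤ N))
  refine (dilationGroup hs0.le hsN).exists_deformation (I := lagrangian g m)
    (contDiff_lagrangian_hsrDil hN hs0 hg) reflectIso (fun z => ?_) (fun a z => ?_)
    (fun z => lagrangian_reflect hodd z) (fun z hI hd => ?_) (nhdsSet_mono ?_ hO) hεbar
  · simp [reflectIso_apply, reflect]
  · simp [reflectIso_apply, reflect, dilationGroup_op]
  · change Tendsto (fun n => fderiv ℝ (fun p : ℝ × (ℝ × Hsr N s) =>
      lagrangian g m (p.2.1, hsrDil p.1 p.2.2)) (0, z n)) atTop (𝓝 0) at hd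
    have happ : ∀ v, Tendsto (fun n => fderiv ℝ (fun p : ℝ × (ℝ × Hsr N s) =>
      lagrangian g m (p.2.1, hsrDil p.1 p.2.2)) (0, z n) v) atTop (𝓝 0) := fun v =>
      ((ContinuousLinearMap.apply ℝ ℝ v).continuous.tendsto 0).comp hd
    refine exists_convergent_subseq hN hs0 hg hm hb hI ?_ ?_ ?_
    · simpa only [fderiv_lagrangian_hsrDil_dil hN hs0 hg] using happ (1, 0)
    · simpa only [fderiv_lagrangian_hsrDil_fst hN hs0 hg] using happ (0, (1, 0))
    · refine squeeze_zero_norm (fun n => ?_) (by simpa using hd.norm)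
      refine ContinuousLinearMap.opNorm_le_bound _ (norm_nonneg _) fun h => ?_
      rw [← fderiv_lagrangian_hsrDil_snd (m := m) hN hs0 hg]
      refine (ContinuousLinearMap.le_opNorm _ _).trans_eq ?_
      congr 1
      simp [Prod.norm_def]
  · rintro z ⟨h1, h2⟩
    exact mem_critPSP hN hs0 hg h1 h2

end FracNLS

end

theorem theorem7p1 (N : ℕ) (hN : 2 ≤ N) (s : ℝ) (hs0 : 0 < s) (hs1 : s < 1) (m : ℝ) (hm : 0 < m)
    (g : ℝ → ℝ) (hg_cont : Continuous g)
    (hg_zero : Tendsto (fun t : ℝ => g t / t) (𝓝[≠] 0) (𝓝 0))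
    (hg_infty : Tendsto (fun t : ℝ => g t / |t| ^ (1 + 4 * s / (N : ℝ))) (cocompact ℝ) (𝓝 0))
    (hg_pos : ∃ t₀ : ℝ, 0 < t₀ ∧ 0 < FracNLS.primitive g t₀)
    (hg_odd : ∀ t : ℝ, g (-t) = -g t)
    (b : ℝ) (hb : b < 0)
    (O : Set (ℝ × FracNLS.Hsr N s)) (hO : O ∈ 𝓝ˢ (FracNLS.critPSP N s g m b))
    (εbar : ℝ) (hεbar : 0 < εbar) :
    ∃ ε : ℝ, 0 < ε ∧ ε < εbar ∧
      ∃ η : unitInterval × (ℝ × FracNLS.Hsr N s) → ℝ × FracNLS.Hsr N s,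
        Continuous η ∧
        (∀ z, η (0, z) = z) ∧
        (∀ t, ∀ z ∈ FracNLS.sublevel N s g m (b - εbar), η (t, z) = z) ∧
        (∀ z, Antitone (fun t : unitInterval => FracNLS.lagrangian g m (η (t, z)))) ∧
        (∀ t z, FracNLS.lagrangian g m (η (t, z)) ≤ FracNLS.lagrangian g m z) ∧
        (FracNLS.critPSP N s g m b = ∅ →
          ∀ z ∈ FracNLS.sublevel N s g m (b + ε),
            η (1, z) ∈ FracNLS.sublevel N s g m (b - ε)) ∧
        ((FracNLS.critPSP N s g m b).Nonempty →
          (∀ z ∈ FracNLS.sublevel N s g m (b + ε) \ O,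
            η (1, z) ∈ FracNLS.sublevel N s g m (b - ε)) ∧
          (∀ z ∈ FracNLS.sublevel N s g m (b + ε),
            η (1, z) ∈ FracNLS.sublevel N s g m (b - ε) ∪ O)) ∧
        (∀ t z, η (t, FracNLS.reflect z) = FracNLS.reflect (η (t, z))) := by
  have hg := FracNLS.subcritical_of_tendsto hN hs0 hg_cont hg_odd hg_zero hg_infty
  -- When the critical set is empty, the empty set is one of its neighbourhoods. Using it in place
  -- of O removes the exceptional points, which gives the stronger conclusion in that case.
  obtain ⟨U, hUO, hU, hUe⟩ : ∃ U ⊆ O, U ∈ 𝓝ˢ (FracNLS.critPSP N s g m b) ∧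
      (FracNLS.critPSP N s g m b = ∅ → U = ∅) := by
    by_cases h : FracNLS.critPSP N s g m b = ∅
    · exact ⟨∅, empty_subset _, by rw [h, nhdsSet_empty]; exact mem_bot, fun _ => rfl⟩
    · exact ⟨O, Subset.rfl, hO, fun h' => absurd h' h⟩
  obtain ⟨ε, hε, hεb, η, hη, h0, h1, h2, h3, h4, h5⟩ :=
    FracNLS.exists_lagrangian_deformation hN hs0 hs1 hm hg hg_odd hb hU hεbar
  refine ⟨ε, hε, hεb, η, hη, h0, h1, h2, fun t z => ?_, fun he z hz => ?_, fun _ => ⟨?_, ?_⟩, h5⟩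
  · have h := h2 z (show (0 : unitInterval) ≤ t from t.2.1)
    simp only [h0] at h
    exact h
  · exact h3 z hz (by rw [hUe he]; exact notMem_empty z)
  · exact fun z hz => h3 z hz.1 fun hzU => hz.2 (hUO hzU)
  · exact fun z hz => (h4 z hz).imp id fun h => hUO h
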